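/- Let $X,Y$ be (real or complex) Hilbert spaces, $A:X\to Y$ a bounded linear injective operator with non-closed range, $B:\mathcal D(B)\subset X\to X$ an unbounded densely defined self-adjoint strictly positive definite operator, and $G=B^{-1}$, $a=\|G\|$. An index function on $(0,b]$ is a continuous strictly increasing function $f$ on $(0,b]$ with $f(0+)=0$; operator functions $f(G)$ are formed with $f(0)=0$. Let $\varrho$ be an index function on $(0,a]$ and let $0<m\le M$ be such that $$m\,\|\varrho(G)x\|\le\|Ax\|\le M\,\|\varrho(G)x\|\qquad\text{for all }x\in X .$$ For $r\in\mathbb R$ put $\psi_r(t)=t^r\varrho(t)$, $0<t\le a$. Let $p>0$, $E>0$, and let $s\in\mathbb R$ be such that $\psi_s$ is an index function on $(0,a]$ (this is automatic for $s\ge 0$). On $(0,\psi_s(a)^2]$ let $h(t)=[\psi_s^{-1}(\sqrt t)]^{p-s}$ and $w=1/h$. A function $f$ on $(0,b]$ is called operator monotone if $S_1\le S_2$ implies $f(S_1)\le f(S_2)$ for all self-adjoint bounded operators $S_1,S_2$ on $X$ with spectra in $(0,b]$. Assume that one of the following holds: * (high order) $s\ge p$ and $w^2$ is operator monotone on $(0,\psi_s(a)^2]$;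 * (low order) $s\le p$, $h^2$ is operator monotone on $(0,\psi_s(a)^2]$, and $t\mapsto h(t)/\sqrt t$ is (not necessarily strictly) decreasing on $(0,\psi_s(a)^2]$. Assume also that $\xi_p(t)=\psi_p^2(t^{1/(2p)})$ is convex on $(0,a^{2p}]$. Let $x_0\in X$, $M_{p,E}=\{x_0+G^pv:\ v\in X,\ \|v\|\le E\}$, $\alpha_1,\dots,\alpha_n>0$ and $\sigma_n=\sum_{k=1}^n1/\alpha_k$. For data $y^\delta\in Y$ let $x_n^\delta$ be defined by $x_0^\delta=x_0$ and $$x_k^\delta=x_{k-1}^\delta-(A^*A+\alpha_kB^{2s})^{-1}A^*(Ax_{k-1}^\delta-y^\delta),\qquad k=1,\dots,n .$$ Let $\delta>0$ be such that $\delta/(mE)\in\psi_p((0,a])$, and let $\sigma_n$ be chosen a priori by $$\sigma_n^{-1}=\frac{\delta^2}{E^2}\Bigl[\psi_p^{-1}\Bigl(\frac{\delta}{mE}\Bigr)\Bigr]^{2(s-p)} .$$ Then $x_n^\delta$ is well defined for every $y^\delta\in Y$, and there are constants $c_1,c_2,C>0$ depending only on $m,M,E$ such that the following holds. 1. $c_2\delta\in\psi_p((0,a])$,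 and for all $x^\dagger\in M_{p,E}$ and all $y^\delta\in Y$ with $\|Ax^\dagger-y^\delta\|\le\delta$, $$\|x_n^\delta-x^\dagger\|\le c_1\,[\psi_p^{-1}(c_2\delta)]^p .$$ 2. The method is order optimal on $M_{p,E}$: for $R:Y\to X$ let $\Delta(\delta,R)=\sup\{\|Ry^\delta-x^\dagger\|:\ x^\dagger\in M_{p,E},\ y^\delta\in Y,\ \|Ax^\dagger-y^\delta\|\le\delta\}$, and let $R_n y^\delta=x_n^\delta$. If $\delta/(ME)$ belongs to the spectrum of $\psi_p(G)$, then $\Delta(\delta,R_n)\le C\,\inf_{R:Y\to X}\Delta(\delta,R)$. -/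

import Mathlib

open Polynomial

namespace HilbertScale

section

set_option linter.unusedSectionVars false

variable {𝕜 H : Type*} [RCLike 𝕜] [NormedAddCommGroup H] [InnerProductSpace 𝕜 H] [CompleteSpace H]
  [Algebra ℝ (H →L[𝕜] H)] [IsScalarTower ℝ 𝕜 (H →L[𝕜] H)]

theorem ofReal_smul_op (c : ℝ) (S : H →L[𝕜] H) : c • S = (c : 𝕜) • S := by
  rw [← algebraMap_smul 𝕜 c S, RCLike.algebraMap_eq_ofReal]

theorem isSelfAdjoint_aeval (S : H →L[𝕜] H) (hS : IsSelfAdjoint S) (q : ℝ[X]) :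
    IsSelfAdjoint (aeval S q) := by
  induction q using Polynomial.induction_on' with
  | add p q hp hq => simpa using hp.add hq
  | monomial n c =>
    rw [aeval_monomial, ← Algebra.smul_def, ofReal_smul_op]
    rw [isSelfAdjoint_iff, star_smul, star_pow, hS.star_eq]
    simp

theorem isUnit_sq_add (N : H →L[𝕜] H) (hN : IsSelfAdjoint N) (d : ℝ) (hd : 0 < d) :
    IsUnit (N ^ 2 + algebraMap ℝ (H →L[𝕜] H) d) := by
  refine ContinuousLinearMap.isUnit_of_forall_le_norm_inner_map _ (c := ⟨d, hd.le⟩) hd fun x => ?_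
  have h1 : inner 𝕜 ((N ^ 2 + algebraMap ℝ (H →L[𝕜] H) d) x) x
      = ((‖N x‖ ^ 2 + d * ‖x‖ ^ 2 : ℝ) : 𝕜) := by
    have h0 : algebraMap ℝ (H →L[𝕜] H) d = (d : 𝕜) • (1 : H →L[𝕜] H) := by
      rw [Algebra.algebraMap_eq_smul_one, ofReal_smul_op]
    have : inner 𝕜 (N (N x)) x = inner 𝕜 (N x) (N x) := hN.isSymmetric (N x) x
    rw [h0, add_apply, inner_add_left, smul_apply,
      inner_smul_left, pow_two, mul_apply_eq_comp, this,
      inner_self_eq_norm_sq_to_K, one_apply_eq_self,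
      inner_self_eq_norm_sq_to_K, RCLike.conj_ofReal]
    push_cast
    rfl
  rw [h1, RCLike.norm_ofReal, abs_of_nonneg (by positivity)]
  change ‖x‖ ^ 2 * d ≤ _
  nlinarith [sq_nonneg ‖N x‖]

theorem isUnit_aeval_of_irreducible (S : H →L[𝕜] H) (hS : IsSelfAdjoint S) (q : ℝ[X])
    (hq : Irreducible q) (h : ∀ t ∈ spectrum ℝ S, q.eval t ≠ 0) : IsUnit (aeval S q) := by
  by_cases hr : ∃ t, q.IsRoot t
  · obtain ⟨t, ht⟩ := hr
    have h1 : Associated (X - C t) q :=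
      (Polynomial.irreducible_X_sub_C t).associated_of_dvd hq (dvd_iff_isRoot.2 ht)
    have h2 := h1.map (aeval S : ℝ[X] →ₐ[ℝ] _)
    refine h2.isUnit ?_
    have h3 : t ∉ spectrum ℝ S := fun h3 => h t h3 ht
    rw [spectrum.notMem_iff] at h3
    simpa using h3.neg
  · push Not at hr
    obtain ⟨a, b, c, rfl⟩ : ∃ a b c, q = C a * X ^ 2 + C b * X + C c :=
      ⟨_, _, _, eq_quadratic_of_degree_le_two hq.degree_le_two⟩
    simp only [IsRoot.def, eval_add, eval_mul, eval_C, eval_pow, eval_X] at hr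
    have ha : a ≠ 0 := by
      rintro rfl
      by_cases hb : b = 0
      · subst hb
        have hc : c ≠ 0 := by simpa using hr 0
        exact hq.not_isUnit (by simpa using hc)
      · exact hr (-c / b) (by field_simp; ring)
    have hD : b ^ 2 - 4 * a * c < 0 := by
      by_contra! hD
      obtain ⟨x, hx⟩ := exists_quadratic_eq_zero (a := a) (b := b) (c := c) ha
        ⟨√(b ^ 2 - 4 * a * c), (Real.mul_self_sqrt hD).symm⟩
      exact hr x (by linarith)
    have h1 := isUnit_sq_add (aeval S (C (2 * a) * X + C b)) (isSelfAdjoint_aeval S hS _)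
      (4 * a * c - b ^ 2) (by linarith)
    have h2 : (aeval S (C (2 * a) * X + C b)) ^ 2 + algebraMap ℝ (H →L[𝕜] H) (4 * a * c - b ^ 2)
      = aeval S (C (4 * a)) * aeval S (C a * X ^ 2 + C b * X + C c) := by
      rw [← map_pow, ← aeval_C S (4 * a * c - b ^ 2), ← map_add, ← map_mul]
      congr 1
      simp only [map_mul, map_sub, map_pow]
      have e4 : (C 4 : ℝ[X]) = 4 := rfl
      have e2 : (C 2 : ℝ[X]) = 2 := rfl
      rw [e4, e2]
      ring
    rw [h2] at h1
    have h3 : IsUnit (aeval S (C (4 * a))) := by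
      apply IsUnit.map
      exact Polynomial.isUnit_C.2 (by simpa using ha)
    exact (IsUnit.mul_left_iff h3).1 h1

theorem isUnit_aeval (S : H →L[𝕜] H) (hS : IsSelfAdjoint S) (q : ℝ[X]) (hq : q ≠ 0)
    (h : ∀ t ∈ spectrum ℝ S, q.eval t ≠ 0) : IsUnit (aeval S q) := by
  induction q using WfDvdMonoid.induction_on_irreducible with
  | zero => exact absurd rfl hq
  | unit u hu => exact hu.map _
  | mul a i ha hi ih =>
    rw [map_mul]
    refine (isUnit_aeval_of_irreducible S hS i hi fun t ht h0 => h t ht ?_).mul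
      (ih ha fun t ht h0 => h t ht ?_) <;> simp [h0]

theorem spectrum_nonempty_op (S : H →L[𝕜] H) (hS : IsSelfAdjoint S) [Nontrivial H] :
    (spectrum 𝕜 S).Nonempty := by
  by_contra! h
  have h1 := ContinuousLinearMap.spectralRadius_eq_nnnorm S hS
  rw [spectralRadius, h] at h1
  have h2 : S = 0 := by simpa using h1.symm
  rw [h2, spectrum.zero_eq] at h
  simp at h

theorem mem_range_of_mem_spectrum (S : H →L[𝕜] H) (hS : IsSelfAdjoint S) (z : 𝕜)
    (hz : z ∈ spectrum 𝕜 S) : ∃ t ∈ spectrum ℝ S, (t : 𝕜) = z := by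
  have h : RCLike.im z = 0 := by
    by_contra h
    refine hz (ContinuousLinearMap.isUnit_of_forall_le_norm_inner_map _
      (c := ⟨|RCLike.im z|, abs_nonneg _⟩) (abs_pos.2 h) fun x => ?_)
    change ‖x‖ ^ 2 * |RCLike.im z| ≤ _
    refine le_trans (le_of_eq ?_) (RCLike.abs_im_le_norm _)
    have h2 : RCLike.im (inner 𝕜 (S x) x) = 0 := hS.isSymmetric.im_inner_apply_self x
    rw [Algebra.algebraMap_eq_smul_one, sub_apply, inner_sub_left,
      smul_apply, inner_smul_left, one_apply_eq_self,
      inner_self_eq_norm_sq_to_K, map_sub, h2, ← RCLike.ofReal_pow, mul_comm _ ((_ : ℝ) : 𝕜),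
      RCLike.im_ofReal_mul]
    simp [abs_mul]
  refine ⟨RCLike.re z, ?_, ?_⟩
  · rw [← spectrum.algebraMap_mem_iff 𝕜, RCLike.algebraMap_eq_ofReal]
    rwa [← RCLike.conj_eq_iff_re.1 (RCLike.conj_eq_iff_im.2 h)] at hz
  · exact RCLike.conj_eq_iff_re.1 (RCLike.conj_eq_iff_im.2 h)

theorem mem_spectrum_aeval [Nontrivial H] (S : H →L[𝕜] H) (hS : IsSelfAdjoint S) (q : ℝ[X]) (c : ℝ)
    (hc : c ∈ spectrum ℝ (aeval S q)) : ∃ t ∈ spectrum ℝ S, q.eval t = c := by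
  by_contra! h
  have hne : q - C c ≠ 0 := by
    intro h0
    obtain ⟨z, hz⟩ := spectrum_nonempty_op S hS
    obtain ⟨t, ht, -⟩ := mem_range_of_mem_spectrum S hS z hz
    exact h t ht (by rw [sub_eq_zero.1 h0, eval_C])
  have h1 := isUnit_aeval S hS (q - C c) hne fun t ht => by simpa [sub_eq_zero] using h t ht
  refine hc ?_
  rw [spectrum.mem_resolventSet_iff]
  simpa using h1.neg

theorem norm_aeval_le (S : H →L[𝕜] H) (hS : IsSelfAdjoint S) (q : ℝ[X]) [CompactSpace (spectrum ℝ S)] :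
    ‖aeval S q‖ ≤ ‖q.toContinuousMapOn (spectrum ℝ S)‖ := by
  nontriviality H
  have h1 := ContinuousLinearMap.spectralRadius_eq_nnnorm _ (isSelfAdjoint_aeval S hS q)
  have h2 : spectralRadius 𝕜 (aeval S q) ≤ ‖q.toContinuousMapOn (spectrum ℝ S)‖₊ := by
    refine iSup₂_le fun z hz => ?_
    obtain ⟨c, hc, rfl⟩ := mem_range_of_mem_spectrum _ (isSelfAdjoint_aeval S hS q) z hz
    obtain ⟨t, ht, rfl⟩ := mem_spectrum_aeval S hS q c hc
    rw [ENNReal.coe_le_coe]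
    have := (q.toContinuousMapOn (spectrum ℝ S)).norm_coe_le_norm ⟨t, ht⟩
    rw [← NNReal.coe_le_coe]
    simpa using this
  rw [h1, ENNReal.coe_le_coe] at h2
  exact h2

theorem compactSpace_spectrum_real (S : H →L[𝕜] H) : CompactSpace (spectrum ℝ S) := by
  rw [← isCompact_iff_compactSpace]
  rw [← spectrum.preimage_algebraMap 𝕜]
  have h : Topology.IsClosedEmbedding (algebraMap ℝ 𝕜) := by
    refine (Isometry.isClosedEmbedding (AddMonoidHomClass.isometry_of_norm _ fun x => ?_))
    simp
  exact h.isCompact_preimage (spectrum.isCompact S)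

theorem isBoundedSMul_op : IsBoundedSMul ℝ (H →L[𝕜] H) :=
  IsBoundedSMul.of_norm_smul_le fun c S => by
    rw [ofReal_smul_op, norm_smul, RCLike.norm_ofReal, Real.norm_eq_abs]

theorem exists_calculus (S : H →L[𝕜] H) (hS : IsSelfAdjoint S) :
    ∃ φ : C(spectrum ℝ S, ℝ) →⋆ₐ[ℝ] (H →L[𝕜] H),
      Continuous φ ∧ Function.Injective φ ∧
      φ ((ContinuousMap.id ℝ).restrict <| spectrum ℝ S) = S ∧
      (∀ f, spectrum ℝ (φ f) = Set.range f) ∧ ∀ f, IsSelfAdjoint (φ f) := by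
  have := compactSpace_spectrum_real S
  have : IsBoundedSMul ℝ (H →L[𝕜] H) := isBoundedSMul_op
  let e : ℝ[X] →ₐ[ℝ] C(spectrum ℝ S, ℝ) := toContinuousMapOnAlgHom (spectrum ℝ S)
  have hd : DenseRange e := by
    have h := polynomialFunctions.topologicalClosure (spectrum ℝ S)
    intro f
    have : f ∈ (polynomialFunctions (spectrum ℝ S)).topologicalClosure := h ▸ Algebra.mem_top
    rw [← SetLike.mem_coe, Subalgebra.topologicalClosure_coe] at this
    simpa [polynomialFunctions, e] using this
  let ψ : C(spectrum ℝ S, ℝ) →L[ℝ] (H →L[𝕜] H) :=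
    (aeval S : ℝ[X] →ₐ[ℝ] (H →L[𝕜] H)).toLinearMap.extendOfNorm e.toLinearMap
  have hψ : ∀ q : ℝ[X], ψ (e q) = aeval S q := fun q =>
    LinearMap.extendOfNorm_eq (f := (aeval S : ℝ[X] →ₐ[ℝ] (H →L[𝕜] H)).toLinearMap)
      (e := e.toLinearMap) hd ⟨1, fun q => by simpa [e] using norm_aeval_le S hS q⟩ q
  have hsa : ∀ f, IsSelfAdjoint (ψ f) := fun f =>
    hd.induction_on (p := fun f => IsSelfAdjoint (ψ f)) f
      (isClosed_eq (continuous_star.comp ψ.continuous) ψ.continuous)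
      fun q => by rw [hψ]; exact isSelfAdjoint_aeval S hS q
  let φ : C(spectrum ℝ S, ℝ) →⋆ₐ[ℝ] (H →L[𝕜] H) :=
    { toFun := ψ
      map_zero' := map_zero ψ
      map_add' := map_add ψ
      map_one' := by simpa using hψ 1
      map_mul' := fun f g => by
        refine hd.induction_on₂ (p := fun f g => ψ (f * g) = ψ f * ψ g)
          (isClosed_eq (by fun_prop) (by fun_prop)) (fun p q => ?_) f g
        rw [← map_mul, hψ, hψ, hψ, map_mul]
      commutes' := fun c => by
        have := hψ (algebraMap ℝ _ c)
        simpa only [AlgHom.commutes] using this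
      map_star' := fun f => by
        rw [star_trivial, (hsa f).star_eq] }
  have hφ : ∀ q : ℝ[X], φ (e q) = aeval S q := hψ
  have hspec : ∀ f, spectrum ℝ (φ f) = Set.range f := by
    intro f
    refine Set.Subset.antisymm ?_ ?_
    · rw [← ContinuousMap.spectrum_eq_range f]
      exact AlgHom.spectrum_apply_subset φ f
    · rintro _ ⟨t, rfl⟩
      have hcl : IsClosed {g : C(spectrum ℝ S, ℝ) | ¬ IsUnit (algebraMap ℝ (H →L[𝕜] H) (g t) - ψ g)} := by
        have hc : Continuous fun g : C(spectrum ℝ S, ℝ) =>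
            algebraMap ℝ (H →L[𝕜] H) (g t) - ψ g := by
          have := continuous_algebraMap ℝ (H →L[𝕜] H)
          fun_prop
        exact (Units.isOpen.preimage hc).isClosed_compl
      refine hd.induction_on (p := fun g => ¬ IsUnit (algebraMap ℝ (H →L[𝕜] H) (g t) - ψ g)) f hcl
        fun q => ?_
      rw [hψ]
      exact spectrum.subset_polynomial_aeval S q ⟨t, t.2, by simp [e]⟩
  refine ⟨φ, ψ.continuous, ?_, ?_, hspec, hsa⟩
  · rw [injective_iff_map_eq_zero]
    intro f hf
    ext t
    have h1 : f t ∈ spectrum ℝ (φ f) := by rw [hspec]; exact ⟨t, rfl⟩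
    rw [hf] at h1
    cases subsingleton_or_nontrivial (H →L[𝕜] H)
    · simp [spectrum.of_subsingleton] at h1
    · simpa using h1
  · have := hφ X
    rw [aeval_X] at this
    refine Eq.trans (congrArg φ ?_) this
    ext
    simp [e]

/-- On a real or complex Hilbert space `H`, self-adjoint bounded operators have a continuous
functional calculus (Mathlib registers this only for complex scalars). -/
theorem continuousFunctionalCalculus_op :
    ContinuousFunctionalCalculus ℝ (H →L[𝕜] H) IsSelfAdjoint where
  predicate_zero := .zero _
  compactSpace_spectrum := compactSpace_spectrum_real
  spectrum_nonempty S hS := by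
    have : Nontrivial H := by
      by_contra h
      rw [not_nontrivial_iff_subsingleton] at h
      exact not_subsingleton (H →L[𝕜] H) inferInstance
    obtain ⟨z, hz⟩ := spectrum_nonempty_op S hS
    obtain ⟨t, ht, -⟩ := mem_range_of_mem_spectrum S hS z hz
    exact ⟨t, ht⟩
  exists_cfc_of_predicate := exists_calculus

end

noncomputable section

/-- `opFun f S = f(S)`: the continuous functional calculus of a self-adjoint bounded operator `S` on
a real or complex Hilbert space, for a real function `f` that is continuous on the spectrum. -/
def opFun {𝕜 H : Type*} [RCLike 𝕜] [NormedAddCommGroup H] [InnerProductSpace 𝕜 H] [CompleteSpace H]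
    (f : ℝ → ℝ) (S : H →L[𝕜] H) : H →L[𝕜] H :=
  letI : Algebra ℝ (H →L[𝕜] H) := Algebra.compHom (H →L[𝕜] H) (algebraMap ℝ 𝕜)
  haveI : IsScalarTower ℝ 𝕜 (H →L[𝕜] H) := IsScalarTower.of_algebraMap_eq fun _ => rfl
  haveI : ContinuousFunctionalCalculus ℝ (H →L[𝕜] H) IsSelfAdjoint :=
    continuousFunctionalCalculus_op
  cfc f S

/-- An index function `f` on `(0, a]`: continuous, strictly increasing, with `f(0+) = 0`. -/
structure IsIndexFunction (f : ℝ → ℝ) (a : ℝ) : Prop where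
  continuousOn : ContinuousOn f (Set.Ioc 0 a)
  strictMonoOn : StrictMonoOn f (Set.Ioc 0 a)
  tendsto_zero : Filter.Tendsto f (nhdsWithin 0 (Set.Ioi 0)) (nhds 0)

/-- `f(G)` for an index function `f` on `(0, ‖G‖]` and a nonnegative self-adjoint operator `G`, where
`f` is extended to the (possible) spectral value `0` by `f(0) = f(0+) = 0`. -/
def indexOp {𝕜 H : Type*} [RCLike 𝕜] [NormedAddCommGroup H] [InnerProductSpace 𝕜 H]
    [CompleteSpace H] (f : ℝ → ℝ) (G : H →L[𝕜] H) : H →L[𝕜] H :=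
  opFun ((Set.Ioi (0 : ℝ)).indicator f) G

/-- The (bounded) power `G ^ r`, `r ≥ 0`, of a nonnegative self-adjoint operator `G`. -/
def opPow {𝕜 H : Type*} [RCLike 𝕜] [NormedAddCommGroup H] [InnerProductSpace 𝕜 H]
    [CompleteSpace H] (G : H →L[𝕜] H) (r : ℝ) : H →L[𝕜] H :=
  opFun (fun t => t ^ r) G

/-- `B` is an unbounded (densely defined) self-adjoint strictly positive definite operator.
For Mathlib's `LinearPMap`, self-adjointness includes that the domain is dense. -/
structure IsScaleGenerator {𝕜 H : Type*} [RCLike 𝕜] [NormedAddCommGroup H]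
    [InnerProductSpace 𝕜 H] [CompleteSpace H] (B : H →ₗ.[𝕜] H) : Prop where
  dense : Dense (B.domain : Set H)
  selfAdjoint : IsSelfAdjoint B
  pos : ∃ c : ℝ, 0 < c ∧ ∀ x : B.domain, c * ‖(x : H)‖ ^ 2 ≤ RCLike.re (inner 𝕜 (B x) (x : H))
  unbounded : ¬ ∃ c : ℝ, ∀ x : B.domain, ‖B x‖ ≤ c * ‖(x : H)‖

/-- `G = B⁻¹`. (`B G = 1` determines `G`, because a strictly positive `B` is injective.) -/
def IsInverse {𝕜 H : Type*} [RCLike 𝕜] [NormedAddCommGroup H] [InnerProductSpace 𝕜 H]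
    (G : H →L[𝕜] H) (B : H →ₗ.[𝕜] H) : Prop :=
  ∀ x : H, ∃ hx : G x ∈ B.domain, B ⟨G x, hx⟩ = x

/-- For `G = B⁻¹` and real `r`: `x` lies in the domain of `B ^ r` and `B ^ r x = z`. For `r ≥ 0` the
operator `B ^ r` is the inverse of `G ^ r`; for `r < 0` it is the bounded operator `G ^ (-r)`. -/
def PowRel {𝕜 H : Type*} [RCLike 𝕜] [NormedAddCommGroup H] [InnerProductSpace 𝕜 H]
    [CompleteSpace H] (G : H →L[𝕜] H) (r : ℝ) (x z : H) : Prop :=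
  (0 ≤ r → opPow G r z = x) ∧ (r < 0 → opPow G (-r) x = z)

/-- The set `M_{p,E}` of all `x` with `x - x₀ ∈ D(B ^ p)` and `‖x - x₀‖_p = ‖B ^ p (x - x₀)‖ ≤ E`. -/
def smoothSet {𝕜 H : Type*} [RCLike 𝕜] [NormedAddCommGroup H] [InnerProductSpace 𝕜 H]
    [CompleteSpace H] (G : H →L[𝕜] H) (x₀ : H) (p E : ℝ) : Set H :=
  {x | ∃ v : H, PowRel G p (x - x₀) v ∧ ‖v‖ ≤ E}

/-- `f` is operator monotone on `(0, b]`: for self-adjoint operators `S₁ ≤ S₂` on `H` with spectra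
in `(0, b]` one has `f(S₁) ≤ f(S₂)` (`≤` is the semiordering by quadratic forms). -/
def IsOperatorMonotone (𝕜 H : Type*) [RCLike 𝕜] [NormedAddCommGroup H] [InnerProductSpace 𝕜 H]
    [CompleteSpace H] (f : ℝ → ℝ) (b : ℝ) : Prop :=
  ∀ S₁ S₂ : H →L[𝕜] H, IsSelfAdjoint S₁ → IsSelfAdjoint S₂ →
    spectrum 𝕜 S₁ ⊆ (fun t : ℝ => (t : 𝕜)) '' Set.Ioc 0 b →
    spectrum 𝕜 S₂ ⊆ (fun t : ℝ => (t : 𝕜)) '' Set.Ioc 0 b →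
    S₁ ≤ S₂ → opFun f S₁ ≤ opFun f S₂

/-- `ψ_r(t) = t ^ r * ϱ(t)`. -/
def psi (ϱ : ℝ → ℝ) (r t : ℝ) : ℝ := t ^ r * ϱ t

/-- The inverse function of `ψ_r : (0, a] → (0, ψ_r(a)]` (only used on `ψ_r((0, a])`). -/
def psiInv (ϱ : ℝ → ℝ) (a r : ℝ) : ℝ → ℝ := Function.invFunOn (psi ϱ r) (Set.Ioc 0 a)

/-- `h(t) = (ψ_s⁻¹(√t)) ^ (p - s)`, for `t ∈ (0, ψ_s(a)²]`. -/
def hFun (ϱ : ℝ → ℝ) (a s p t : ℝ) : ℝ := (psiInv ϱ a s (Real.sqrt t)) ^ (p - s)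

/-- `w = 1 / h`. -/
def wFun (ϱ : ℝ → ℝ) (a s p t : ℝ) : ℝ := 1 / hFun ϱ a s p t

/-- `σ_n = ∑_{k = 1}^n 1 / α_k`. -/
def sigma (α : ℕ → ℝ) (n : ℕ) : ℝ := ∑ k ∈ Finset.Icc 1 n, 1 / α k

/-- One step `x' = x - (A*A + α B^{2s})⁻¹ A* (A x - y)` of the implicit iteration method, written as
the equation `(A*A + α B^{2s}) (x' - x) = -A* (A x - y)` with `x' - x ∈ D(B^{2s})`. -/
def IsIterationStep {𝕜 X Y : Type*} [RCLike 𝕜] [NormedAddCommGroup X] [InnerProductSpace 𝕜 X]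
    [CompleteSpace X] [NormedAddCommGroup Y] [InnerProductSpace 𝕜 Y] [CompleteSpace Y]
    (A : X →L[𝕜] Y) (G : X →L[𝕜] X) (s α : ℝ) (y : Y) (x x' : X) : Prop :=
  ∃ z : X, PowRel G (2 * s) (x' - x) z ∧
    ContinuousLinearMap.adjoint A (A (x' - x)) + (α : 𝕜) • z
      = - ContinuousLinearMap.adjoint A (A x - y)

/-- `x` is the `n`-th iterate of the implicit iteration method with data `y`, starting value `x₀` and
parameters `α 1, …, α n`. -/
def IsIterate {𝕜 X Y : Type*} [RCLike 𝕜] [NormedAddCommGroup X] [InnerProductSpace 𝕜 X]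
    [CompleteSpace X] [NormedAddCommGroup Y] [InnerProductSpace 𝕜 Y] [CompleteSpace Y]
    (A : X →L[𝕜] Y) (G : X →L[𝕜] X) (s : ℝ) (x₀ : X) (α : ℕ → ℝ) (n : ℕ) (y : Y) (x : X) : Prop :=
  ∃ u : ℕ → X, u 0 = x₀ ∧
    (∀ k ∈ Finset.Icc 1 n, IsIterationStep A G s (α k) y (u (k - 1)) (u k)) ∧ u n = x

/-- The worst case error `Δ(δ, R)` of a method `R : Y → X` on the set `S` of solutions. -/
def worstCaseError {𝕜 X Y : Type*} [RCLike 𝕜] [NormedAddCommGroup X] [InnerProductSpace 𝕜 X]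
    [NormedAddCommGroup Y] [InnerProductSpace 𝕜 Y] (A : X →L[𝕜] Y) (S : Set X) (δ : ℝ)
    (R : Y → X) : ENNReal :=
  ⨆ (x : X) (_ : x ∈ S) (y : Y) (_ : ‖A x - y‖ ≤ δ), ENNReal.ofReal ‖R y - x‖

end

end HilbertScale

open HilbertScale

/-! The substitution `ζ = B^s (x - x₀)` and the operator `T = A B^{-s}` turn the method into
nonstationary iterated Tikhonov regularization for `T`: the iterates are `ζ_n = g_n(T*T) T* (y - A
x₀)`, where `1 - t g_n(t) = ∏ α_k / (t + α_k) ≤ 1 / (1 + σ_n t)`. The link condition squeezes `S =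
T*T / M²` between `(m/M)² ψ_s(G)²` and `ψ_s(G)²`.

Put `q = |p - s|` and `k(t) = (ψ_s⁻¹(√t))^q`; this is `h` in the low order case, `w` in the high
order case, and `k(ψ_s(G)²) = G^q`. Operator monotonicity of `k²` carries the squeeze over to `‖k(S)
x‖ ≤ ‖G^q x‖ ≤ (M/m) ‖k(S) x‖` (`norm_equivalence`). So smoothness measured by `G` becomes
smoothness measured by `T` itself, where filter calculus applies. Since `k` increases and `k/√t`
decreases, `k` grows at a rate between a constant and `√t`, which is what the filters can absorb
(`filter_estimates`).

Write `δ = m E ψ_p(t₀)`; the parameter rule then reads `1/σ_n = m² ψ_s(t₀)²`. The filter bounds give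
two estimates for the error `e = x_n - x†`: it has the form `G^p q` with `‖q‖ ≤ 2 (M/m) E`, and `‖A
e‖ ≤ (1 + M/m) δ` (`exists_error_repr`). Convexity of `ξ_p` gives an interpolation inequality,
Jensen's inequality in the form of a supporting line under the functional calculus
(`norm_opPow_le_of_interpolation`), which combines the two into `‖e‖ ≤ 2 (M/m) E t₀^p`.

For optimality, a spectral value `t₁` of `G` with `ψ_p(t₁) = δ/(ME)` yields approximate
eigenvectors. They provide two elements `x₀ ± u` of `M_{p,E}`, both compatible with the data `A x₀`,
and no method can approximate both to better than `‖u‖`, which is at least `E t₁^p / 4`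
(`le_worstCaseError`). As `ϱ` increases, `t₀^p ≤ (M/m) t₁^p`, so the two bounds match up to a
constant. -/

namespace HilbertScale

/-! ### Rules for the functional calculus and its quadratic forms. -/

section Calculus

set_option linter.unusedSectionVars false

open ContinuousLinearMap

variable {𝕜 H : Type*} [RCLike 𝕜] [NormedAddCommGroup H] [InnerProductSpace 𝕜 H] [CompleteSpace H]

/-- `S` is self-adjoint and its spectrum consists of real numbers in `K`. -/
structure SpectrumIn (S : H →L[𝕜] H) (K : Set ℝ) : Prop where
  sa : IsSelfAdjoint S
  mem : ∀ t : ℝ, (t : 𝕜) ∈ spectrum 𝕜 S → t ∈ K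

/-- The real algebra structure used by `opFun`. -/
abbrev realAlgebra (𝕜 H : Type*) [RCLike 𝕜] [NormedAddCommGroup H] [InnerProductSpace 𝕜 H] :
    Algebra ℝ (H →L[𝕜] H) := Algebra.compHom (H →L[𝕜] H) (algebraMap ℝ 𝕜)

theorem realAlgebra_tower (𝕜 H : Type*) [RCLike 𝕜] [NormedAddCommGroup H]
    [InnerProductSpace 𝕜 H] :
    letI := realAlgebra 𝕜 H
    IsScalarTower ℝ 𝕜 (H →L[𝕜] H) :=
  letI := realAlgebra 𝕜 H
  IsScalarTower.of_algebraMap_eq fun _ => rfl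

theorem realAlgebra_calculus (𝕜 H : Type*) [RCLike 𝕜] [NormedAddCommGroup H]
    [InnerProductSpace 𝕜 H] [CompleteSpace H] :
    letI := realAlgebra 𝕜 H
    ContinuousFunctionalCalculus ℝ (H →L[𝕜] H) IsSelfAdjoint :=
  letI := realAlgebra 𝕜 H
  haveI := realAlgebra_tower 𝕜 H
  continuousFunctionalCalculus_op

attribute [local instance] realAlgebra realAlgebra_tower realAlgebra_calculus

/-- The local instances are definitionally those inside `opFun`, so the rules for `cfc` apply
directly. -/
theorem opFun_eq_cfc (f : ℝ → ℝ) (S : H →L[𝕜] H) : opFun f S = cfc f S := rfl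

theorem mem_real_spectrum_iff {S : H →L[𝕜] H} {t : ℝ} :
    t ∈ spectrum ℝ S ↔ (t : 𝕜) ∈ spectrum 𝕜 S := by
  rw [← spectrum.algebraMap_mem_iff 𝕜, RCLike.algebraMap_eq_ofReal]

theorem SpectrumIn.subset {S : H →L[𝕜] H} {K : Set ℝ} (h : SpectrumIn S K) : spectrum ℝ S ⊆ K :=
  fun t ht => h.mem t (mem_real_spectrum_iff.1 ht)

variable {S : H →L[𝕜] H} {K : Set ℝ} {f g : ℝ → ℝ}

theorem isSelfAdjoint_opFun (f : ℝ → ℝ) (S : H →L[𝕜] H) : IsSelfAdjoint (opFun f S) :=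
  cfc_predicate f S

theorem opFun_congr (hS : SpectrumIn S K) (h : Set.EqOn f g K) : opFun f S = opFun g S :=
  cfc_congr (h.mono hS.subset)

theorem opFun_mul (hS : SpectrumIn S K) (hf : ContinuousOn f K) (hg : ContinuousOn g K) :
    opFun (fun t => f t * g t) S = opFun f S * opFun g S :=
  cfc_mul f g S (hf.mono hS.subset) (hg.mono hS.subset)

theorem opFun_mul_apply (hS : SpectrumIn S K) (hf : ContinuousOn f K) (hg : ContinuousOn g K)
    (x : H) : opFun (fun t => f t * g t) S x = opFun f S (opFun g S x) := by
  rw [opFun_mul hS hf hg]; rfl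

theorem opFun_comm_apply (hS : SpectrumIn S K) (hf : ContinuousOn f K) (hg : ContinuousOn g K)
    (x : H) : opFun f S (opFun g S x) = opFun g S (opFun f S x) := by
  rw [← opFun_mul_apply hS hf hg, ← opFun_mul_apply hS hg hf]
  simp only [mul_comm]

theorem opFun_add (hS : SpectrumIn S K) (hf : ContinuousOn f K) (hg : ContinuousOn g K) :
    opFun (fun t => f t + g t) S = opFun f S + opFun g S :=
  cfc_add S f g (hf.mono hS.subset) (hg.mono hS.subset)

theorem opFun_sub (hS : SpectrumIn S K) (hf : ContinuousOn f K) (hg : ContinuousOn g K) :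
    opFun (fun t => f t - g t) S = opFun f S - opFun g S :=
  cfc_sub f g S (hf.mono hS.subset) (hg.mono hS.subset)

theorem opFun_const (hS : SpectrumIn S K) (c : ℝ) :
    opFun (fun _ => c) S = (c : 𝕜) • (1 : H →L[𝕜] H) := by
  rw [opFun_eq_cfc, cfc_const c S hS.sa, Algebra.algebraMap_eq_smul_one, ofReal_smul_op]

theorem opFun_id (hS : SpectrumIn S K) : opFun (fun t => t) S = S := cfc_id' ℝ S hS.sa

theorem opFun_const_mul (hS : SpectrumIn S K) (c : ℝ) (hf : ContinuousOn f K) :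
    opFun (fun t => c * f t) S = (c : 𝕜) • opFun f S := by
  rw [opFun_mul hS continuousOn_const hf, opFun_const hS, smul_mul_assoc, one_mul]

theorem spectrum_opFun (hS : SpectrumIn S K) (hf : ContinuousOn f K) (c : ℝ) :
    (c : 𝕜) ∈ spectrum 𝕜 (opFun f S) ↔ ∃ t : ℝ, (t : 𝕜) ∈ spectrum 𝕜 S ∧ f t = c := by
  rw [← mem_real_spectrum_iff, opFun_eq_cfc, cfc_map_spectrum f S hS.sa (hf.mono hS.subset)]
  simp only [Set.mem_image, mem_real_spectrum_iff]

theorem spectrumIn_opFun (hS : SpectrumIn S K) (hf : ContinuousOn f K) {L : Set ℝ}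
    (hL : Set.MapsTo f K L) : SpectrumIn (opFun f S) L := by
  refine ⟨isSelfAdjoint_opFun f S, fun c hc => ?_⟩
  obtain ⟨t, ht, rfl⟩ := (spectrum_opFun hS hf c).1 hc
  exact hL (hS.mem t ht)

theorem opFun_comp (hS : SpectrumIn S K) (hf : ContinuousOn f K) {L : Set ℝ}
    (hL : Set.MapsTo f K L) (hg : ContinuousOn g L) :
    opFun g (opFun f S) = opFun (fun t => g (f t)) S :=
  (cfc_comp g f S hS.sa (hg.mono ((Set.image_mono hS.subset).trans hL.image_subset))
    (hf.mono hS.subset)).symm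

theorem inner_opFun_sq (hS : SpectrumIn S K) (hf : ContinuousOn f K) (x : H) :
    inner 𝕜 (opFun (fun t => f t ^ 2) S x) x = ((‖opFun f S x‖ ^ 2 : ℝ) : 𝕜) := by
  simp only [pow_two (f _)]
  rw [opFun_mul_apply hS hf hf]
  have h1 : inner 𝕜 (opFun f S (opFun f S x)) x = inner 𝕜 (opFun f S x) (opFun f S x) :=
    (isSelfAdjoint_opFun f S).isSymmetric (opFun f S x) x
  rw [h1, inner_self_eq_norm_sq_to_K]
  push_cast
  rfl

theorem re_inner_opFun_sq (hS : SpectrumIn S K) (hf : ContinuousOn f K) (x : H) :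
    RCLike.re (inner 𝕜 (opFun (fun t => f t ^ 2) S x) x) = ‖opFun f S x‖ ^ 2 := by
  rw [inner_opFun_sq hS hf, RCLike.ofReal_re]

/-- Writing `f = (√f)²` on `K` makes the form equal to `‖√f(S) x‖²`. All later norm comparisons
between functions of one operator come from this. -/
theorem re_inner_opFun_nonneg (hS : SpectrumIn S K) (hf : ContinuousOn f K)
    (h : ∀ t ∈ K, 0 ≤ f t) (x : H) : 0 ≤ RCLike.re (inner 𝕜 (opFun f S x) x) := by
  have h1 : opFun f S = opFun (fun t => (√(f t)) ^ 2) S :=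
    opFun_congr hS fun t ht => (Real.sq_sqrt (h t ht)).symm
  rw [h1, re_inner_opFun_sq hS hf.sqrt]
  positivity

theorem re_inner_opFun_mono (hS : SpectrumIn S K) (hf : ContinuousOn f K) (hg : ContinuousOn g K)
    (h : ∀ t ∈ K, f t ≤ g t) (x : H) :
    RCLike.re (inner 𝕜 (opFun f S x) x) ≤ RCLike.re (inner 𝕜 (opFun g S x) x) := by
  have h1 := re_inner_opFun_nonneg hS (hg.sub hf) (fun t ht => sub_nonneg.2 (h t ht)) x
  have h2 := opFun_sub hS hg hf
  change 0 ≤ RCLike.re (inner 𝕜 (opFun (fun t => g t - f t) S x) x) at h1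
  rw [h2, sub_apply, inner_sub_left, map_sub] at h1
  linarith

theorem norm_opFun_apply_mono (hS : SpectrumIn S K) (hf : ContinuousOn f K) (hg : ContinuousOn g K)
    (h : ∀ t ∈ K, |f t| ≤ |g t|) (x : H) : ‖opFun f S x‖ ≤ ‖opFun g S x‖ := by
  have h1 := re_inner_opFun_mono (f := fun t => f t ^ 2) (g := fun t => g t ^ 2) hS (hf.pow 2)
    (hg.pow 2) (fun t ht => sq_le_sq.2 (h t ht)) x
  rw [re_inner_opFun_sq hS hf, re_inner_opFun_sq hS hg] at h1
  exact (sq_le_sq₀ (norm_nonneg _) (norm_nonneg _)).1 h1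

theorem norm_opFun_const_mul (hS : SpectrumIn S K) (c : ℝ) (hf : ContinuousOn f K) (x : H) :
    ‖opFun (fun t => c * f t) S x‖ = |c| * ‖opFun f S x‖ := by
  rw [opFun_const_mul hS c hf, smul_apply, norm_smul, RCLike.norm_ofReal]

theorem norm_opFun_apply_le_mul (hS : SpectrumIn S K) (hf : ContinuousOn f K)
    (hg : ContinuousOn g K) {c : ℝ} (hc : 0 ≤ c) (h : ∀ t ∈ K, |f t| ≤ c * |g t|) (x : H) :
    ‖opFun f S x‖ ≤ c * ‖opFun g S x‖ := by
  have h1 := norm_opFun_apply_mono (g := fun t => c * g t) hS hf (continuousOn_const.mul hg)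
    (fun t ht => by rw [abs_mul, abs_of_nonneg hc]; exact h t ht) x
  rwa [norm_opFun_const_mul hS c hg, abs_of_nonneg hc] at h1

theorem norm_opFun_apply_le (hS : SpectrumIn S K) (hf : ContinuousOn f K) {c : ℝ} (hc : 0 ≤ c)
    (h : ∀ t ∈ K, |f t| ≤ c) (x : H) : ‖opFun f S x‖ ≤ c * ‖x‖ := by
  have h1 := norm_opFun_apply_le_mul hS hf (continuousOn_const (c := (1 : ℝ))) hc
    (fun t ht => by simpa using h t ht) x
  rwa [opFun_const hS, RCLike.ofReal_one, one_smul, one_apply_eq_self] at h1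

/-- The spectrum of a self-adjoint operator lies in the interval given by its quadratic form. -/
theorem spectrumIn_Icc {b c : ℝ} (hS : IsSelfAdjoint S)
    (h0 : ∀ x, b * ‖x‖ ^ 2 ≤ RCLike.re (inner 𝕜 (S x) x))
    (h1 : ∀ x, RCLike.re (inner 𝕜 (S x) x) ≤ c * ‖x‖ ^ 2) : SpectrumIn S (Set.Icc b c) := by
  have key : ∀ t x, RCLike.re (inner 𝕜 ((algebraMap 𝕜 (H →L[𝕜] H) ((t : ℝ) : 𝕜) - S) x) x)
      = t * ‖x‖ ^ 2 - RCLike.re (inner 𝕜 (S x) x) := by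
    intro t x
    rw [Algebra.algebraMap_eq_smul_one, sub_apply, inner_sub_left, smul_apply, inner_smul_left,
      one_apply_eq_self, inner_self_eq_norm_sq_to_K, map_sub, RCLike.conj_ofReal,
      ← RCLike.ofReal_pow, ← RCLike.ofReal_mul, RCLike.ofReal_re]
  refine ⟨hS, fun t ht => ⟨?_, ?_⟩⟩
  · by_contra! hlt
    refine ht (isUnit_of_forall_le_norm_inner_map _ (c := ⟨b - t, by linarith⟩)
      (sub_pos.2 hlt) fun x => ?_)
    change ‖x‖ ^ 2 * (b - t) ≤ _
    refine le_trans ?_ (RCLike.abs_re_le_norm _)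
    rw [key, abs_sub_comm]
    refine le_trans ?_ (le_abs_self _)
    linarith [h0 x]
  · by_contra! hlt
    refine ht (isUnit_of_forall_le_norm_inner_map _ (c := ⟨t - c, by linarith⟩)
      (sub_pos.2 hlt) fun x => ?_)
    change ‖x‖ ^ 2 * (t - c) ≤ _
    refine le_trans ?_ (RCLike.abs_re_le_norm _)
    rw [key]
    refine le_trans ?_ (le_abs_self _)
    linarith [h1 x]

end Calculus

/-! ### Index functions, their inverses, and the comparison function `k`. -/

section RealFunctions

noncomputable section

/-- The extension of an index function by the value `0`. -/
abbrev ext0 (f : ℝ → ℝ) : ℝ → ℝ := (Set.Ioi (0 : ℝ)).indicator f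

theorem ext0_zero (f : ℝ → ℝ) : ext0 f 0 = 0 := Set.indicator_of_notMem (by simp) _

theorem ext0_of_pos (f : ℝ → ℝ) {t : ℝ} (ht : 0 < t) : ext0 f t = f t :=
  Set.indicator_of_mem (Set.mem_Ioi.2 ht) _

variable {f : ℝ → ℝ} {a : ℝ}

theorem IsIndexFunction.pos (hf : IsIndexFunction f a) {t : ℝ} (ht : t ∈ Set.Ioc 0 a) :
    0 < f t := by
  have h1 : f (t / 2) < f t := hf.strictMonoOn ⟨half_pos ht.1, by linarith [ht.1, ht.2]⟩ ht
    (half_lt_self ht.1)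
  refine lt_of_le_of_lt ?_ h1
  refine le_of_tendsto hf.tendsto_zero ?_
  filter_upwards [Ioo_mem_nhdsGT (half_pos ht.1)] with u hu
  exact (hf.strictMonoOn ⟨hu.1, by linarith [hu.2, ht.1, ht.2]⟩
    ⟨half_pos ht.1, by linarith [ht.1, ht.2]⟩ hu.2).le

theorem IsIndexFunction.continuousOn_ext0 (hf : IsIndexFunction f a) :
    ContinuousOn (ext0 f) (Set.Icc 0 a) := by
  intro t ht
  rcases ht.1.eq_or_lt with rfl | h0
  · have h1 : ContinuousWithinAt (ext0 f) (Set.Ioi 0) 0 := by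
      rw [ContinuousWithinAt, ext0_zero]
      refine hf.tendsto_zero.congr' ?_
      filter_upwards [self_mem_nhdsWithin] with u hu using (ext0_of_pos f hu).symm
    refine (h1.insert).mono fun u hu => ?_
    rcases hu.1.eq_or_lt with rfl | h
    · exact Set.mem_insert _ _
    · exact Set.mem_insert_of_mem _ h
  · have h1 : ContinuousWithinAt f (Set.Icc 0 a) t := by
      refine (hf.continuousOn t ⟨h0, ht.2⟩).mono_of_mem_nhdsWithin ?_
      filter_upwards [self_mem_nhdsWithin, mem_nhdsWithin_of_mem_nhds (Ioi_mem_nhds h0)] with u hu hu'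
      exact ⟨hu', hu.2⟩
    refine h1.congr_of_eventuallyEq ?_ (ext0_of_pos f h0)
    filter_upwards [mem_nhdsWithin_of_mem_nhds (Ioi_mem_nhds h0)] with u hu using ext0_of_pos f hu

theorem IsIndexFunction.strictMonoOn_ext0 (hf : IsIndexFunction f a) :
    StrictMonoOn (ext0 f) (Set.Icc 0 a) := by
  intro t ht u hu htu
  have hu0 : 0 < u := lt_of_le_of_lt ht.1 htu
  rw [ext0_of_pos f hu0]
  rcases ht.1.eq_or_lt with rfl | h0
  · rw [ext0_zero]; exact hf.pos ⟨hu0, hu.2⟩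
  · rw [ext0_of_pos f h0]; exact hf.strictMonoOn ⟨h0, ht.2⟩ ⟨hu0, hu.2⟩ htu

theorem IsIndexFunction.ext0_nonneg (hf : IsIndexFunction f a) {t : ℝ} (ht : t ∈ Set.Icc 0 a) :
    0 ≤ ext0 f t := by
  rcases ht.1.eq_or_lt with rfl | h0
  · rw [ext0_zero]
  · rw [ext0_of_pos f h0]; exact (hf.pos ⟨h0, ht.2⟩).le

theorem IsIndexFunction.image_ext0 (hf : IsIndexFunction f a) (ha : 0 < a) :
    ext0 f '' Set.Icc 0 a = Set.Icc 0 (f a) := by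
  refine Set.Subset.antisymm ?_ ?_
  · rintro _ ⟨t, ht, rfl⟩
    refine ⟨hf.ext0_nonneg ht, ?_⟩
    rw [← ext0_of_pos f ha]
    exact hf.strictMonoOn_ext0.monotoneOn ht ⟨ha.le, le_rfl⟩ ht.2
  · have := intermediate_value_Icc ha.le hf.continuousOn_ext0
    rwa [ext0_zero, ext0_of_pos f ha] at this

theorem IsIndexFunction.image (hf : IsIndexFunction f a) (ha : 0 < a) :
    f '' Set.Ioc 0 a = Set.Ioc 0 (f a) := by
  refine Set.Subset.antisymm ?_ ?_
  · rintro _ ⟨t, ht, rfl⟩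
    exact ⟨hf.pos ht, hf.strictMonoOn.monotoneOn ht ⟨ha, le_rfl⟩ ht.2⟩
  · intro y hy
    obtain ⟨t, ht, rfl⟩ : y ∈ ext0 f '' Set.Icc 0 a := by
      rw [hf.image_ext0 ha]; exact ⟨hy.1.le, hy.2⟩
    rcases ht.1.eq_or_lt with rfl | h0
    · rw [ext0_zero] at hy; exact absurd hy.1 (lt_irrefl _)
    · exact ⟨t, ⟨h0, ht.2⟩, (ext0_of_pos f h0).symm⟩

theorem IsIndexFunction.invFunOn_apply (hf : IsIndexFunction f a) {t : ℝ} (ht : t ∈ Set.Ioc 0 a) :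
    Function.invFunOn f (Set.Ioc 0 a) (f t) = t :=
  hf.strictMonoOn.injOn.leftInvOn_invFunOn ht

theorem IsIndexFunction.ext0_inv (hf : IsIndexFunction f a) {t : ℝ} (ht : t ∈ Set.Icc 0 a) :
    ext0 (Function.invFunOn f (Set.Ioc 0 a)) (ext0 f t) = t := by
  rcases ht.1.eq_or_lt with rfl | h0
  · rw [ext0_zero, ext0_zero]
  · rw [ext0_of_pos f h0, ext0_of_pos _ (hf.pos ⟨h0, ht.2⟩), hf.invFunOn_apply ⟨h0, ht.2⟩]

/-- The extension of `f` by `0` is an order isomorphism between the intervals `[0, a]` and `[0,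
f(a)]`, and order isomorphisms are homeomorphisms for the order topology. -/
theorem IsIndexFunction.continuousOn_inv (hf : IsIndexFunction f a) (ha : 0 < a) :
    ContinuousOn (ext0 (Function.invFunOn f (Set.Ioc 0 a))) (Set.Icc 0 (f a)) := by
  rw [← hf.image_ext0 ha]
  let e := StrictMonoOn.orderIso (ext0 f) (Set.Icc 0 a) hf.strictMonoOn_ext0
  have : Set.OrdConnected (ext0 f '' Set.Icc 0 a) := by
    rw [hf.image_ext0 ha]; infer_instance
  have h1 : Continuous fun y => (e.symm y : ℝ) := continuous_subtype_val.comp e.symm.continuous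
  rw [continuousOn_iff_continuous_domRestrict]
  refine h1.congr fun y => ?_
  obtain ⟨t, rfl⟩ := e.surjective y
  rw [e.symm_apply_apply]
  exact (hf.ext0_inv t.2).symm

theorem IsIndexFunction.inv_mem (hf : IsIndexFunction f a) (ha : 0 < a) {y : ℝ}
    (hy : y ∈ Set.Icc 0 (f a)) :
    ext0 (Function.invFunOn f (Set.Ioc 0 a)) y ∈ Set.Icc 0 a := by
  rw [← hf.image_ext0 ha] at hy
  obtain ⟨t, ht, rfl⟩ := hy
  rwa [hf.ext0_inv ht]

theorem IsIndexFunction.inv_monotoneOn (hf : IsIndexFunction f a) (ha : 0 < a) :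
    MonotoneOn (ext0 (Function.invFunOn f (Set.Ioc 0 a))) (Set.Icc 0 (f a)) := by
  rw [← hf.image_ext0 ha]
  rintro _ ⟨t, ht, rfl⟩ _ ⟨u, hu, rfl⟩ h
  rw [hf.ext0_inv ht, hf.ext0_inv hu]
  exact (hf.strictMonoOn_ext0.le_iff_le ht hu).1 h

theorem IsIndexFunction.psi {ϱ : ℝ → ℝ} (hϱ : IsIndexFunction ϱ a) {p : ℝ} (hp : 0 < p) :
    IsIndexFunction (psi ϱ p) a where
  continuousOn := (Real.continuous_rpow_const hp.le).continuousOn.mul hϱ.continuousOn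
  strictMonoOn := fun t ht u hu htu => by
    have h1 := Real.rpow_lt_rpow ht.1.le htu hp
    have h2 := hϱ.strictMonoOn ht hu htu
    exact mul_lt_mul'' h1 h2 (Real.rpow_nonneg ht.1.le _) (hϱ.pos ht).le
  tendsto_zero := by
    have h1 : Filter.Tendsto (fun t : ℝ => t ^ p) (nhdsWithin 0 (Set.Ioi 0)) (nhds 0) := by
      have := (Real.continuous_rpow_const hp.le).tendsto (0 : ℝ)
      rw [Real.zero_rpow hp.ne'] at this
      exact this.mono_left nhdsWithin_le_nhds
    have := h1.mul hϱ.tendsto_zero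
    rwa [mul_zero] at this

/-- The function `t ↦ (f⁻¹(√t)) ^ q` on `[0, f(a)²]`. -/
def invPow (f : ℝ → ℝ) (a q t : ℝ) : ℝ :=
  (ext0 (Function.invFunOn f (Set.Ioc 0 a)) (√t)) ^ q

theorem sqrt_mem_Icc {b t : ℝ} (hb : 0 ≤ b) (ht : t ∈ Set.Icc 0 (b ^ 2)) : √t ∈ Set.Icc 0 b :=
  ⟨Real.sqrt_nonneg _, Real.sqrt_le_iff.2 ⟨hb, ht.2⟩⟩

theorem IsIndexFunction.invPow_continuousOn (hf : IsIndexFunction f a) (ha : 0 < a) {q : ℝ}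
    (hq : 0 ≤ q) : ContinuousOn (invPow f a q) (Set.Icc 0 (f a ^ 2)) :=
  ((hf.continuousOn_inv ha).comp Real.continuous_sqrt.continuousOn fun _ ht =>
    sqrt_mem_Icc (hf.pos ⟨ha, le_rfl⟩).le ht).rpow_const fun _ _ => Or.inr hq

theorem IsIndexFunction.invPow_monotoneOn (hf : IsIndexFunction f a) (ha : 0 < a) {q : ℝ}
    (hq : 0 ≤ q) : MonotoneOn (invPow f a q) (Set.Icc 0 (f a ^ 2)) := by
  intro t ht u hu htu
  have h0 := (hf.pos ⟨ha, le_rfl⟩).le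
  exact Real.rpow_le_rpow (hf.inv_mem ha (sqrt_mem_Icc h0 ht)).1
    (hf.inv_monotoneOn ha (sqrt_mem_Icc h0 ht) (sqrt_mem_Icc h0 hu) (Real.sqrt_le_sqrt htu)) hq

theorem IsIndexFunction.invPow_apply (hf : IsIndexFunction f a) (q : ℝ) {t : ℝ}
    (ht : t ∈ Set.Icc 0 a) : invPow f a q (ext0 f t ^ 2) = t ^ q := by
  rw [invPow, Real.sqrt_sq (hf.ext0_nonneg ht), hf.ext0_inv ht]

theorem IsIndexFunction.invPow_apply_of_pos (hf : IsIndexFunction f a) (q : ℝ) {t : ℝ}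
    (ht : t ∈ Set.Ioc 0 a) : invPow f a q (f t ^ 2) = t ^ q := by
  have := hf.invPow_apply q ⟨ht.1.le, ht.2⟩
  rwa [ext0_of_pos f ht.1] at this

theorem IsIndexFunction.exists_of_mem_Ioc (hf : IsIndexFunction f a) (ha : 0 < a) {t : ℝ}
    (ht : t ∈ Set.Ioc 0 (f a ^ 2)) : ∃ u ∈ Set.Ioc 0 a, t = f u ^ 2 := by
  have h1 : √t ∈ f '' Set.Ioc 0 a := by
    rw [hf.image ha]
    exact ⟨Real.sqrt_pos.2 ht.1, Real.sqrt_le_iff.2 ⟨(hf.pos ⟨ha, le_rfl⟩).le, ht.2⟩⟩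
  obtain ⟨u, hu, h⟩ := h1
  exact ⟨u, hu, by rw [h, Real.sq_sqrt ht.1.le]⟩

theorem IsIndexFunction.invPow_pos (hf : IsIndexFunction f a) (ha : 0 < a) (q : ℝ) {t : ℝ}
    (ht : t ∈ Set.Ioc 0 (f a ^ 2)) : 0 < invPow f a q t := by
  obtain ⟨u, hu, rfl⟩ := hf.exists_of_mem_Ioc ha ht
  rw [hf.invPow_apply_of_pos q hu]
  exact Real.rpow_pos_of_pos hu.1 _

theorem invPow_nonneg (hf : IsIndexFunction f a) (ha : 0 < a) (q : ℝ) {t : ℝ}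
    (ht : t ∈ Set.Icc 0 (f a ^ 2)) : 0 ≤ invPow f a q t :=
  Real.rpow_nonneg (hf.inv_mem ha (sqrt_mem_Icc (hf.pos ⟨ha, le_rfl⟩).le ht)).1 _

theorem hFun_eq_invPow (ϱ : ℝ → ℝ) (a s p : ℝ) {t : ℝ} (ht : 0 < t) :
    hFun ϱ a s p t = invPow (psi ϱ s) a (p - s) t := by
  rw [hFun, invPow, ext0_of_pos _ (Real.sqrt_pos.2 ht), psiInv]

theorem wFun_eq_invPow {ϱ : ℝ → ℝ} {a s : ℝ} (hψ : IsIndexFunction (psi ϱ s) a) (ha : 0 < a)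
    (p : ℝ) {t : ℝ} (ht : t ∈ Set.Ioc 0 (psi ϱ s a ^ 2)) :
    wFun ϱ a s p t = invPow (psi ϱ s) a (s - p) t := by
  rw [wFun, hFun_eq_invPow ϱ a s p ht.1]
  obtain ⟨u, hu, rfl⟩ := hψ.exists_of_mem_Ioc ha ht
  rw [hψ.invPow_apply_of_pos _ hu, hψ.invPow_apply_of_pos _ hu, one_div, ← Real.rpow_neg hu.1.le,
    neg_sub]

/-- At `t = ψ_s(u)²` the quotient is `u^{s-p} / ψ_s(u) = 1 / ψ_p(u)`, which decreases because `ψ_p`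
increases. Hence the high order case needs no separate assumption of this kind. -/
theorem antitoneOn_invPow_div_sqrt {ϱ : ℝ → ℝ} {s p : ℝ} (hϱ : IsIndexFunction ϱ a)
    (hψ : IsIndexFunction (psi ϱ s) a) (ha : 0 < a) (hp : 0 < p) :
    AntitoneOn (fun t => invPow (psi ϱ s) a (s - p) t / √t) (Set.Ioc 0 (psi ϱ s a ^ 2)) := by
  have key : ∀ u ∈ Set.Ioc 0 a, invPow (psi ϱ s) a (s - p) (psi ϱ s u ^ 2) / √(psi ϱ s u ^ 2)
      = (psi ϱ p u)⁻¹ := by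
    intro u hu
    rw [hψ.invPow_apply_of_pos _ hu, Real.sqrt_sq (hψ.pos hu).le, psi, psi, Real.rpow_sub hu.1]
    have := (Real.rpow_pos_of_pos hu.1 s).ne'
    have := (Real.rpow_pos_of_pos hu.1 p).ne'
    have := (hϱ.pos hu).ne'
    field_simp
  intro t ht t' ht' htt
  obtain ⟨u, hu, rfl⟩ := hψ.exists_of_mem_Ioc ha ht
  obtain ⟨u', hu', rfl⟩ := hψ.exists_of_mem_Ioc ha ht'
  simp only [key u hu, key u' hu']
  have h1 : u ≤ u' := by
    rw [← hψ.strictMonoOn.le_iff_le hu hu']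
    exact (sq_le_sq₀ (hψ.pos hu).le (hψ.pos hu').le).1 htt
  exact inv_anti₀ ((hϱ.psi hp).pos hu) ((hϱ.psi hp).strictMonoOn.monotoneOn hu hu' h1)

/-- If `k / √t` is decreasing then `√θ k(t) ≤ k(θ t)` for `θ ≤ 1`. -/
theorem mul_le_of_antitoneOn_div_sqrt {k : ℝ → ℝ} {b r t : ℝ}
    (hk : AntitoneOn (fun t => k t / √t) (Set.Ioc 0 b)) (ht : t ∈ Set.Ioc 0 b) (hr : 0 < r)
    (hr1 : r ≤ 1) : r * k t ≤ k (r ^ 2 * t) := by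
  have h1 : r ^ 2 * t ≤ t := mul_le_of_le_one_left ht.1.le (pow_le_one₀ hr.le hr1)
  have h0 : 0 < r ^ 2 * t := by have := ht.1; positivity
  have h2 := hk ⟨h0, h1.trans ht.2⟩ ht h1
  simp only [Real.sqrt_mul (sq_nonneg r), Real.sqrt_sq hr.le] at h2
  have h3 := Real.sqrt_pos.2 ht.1
  rw [div_le_div_iff₀ h3 (by positivity)] at h2
  nlinarith

end

end RealFunctions

/-! ### Scalar estimates for the filter functions. -/

section Filters

noncomputable section

/-- The filter functions `g_k` of the nonstationary implicit iteration method. -/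
def iterFilter (α : ℕ → ℝ) : ℕ → ℝ → ℝ
  | 0, _ => 0
  | k + 1, t => iterFilter α k t + (1 - t * iterFilter α k t) / (t + α (k + 1))

variable {α : ℕ → ℝ} {n : ℕ}

theorem sigma_succ (α : ℕ → ℝ) (k : ℕ) : sigma α (k + 1) = sigma α k + 1 / α (k + 1) :=
  Finset.sum_Icc_succ_top (Nat.le_add_left 1 k) _

/-- Each step multiplies the residual `1 - t g` by `α / (t + α)`, so the residual is a product of
factors `1 / (1 + t/α_k)`. Expanding `∏ (1 + t/α_k) ≥ 1 + σ t` gives the decay in terms of `σ`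
alone. -/
theorem iterFilter_bounds (hα : ∀ k ∈ Finset.Icc 1 n, 0 < α k) {t : ℝ} (ht : 0 ≤ t) :
    0 ≤ iterFilter α n t ∧ iterFilter α n t ≤ sigma α n ∧ 0 ≤ 1 - t * iterFilter α n t ∧
      (1 - t * iterFilter α n t) * (1 + sigma α n * t) ≤ 1 := by
  induction n with
  | zero => simp [iterFilter, sigma]
  | succ k ih =>
    obtain ⟨h1, h2, h3, h4⟩ := ih fun j hj =>
      hα j (Finset.mem_Icc.2 ⟨(Finset.mem_Icc.1 hj).1, (Finset.mem_Icc.1 hj).2.trans k.le_succ⟩)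
    have ha : 0 < α (k + 1) := hα (k + 1) (by simp)
    have hσ : 0 ≤ sigma α k := h1.trans h2
    have hr : 1 - t * iterFilter α (k + 1) t
        = (1 - t * iterFilter α k t) * (α (k + 1) / (t + α (k + 1))) := by
      have : t + α (k + 1) ≠ 0 := by positivity
      simp only [iterFilter]
      field_simp
      ring
    have hle : 1 - t * iterFilter α k t ≤ 1 := by nlinarith
    refine ⟨?_, ?_, ?_, ?_⟩
    · exact add_nonneg h1 (div_nonneg h3 (by positivity))
    · rw [sigma_succ]
      refine add_le_add h2 ?_
      rw [div_le_div_iff₀ (by positivity) ha]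
      nlinarith
    · rw [hr]; positivity
    · rw [hr, sigma_succ]
      refine le_trans ?_ h4
      rw [mul_assoc]
      refine mul_le_mul_of_nonneg_left ?_ h3
      rw [div_mul_eq_mul_div, div_le_iff₀ (by positivity)]
      have : α (k + 1) * (1 + (sigma α k + 1 / α (k + 1)) * t)
          = α (k + 1) * (1 + sigma α k * t) + t := by field_simp; ring
      rw [this]
      nlinarith [mul_nonneg (mul_nonneg hσ ht) ht]

theorem iterFilter_continuousOn (hα : ∀ k ∈ Finset.Icc 1 n, 0 < α k) :
    ContinuousOn (iterFilter α n) (Set.Ici 0) := by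
  induction n with
  | zero => exact continuousOn_const
  | succ k ih =>
    have h1 := ih fun j hj =>
      hα j (Finset.mem_Icc.2 ⟨(Finset.mem_Icc.1 hj).1, (Finset.mem_Icc.1 hj).2.trans k.le_succ⟩)
    have ha : 0 < α (k + 1) := hα (k + 1) (by simp)
    refine h1.add (ContinuousOn.div (continuousOn_const.sub (continuousOn_id.mul h1))
      (continuousOn_id.add continuousOn_const) fun t ht => ?_)
    have : (0 : ℝ) ≤ t := ht
    change t + α (k + 1) ≠ 0
    positivity

/-- This is the normalized form of the filter bounds: `x² = σ c² t`, `u = g/σ`, `y = k(t)/k(τ)`, and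
`r` is the residual. The hypotheses place `y` between `1` and `x`; since `x² r ≤ 1` and `x² u ≤ 1`,
a factor `y` never costs more than the available factor `x`. -/
theorem min_max_estimates {x y u r : ℝ} (hx : 0 < x) (hy : 0 ≤ y) (hu : 0 ≤ u) (hu1 : u ≤ 1)
    (hr0 : 0 ≤ r) (hr : r = 1 - x ^ 2 * u) (hr1 : r * (1 + x ^ 2) ≤ 1)
    (hlow : x ≤ 1 → x ≤ y ∧ y ≤ 1) (hhigh : 1 ≤ x → 1 ≤ y ∧ y ≤ x) :
    x * u ≤ y ∧ x * r * y ≤ 1 ∧ x * u * y ≤ 1 ∧ x * r ≤ y := by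
  have hle : r ≤ 1 := by nlinarith [mul_nonneg (sq_nonneg x) hu]
  have hxu : 0 ≤ x * u := by positivity
  have hxr : 0 ≤ x * r := by positivity
  have hxx : x * r * x ≤ 1 := by nlinarith
  have hxxu : x * u * x ≤ 1 := by nlinarith
  rcases le_total x 1 with h | h
  · obtain ⟨h1, h2⟩ := hlow h
    have h3 : x * u ≤ x := mul_le_of_le_one_right hx.le hu1
    have h4 : x * r ≤ x := mul_le_of_le_one_right hx.le hle
    exact ⟨h3.trans h1, mul_le_one₀ (h4.trans h) hy h2, mul_le_one₀ (h3.trans h) hy h2,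
      h4.trans h1⟩
  · obtain ⟨h1, h2⟩ := hhigh h
    refine ⟨?_, ?_, ?_, ?_⟩
    · nlinarith
    · exact (mul_le_mul_of_nonneg_left h2 hxr).trans hxx
    · exact (mul_le_mul_of_nonneg_left h2 hxu).trans hxxu
    · nlinarith

/-- Bounds for the filter functions against an increasing `k` with `k / √t` decreasing, where `τ`
corresponds to `1 / σ_n` in the scaled variable. -/
theorem filter_estimates {k : ℝ → ℝ} {b τ σ c t g : ℝ} (hc : 0 < c) (hσ : 0 < σ)
    (hτ : τ ∈ Set.Ioc 0 b) (hτσ : σ * (c ^ 2 * τ) = 1)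
    (hmono : MonotoneOn k (Set.Icc 0 b)) (hanti : AntitoneOn (fun t => k t / √t) (Set.Ioc 0 b))
    (hk0 : ∀ t ∈ Set.Icc 0 b, 0 ≤ k t) (hkτ : 0 < k τ) (ht : t ∈ Set.Icc 0 b)
    (hg0 : 0 ≤ g) (hg1 : g ≤ σ) (hr0 : 0 ≤ 1 - c ^ 2 * t * g)
    (hr1 : (1 - c ^ 2 * t * g) * (1 + σ * (c ^ 2 * t)) ≤ 1) :
    c * √t * g ≤ √σ / k τ * k t ∧ c * √t * (1 - c ^ 2 * t * g) * k t ≤ k τ / √σ ∧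
      c * √t * g * k t ≤ √σ * k τ ∧ c * √t * (1 - c ^ 2 * t * g) ≤ (√σ * k τ)⁻¹ * k t := by
  rcases ht.1.eq_or_lt with rfl | h0
  · have := hk0 0 ht
    simp only [Real.sqrt_zero, mul_zero, zero_mul]
    refine ⟨by positivity, by positivity, by positivity, by positivity⟩
  set x := √σ * (c * √t) with hx
  set y := k t / k τ with hy
  have hs : 0 < √σ := Real.sqrt_pos.2 hσ
  have hx0 : 0 < x := mul_pos hs (mul_pos hc (Real.sqrt_pos.2 h0))
  have hx2 : x ^ 2 = σ * (c ^ 2 * t) := by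
    rw [hx, mul_pow, mul_pow, Real.sq_sqrt hσ.le, Real.sq_sqrt ht.1]
  -- `τ` is the point where the normalized variable `x` equals `1`, so comparing `t` with `τ` is the
  -- same as comparing `x` with `1`.
  have hxτ : √σ * (c * √τ) = 1 := by
    have : (√σ * (c * √τ)) ^ 2 = 1 := by
      rw [mul_pow, mul_pow, Real.sq_sqrt hσ.le, Real.sq_sqrt hτ.1.le, hτσ]
    exact (pow_eq_one_iff_of_nonneg (by positivity) two_ne_zero).1 this
  have hkt : k t = y * k τ := by rw [hy, div_mul_cancel₀ _ hkτ.ne']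
  have hy0 : 0 ≤ y := div_nonneg (hk0 t ht) hkτ.le
  -- Monotonicity of `k` compares `y` with `1`, and monotonicity of `k/√t` compares `y` with `x`;
  -- both comparisons reverse when `t` crosses `τ`.
  have hlow : x ≤ 1 → x ≤ y ∧ y ≤ 1 := by
    intro h
    have htτ : t ≤ τ := by
      have : x ^ 2 ≤ 1 := pow_le_one₀ hx0.le h
      rw [hx2, ← hτσ] at this
      have h3 : 0 < σ * c ^ 2 := by positivity
      nlinarith
    refine ⟨?_, ?_⟩
    · have h2 := hanti ⟨h0, ht.2⟩ hτ htτ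
      simp only at h2
      rw [div_le_div_iff₀ (Real.sqrt_pos.2 hτ.1) (Real.sqrt_pos.2 h0)] at h2
      rw [hy, le_div_iff₀ hkτ, hx]
      calc √σ * (c * √t) * k τ = √σ * c * (k τ * √t) := by ring
        _ ≤ √σ * c * (k t * √τ) := by gcongr
        _ = (√σ * (c * √τ)) * k t := by ring
        _ = k t := by rw [hxτ, one_mul]
    · exact div_le_one_of_le₀ (hmono ht ⟨hτ.1.le, hτ.2⟩ htτ) hkτ.le
  have hhigh : 1 ≤ x → 1 ≤ y ∧ y ≤ x := by
    intro h
    have htτ : τ ≤ t := by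
      have : 1 ≤ x ^ 2 := one_le_pow₀ h
      rw [hx2, ← hτσ] at this
      have h3 : 0 < σ * c ^ 2 := by positivity
      nlinarith
    refine ⟨?_, ?_⟩
    · exact (one_le_div₀ hkτ).2 (hmono ⟨hτ.1.le, hτ.2⟩ ht htτ)
    · have h2 := hanti hτ ⟨h0, ht.2⟩ htτ
      simp only at h2
      rw [div_le_div_iff₀ (Real.sqrt_pos.2 h0) (Real.sqrt_pos.2 hτ.1)] at h2
      rw [hy, div_le_iff₀ hkτ, hx]
      calc k t = (√σ * (c * √τ)) * k t := by rw [hxτ, one_mul]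
        _ = √σ * c * (k t * √τ) := by ring
        _ ≤ √σ * c * (k τ * √t) := by gcongr
        _ = _ := by ring
  have hct : c * √t = x / √σ := by rw [hx]; field_simp
  set γ := g / σ with hγ
  have hgγ : g = γ * σ := by rw [hγ, div_mul_cancel₀ _ hσ.ne']
  have hγ0 : 0 ≤ γ := div_nonneg hg0 hσ.le
  have hγ1 : γ ≤ 1 := div_le_one_of_le₀ hg1 hσ.le
  have hctg : c ^ 2 * t * g = x ^ 2 * γ := by rw [hx2, hgγ]; ring
  rw [hctg] at hr0 hr1 ⊢
  rw [← hx2] at hr1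
  obtain ⟨e1, e2, e3, e4⟩ := min_max_estimates hx0 hy0 hγ0 hγ1 hr0 rfl hr1 hlow hhigh
  have hcg : c * √t * g = √σ * (x * γ) := by
    rw [hct, hgγ]
    nth_rewrite 2 [← Real.sq_sqrt hσ.le]
    field_simp
  have hcr : c * √t * (1 - x ^ 2 * γ) = x * (1 - x ^ 2 * γ) / √σ := by rw [hct]; ring
  refine ⟨?_, ?_, ?_, ?_⟩
  · calc c * √t * g = √σ * (x * γ) := hcg
      _ ≤ √σ * y := mul_le_mul_of_nonneg_left e1 hs.le
      _ = √σ / k τ * k t := by rw [hy]; ring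
  · calc c * √t * (1 - x ^ 2 * γ) * k t = x * (1 - x ^ 2 * γ) * y * (k τ / √σ) := by
          rw [hcr, hkt]; ring
      _ ≤ k τ / √σ := mul_le_of_le_one_left (by positivity) e2
  · calc c * √t * g * k t = x * γ * y * (√σ * k τ) := by rw [hcg, hkt]; ring
      _ ≤ √σ * k τ := mul_le_of_le_one_left (by positivity) e3
  · calc c * √t * (1 - x ^ 2 * γ) = x * (1 - x ^ 2 * γ) * (√σ)⁻¹ := by rw [hcr, div_eq_mul_inv]
      _ ≤ y * (√σ)⁻¹ := mul_le_mul_of_nonneg_right e4 (by positivity)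
      _ = (√σ * k τ)⁻¹ * k t := by rw [hy, mul_inv]; ring

end

end Filters

/-! ### Factorization, and operator monotonicity up to the spectral value `0`. -/

section Operators

set_option linter.unusedSectionVars false

open ContinuousLinearMap

variable {𝕜 H Z W : Type*} [RCLike 𝕜] [NormedAddCommGroup H] [InnerProductSpace 𝕜 H]
  [CompleteSpace H] [NormedAddCommGroup Z] [InnerProductSpace 𝕜 Z] [CompleteSpace Z]
  [NormedAddCommGroup W] [InnerProductSpace 𝕜 W] [CompleteSpace W]

theorem denseRange_of_isSelfAdjoint {Q : H →L[𝕜] H} (hQ : IsSelfAdjoint Q)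
    (hinj : ∀ x, Q x = 0 → x = 0) : DenseRange Q := by
  have h1 : (Q : H →ₗ[𝕜] H).rangeᗮ = ⊥ := by
    rw [orthogonal_range, hQ.adjoint_eq, LinearMap.ker_eq_bot']
    exact hinj
  have h2 := Submodule.topologicalClosure_eq_top_iff.2 h1
  have h3 := (Submodule.dense_iff_topologicalClosure_eq_top).2 h2
  exact h3

/-- Douglas' factorization: `‖F x‖ ≤ C ‖Q x‖` implies `F = K Q`. -/
theorem exists_factor {Q : H →L[𝕜] W} (hQ : DenseRange Q) (F : H →L[𝕜] Z) {C : ℝ}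
    (h : ∀ x, ‖F x‖ ≤ C * ‖Q x‖) :
    ∃ K : W →L[𝕜] Z, (∀ x, K (Q x) = F x) ∧ ∀ w, ‖K w‖ ≤ C * ‖w‖ :=
  ⟨(F : H →ₗ[𝕜] Z).extendOfNorm (Q : H →ₗ[𝕜] W),
    fun x => LinearMap.extendOfNorm_eq (f := (F : H →ₗ[𝕜] Z)) (e := (Q : H →ₗ[𝕜] W)) hQ ⟨C, h⟩ x,
    fun w => LinearMap.norm_extendOfNorm_apply_le (f := (F : H →ₗ[𝕜] Z)) (e := (Q : H →ₗ[𝕜] W))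
      hQ C h w⟩

theorem norm_adjoint_apply_le {F : H →L[𝕜] Z} {C : ℝ} (hC : 0 ≤ C) (h : ∀ x, ‖F x‖ ≤ C * ‖x‖)
    (z : Z) : ‖adjoint F z‖ ≤ C * ‖z‖ := by
  refine (le_opNorm _ _).trans (mul_le_mul_of_nonneg_right ?_ (norm_nonneg _))
  rw [LinearIsometryEquiv.norm_map]
  exact opNorm_le_bound _ hC h

theorem eq_of_denseRange {Q : H →L[𝕜] W} (hQ : DenseRange Q) {F F' : W →L[𝕜] Z}
    (h : ∀ x, F (Q x) = F' (Q x)) (w : W) : F w = F' w :=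
  hQ.induction_on (p := fun w => F w = F' w) w (isClosed_eq F.continuous F'.continuous) h

theorem norm_apply_le_of_denseRange {Q : H →L[𝕜] W} (hQ : DenseRange Q) {F : W →L[𝕜] Z} {C : ℝ}
    (h : ∀ x, ‖F (Q x)‖ ≤ C * ‖Q x‖) (w : W) : ‖F w‖ ≤ C * ‖w‖ :=
  hQ.induction_on (p := fun w => ‖F w‖ ≤ C * ‖w‖) w
    (isClosed_le F.continuous.norm (continuous_const.mul continuous_norm)) h

/-- An operator monotone function that extends continuously to `0` preserves the order also for
operators whose spectrum contains `0`. -/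
theorem IsOperatorMonotone.re_inner_le {f F : ℝ → ℝ} {b : ℝ} (hf : IsOperatorMonotone 𝕜 H f b)
    (hb : 0 < b) (hF : ContinuousOn F (Set.Icc 0 b)) (hfF : Set.EqOn f F (Set.Ioc 0 b))
    {S₁ S₂ : H →L[𝕜] H} (h₁ : SpectrumIn S₁ (Set.Icc 0 b)) (h₂ : SpectrumIn S₂ (Set.Icc 0 b))
    (h : ∀ x, RCLike.re (inner 𝕜 (S₁ x) x) ≤ RCLike.re (inner 𝕜 (S₂ x) x)) (x : H) :
    RCLike.re (inner 𝕜 (opFun F S₁ x) x) ≤ RCLike.re (inner 𝕜 (opFun F S₂ x) x) := by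
  suffices hη : ∀ η : ℝ, 0 < η → RCLike.re (inner 𝕜 (opFun F S₁ x) x)
      ≤ RCLike.re (inner 𝕜 (opFun F S₂ x) x) + 2 * η * ‖x‖ ^ 2 by
    refine le_of_forall_pos_le_add fun ε hε => ?_
    refine (hη (ε / (2 * (‖x‖ ^ 2 + 1))) (by positivity)).trans (add_le_add_right ?_ _)
    rw [← mul_div_assoc, mul_div_mul_left _ _ two_ne_zero, div_mul_eq_mul_div,
      div_le_iff₀ (by positivity)]
    nlinarith
  intro η hη
  obtain ⟨d, hd, hunif⟩ := Metric.uniformContinuousOn_iff_le.1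
    (isCompact_Icc.uniformContinuousOn_of_continuous hF) η hη
  -- The map `l(t) = (1 - ε) t + ε b` preserves the operator order and moves spectra into `[ε b,
  -- b]`, away from `0`. It displaces points by at most `ε b ≤ d`, hence changes `F` by at most `η`,
  -- and `η` is arbitrary.
  set ε := min 1 (d / b) with hε
  have hε0 : 0 < ε := lt_min one_pos (div_pos hd hb)
  have hε1 : ε ≤ 1 := min_le_left _ _
  have hεd : ε * b ≤ d := by
    rw [← le_div_iff₀ hb]; exact min_le_right _ _
  set l : ℝ → ℝ := fun t => (1 - ε) * t + ε * b with hl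
  have hlc : Continuous l := by fun_prop
  have hmem : Set.MapsTo l (Set.Icc 0 b) (Set.Icc (ε * b) b) := fun t ht =>
    ⟨by simp only [hl]; nlinarith [mul_nonneg (sub_nonneg.2 hε1) ht.1],
      by simp only [hl]; nlinarith [mul_le_mul_of_nonneg_left ht.2 (sub_nonneg.2 hε1)]⟩
  have hsub : Set.Icc (ε * b) b ⊆ Set.Ioc 0 b := fun t ht => ⟨lt_of_lt_of_le (by positivity) ht.1, ht.2⟩
  have hclose : ∀ t ∈ Set.Icc 0 b, |F (l t) - F t| ≤ η := by
    intro t ht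
    refine hunif _ (Set.Ioc_subset_Icc_self (hsub (hmem ht))) _ ht ?_
    rw [Real.dist_eq]
    have : l t - t = ε * (b - t) := by simp only [hl]; ring
    rw [this, abs_of_nonneg (mul_nonneg hε0.le (sub_nonneg.2 ht.2))]
    refine le_trans ?_ hεd
    exact mul_le_mul_of_nonneg_left (by linarith [ht.1]) hε0.le
  have hFl : ContinuousOn (fun t => F (l t)) (Set.Icc 0 b) :=
    hF.comp hlc.continuousOn fun t ht => Set.Ioc_subset_Icc_self (hsub (hmem ht))
  have hspec : ∀ {S : H →L[𝕜] H}, SpectrumIn S (Set.Icc 0 b) →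
      spectrum 𝕜 (opFun l S) ⊆ (fun t : ℝ => (t : 𝕜)) '' Set.Ioc 0 b := by
    intro S hS z hz
    have h3 := spectrumIn_opFun hS hlc.continuousOn hmem
    let _ := realAlgebra 𝕜 H
    have := realAlgebra_tower 𝕜 H
    obtain ⟨t, -, rfl⟩ := mem_range_of_mem_spectrum _ h3.sa z hz
    exact ⟨t, hsub (h3.mem t hz), rfl⟩
  have hop : ∀ {S : H →L[𝕜] H}, SpectrumIn S (Set.Icc 0 b) →
      opFun f (opFun l S) = opFun (fun t => F (l t)) S := by
    intro S hS
    rw [opFun_congr (spectrumIn_opFun hS hlc.continuousOn hmem) (hfF.mono hsub)]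
    exact opFun_comp hS hlc.continuousOn (L := Set.Icc 0 b)
      (fun t ht => Set.Ioc_subset_Icc_self (hsub (hmem ht))) hF
  have hlin : ∀ {S : H →L[𝕜] H}, SpectrumIn S (Set.Icc 0 b) →
      opFun l S = ((1 - ε : ℝ) : 𝕜) • S + ((ε * b : ℝ) : 𝕜) • (1 : H →L[𝕜] H) := by
    intro S hS
    rw [opFun_add hS (by fun_prop) (by fun_prop), opFun_const hS,
      opFun_const_mul hS (1 - ε) (continuousOn_id' _), opFun_id hS]
  have hle : opFun l S₁ ≤ opFun l S₂ := by
    rw [ContinuousLinearMap.le_def, isPositive_def]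
    refine ⟨((isSelfAdjoint_opFun l S₂).sub (isSelfAdjoint_opFun l S₁)).isSymmetric, fun y => ?_⟩
    have : opFun l S₂ - opFun l S₁ = ((1 - ε : ℝ) : 𝕜) • (S₂ - S₁) := by
      rw [hlin h₁, hlin h₂, smul_sub]; abel
    rw [this, reApplyInnerSelf_apply, smul_apply, inner_smul_left, RCLike.conj_ofReal,
      RCLike.re_ofReal_mul, sub_apply, inner_sub_left, map_sub]
    exact mul_nonneg (sub_nonneg.2 hε1) (sub_nonneg.2 (h y))
  have hmain := hf _ _ (isSelfAdjoint_opFun l S₁) (isSelfAdjoint_opFun l S₂) (hspec h₁) (hspec h₂) hle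
  rw [hop h₁, hop h₂, ContinuousLinearMap.le_def, isPositive_def] at hmain
  have hx := hmain.2 x
  rw [reApplyInnerSelf_apply, sub_apply, inner_sub_left, map_sub] at hx
  have hqc : ∀ {S : H →L[𝕜] H}, SpectrumIn S (Set.Icc 0 b) →
      RCLike.re (inner 𝕜 (((η : 𝕜) • (1 : H →L[𝕜] H)) x) x) = η * ‖x‖ ^ 2 := by
    intro S _
    rw [smul_apply, inner_smul_left, RCLike.conj_ofReal, RCLike.re_ofReal_mul, one_apply_eq_self,
      inner_self_eq_norm_sq_to_K, ← RCLike.ofReal_pow, RCLike.ofReal_re]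
  have e1 := re_inner_opFun_mono h₁ (f := F) (g := fun t => F (l t) + η) hF (hFl.add continuousOn_const)
    (fun t ht => by linarith [(abs_le.1 (hclose t ht)).1]) x
  have e2 := re_inner_opFun_mono h₂ (f := fun t => F (l t)) (g := fun t => F t + η) hFl
    (hF.add continuousOn_const) (fun t ht => by linarith [(abs_le.1 (hclose t ht)).2]) x
  rw [opFun_add h₁ hFl continuousOn_const, opFun_const h₁, add_apply, inner_add_left, map_add,
    hqc h₁] at e1
  rw [opFun_add h₂ hF continuousOn_const, opFun_const h₂, add_apply, inner_add_left, map_add,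
    hqc h₂] at e2
  linarith

theorem IsOperatorMonotone.norm_opFun_le {f k : ℝ → ℝ} {b : ℝ} (hf : IsOperatorMonotone 𝕜 H f b)
    (hb : 0 < b) (hk : ContinuousOn k (Set.Icc 0 b)) (hfk : ∀ t ∈ Set.Ioc 0 b, f t = k t ^ 2)
    {S₁ S₂ : H →L[𝕜] H} (h₁ : SpectrumIn S₁ (Set.Icc 0 b)) (h₂ : SpectrumIn S₂ (Set.Icc 0 b))
    (h : ∀ x, RCLike.re (inner 𝕜 (S₁ x) x) ≤ RCLike.re (inner 𝕜 (S₂ x) x)) (x : H) :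
    ‖opFun k S₁ x‖ ≤ ‖opFun k S₂ x‖ := by
  have h1 := hf.re_inner_le (F := fun t => k t ^ 2) hb (hk.pow 2) hfk h₁ h₂ h x
  rw [re_inner_opFun_sq h₁ hk, re_inner_opFun_sq h₂ hk] at h1
  exact (sq_le_sq₀ (norm_nonneg _) (norm_nonneg _)).1 h1

/-! ### The normalized operator `T*T/M²` and its comparison with powers of `G`. -/

noncomputable section

/-- The normalized operator `T*T / M²`. -/
def gramOp (M : ℝ) (T : H →L[𝕜] Z) : H →L[𝕜] H := (((M ^ 2)⁻¹ : ℝ) : 𝕜) • (adjoint T ∘L T)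

theorem isSelfAdjoint_gramOp (M : ℝ) (T : H →L[𝕜] Z) : IsSelfAdjoint (gramOp M T) := by
  rw [gramOp, isSelfAdjoint_iff, star_smul, star_eq_adjoint, adjoint_comp, adjoint_adjoint]
  simp

theorem re_inner_gramOp (M : ℝ) (T : H →L[𝕜] Z) (x : H) :
    RCLike.re (inner 𝕜 (gramOp M T x) x) = (M ^ 2)⁻¹ * ‖T x‖ ^ 2 := by
  rw [gramOp, smul_apply, inner_smul_left, RCLike.conj_ofReal, RCLike.re_ofReal_mul, comp_apply,
    adjoint_inner_left, inner_self_eq_norm_sq_to_K, ← RCLike.ofReal_pow, RCLike.ofReal_re]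

theorem adjoint_comp_self_apply {M : ℝ} (hM : 0 < M) (T : H →L[𝕜] Z) (x : H) :
    adjoint T (T x) = ((M ^ 2 : ℝ) : 𝕜) • gramOp M T x := by
  rw [gramOp, smul_apply, smul_smul, ← RCLike.ofReal_mul, mul_inv_cancel₀ (by positivity),
    RCLike.ofReal_one, one_smul, comp_apply]

variable {M b : ℝ} {T : H →L[𝕜] Z}

theorem norm_apply_eq_gramOp (hM : 0 < M) (hS : SpectrumIn (gramOp M T) (Set.Icc 0 b)) (x : H) :
    ‖T x‖ = M * ‖opFun (fun t => √t) (gramOp M T) x‖ := by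
  have h1 := re_inner_opFun_sq hS (f := fun t => √t) Real.continuous_sqrt.continuousOn x
  rw [opFun_congr hS (g := fun t => t) (fun t ht => Real.sq_sqrt ht.1), opFun_id hS,
    re_inner_gramOp] at h1
  have h2 : ‖T x‖ ^ 2 = (M * ‖opFun (fun t => √t) (gramOp M T) x‖) ^ 2 := by
    rw [mul_pow, ← h1]; field_simp
  exact (pow_left_inj₀ (norm_nonneg _) (by positivity) two_ne_zero).1 h2

theorem norm_apply_opFun_eq (hM : 0 < M) (hS : SpectrumIn (gramOp M T) (Set.Icc 0 b)) {f : ℝ → ℝ}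
    (hf : ContinuousOn f (Set.Icc 0 b)) (x : H) :
    ‖T (opFun f (gramOp M T) x)‖ = ‖opFun (fun t => M * √t * f t) (gramOp M T) x‖ := by
  rw [norm_apply_eq_gramOp hM hS, ← opFun_mul_apply hS Real.continuous_sqrt.continuousOn hf]
  simp only [mul_assoc]
  rw [norm_opFun_const_mul (f := fun t => √t * f t) hS M
    (Real.continuous_sqrt.continuousOn.mul hf), abs_of_pos hM]

theorem adjoint_comp_self_opFun (hM : 0 < M) (hS : SpectrumIn (gramOp M T) (Set.Icc 0 b)) {f : ℝ → ℝ}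
    (hf : ContinuousOn f (Set.Icc 0 b)) (x : H) :
    adjoint T (T (opFun f (gramOp M T) x)) = opFun (fun t => M ^ 2 * t * f t) (gramOp M T) x := by
  rw [adjoint_comp_self_apply hM]
  simp only [mul_assoc]
  rw [opFun_const_mul (f := fun t => t * f t) hS (M ^ 2) ((continuousOn_id' _).mul hf), smul_apply,
    opFun_mul_apply hS (continuousOn_id' _) hf, opFun_id hS]

variable {G : H →L[𝕜] H} {f : ℝ → ℝ} {a m : ℝ}

/-- The division by `M²` makes `T*T/M² ≤ f(G)²`, which keeps the spectrum inside the interval on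
which operator monotonicity is assumed. -/
theorem spectrumIn_gramOp (hG : SpectrumIn G (Set.Icc 0 a)) (ha : 0 < a)
    (hf : IsIndexFunction f a) (hM : 0 < M)
    (hT : ∀ x, ‖T x‖ ≤ M * ‖indexOp f G x‖) : SpectrumIn (gramOp M T) (Set.Icc 0 (f a ^ 2)) := by
  refine spectrumIn_Icc (isSelfAdjoint_gramOp M T) (fun x => ?_) fun x => ?_
  · rw [re_inner_gramOp, zero_mul]; positivity
  · have h0 := (hf.pos ⟨ha, le_rfl⟩).le
    have h1 : ‖indexOp f G x‖ ≤ f a * ‖x‖ := norm_opFun_apply_le hG hf.continuousOn_ext0 h0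
      (fun t ht => by
        have : ext0 f t ∈ Set.Icc 0 (f a) := by rw [← hf.image_ext0 ha]; exact ⟨t, ht, rfl⟩
        rw [abs_of_nonneg this.1]; exact this.2) x
    have h2 := (hT x).trans (mul_le_mul_of_nonneg_left h1 hM.le)
    rw [re_inner_gramOp, inv_mul_le_iff₀ (by positivity), ← mul_pow, ← mul_pow]
    exact pow_le_pow_left₀ (norm_nonneg _) h2 2

/-- The norm equivalence `k(T*T/M²) ∼ G^q` for `k = (f⁻¹ ∘ √)^q` with `k²` operator monotone. -/
theorem norm_equivalence (hG : SpectrumIn G (Set.Icc 0 a)) (ha : 0 < a)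
    (hf : IsIndexFunction f a) (hm : 0 < m) (hmM : m ≤ M)
    (hT₁ : ∀ x, m * ‖indexOp f G x‖ ≤ ‖T x‖) (hT₂ : ∀ x, ‖T x‖ ≤ M * ‖indexOp f G x‖)
    {q : ℝ} (hq : 0 ≤ q) {φ : ℝ → ℝ} (hφ : IsOperatorMonotone 𝕜 H φ (f a ^ 2))
    (hφk : ∀ t ∈ Set.Ioc 0 (f a ^ 2), φ t = invPow f a q t ^ 2)
    (hanti : AntitoneOn (fun t => invPow f a q t / √t) (Set.Ioc 0 (f a ^ 2))) (x : H) :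
    ‖opFun (invPow f a q) (gramOp M T) x‖ ≤ ‖opPow G q x‖ ∧
      ‖opPow G q x‖ ≤ M / m * ‖opFun (invPow f a q) (gramOp M T) x‖ := by
  have hM := hm.trans_le hmM
  have hS := spectrumIn_gramOp hG ha hf hM hT₂
  have hb : 0 < f a ^ 2 := by have := hf.pos ⟨ha, le_rfl⟩; positivity
  have hk := hf.invPow_continuousOn ha hq
  set r := m / M with hr
  have hr0 : 0 < r := div_pos hm hM
  have hr1 : r ≤ 1 := div_le_one_of_le₀ hmM hM.le
  have hmapr : ∀ {r : ℝ}, 0 < r → r ≤ 1 →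
      Set.MapsTo (fun t => (r * ext0 f t) ^ 2) (Set.Icc 0 a) (Set.Icc 0 (f a ^ 2)) := by
    intro r hr0 hr1 t ht
    have h1 : ext0 f t ∈ Set.Icc 0 (f a) := by rw [← hf.image_ext0 ha]; exact ⟨t, ht, rfl⟩
    refine ⟨sq_nonneg _, pow_le_pow_left₀ (mul_nonneg hr0.le h1.1) ?_ 2⟩
    exact (mul_le_of_le_one_left h1.1 hr1).trans h1.2
  have hcr : ∀ r : ℝ, ContinuousOn (fun t => r * ext0 f t) (Set.Icc 0 a) := fun r =>
    continuousOn_const.mul hf.continuousOn_ext0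
  have hcr2 : ∀ r : ℝ, ContinuousOn (fun t => (r * ext0 f t) ^ 2) (Set.Icc 0 a) := fun r =>
    (hcr r).pow 2
  have hre : ∀ (r : ℝ) (x : H), RCLike.re (inner 𝕜 (opFun (fun t => (r * ext0 f t) ^ 2) G x) x)
      = (|r| * ‖indexOp f G x‖) ^ 2 := by
    intro r x
    rw [re_inner_opFun_sq hG (hcr r), norm_opFun_const_mul hG r hf.continuousOn_ext0]
    rfl
  constructor
  -- Here `T*T/M² ≤ f(G)²`, and `k(f(t)²) = t^q`.
  · have h1 := hφ.norm_opFun_le hb hk hφk hS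
      (spectrumIn_opFun hG (hcr2 1) (hmapr one_pos le_rfl)) (fun x => by
        rw [re_inner_gramOp, hre, inv_mul_le_iff₀ (by positivity), ← mul_pow, abs_one, one_mul]
        exact pow_le_pow_left₀ (norm_nonneg _) (hT₂ x) 2) x
    rw [opFun_comp (f := fun t => (1 * ext0 f t) ^ 2) hG (hcr2 1) (hmapr one_pos le_rfl) hk,
      opFun_congr hG (g := fun t => t ^ q)
        (fun t ht => by simp only [one_mul]; exact hf.invPow_apply q ht)] at h1
    exact h1
  -- Here `(r f(G))² ≤ T*T/M²` with `r = m/M`. The factor `r` inside `k` comes out through `r k(f²)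
  -- ≤ k(r² f²)`, the consequence of `k/√t` being decreasing.
  · have h1 := hφ.norm_opFun_le hb hk hφk
      (spectrumIn_opFun hG (hcr2 r) (hmapr hr0 hr1)) hS (fun x => by
        rw [re_inner_gramOp, hre, inv_mul_eq_div, le_div_iff₀ (by positivity), ← mul_pow,
          abs_of_pos hr0]
        refine pow_le_pow_left₀ (by positivity) ?_ 2
        refine le_trans (le_of_eq ?_) (hT₁ x)
        rw [hr]; field_simp) x
    rw [opFun_comp (f := fun t => (r * ext0 f t) ^ 2) hG (hcr2 r) (hmapr hr0 hr1) hk] at h1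
    have h2 := norm_opFun_apply_le_mul (f := fun t => t ^ q)
      (g := fun t => invPow f a q ((r * ext0 f t) ^ 2)) hG (c := M / m)
      ((Real.continuous_rpow_const hq).continuousOn) (hk.comp (hcr2 r) (hmapr hr0 hr1))
      (div_nonneg hM.le hm.le) (fun t ht => by
        rw [abs_of_nonneg (Real.rpow_nonneg ht.1 q),
          abs_of_nonneg (invPow_nonneg hf ha q (hmapr hr0 hr1 ht)), ← hf.invPow_apply q ht]
        have hMr : M / m = r⁻¹ := by rw [hr, inv_div]
        rw [hMr, ← div_eq_inv_mul, le_div_iff₀' hr0]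
        rcases ht.1.eq_or_lt with rfl | h0
        · simp only [ext0_zero, mul_zero]
          exact mul_le_of_le_one_left (invPow_nonneg hf ha q (by simpa using hb.le)) hr1
        · simp only [mul_pow]
          have h3 := hmapr one_pos le_rfl ht
          simp only [one_mul] at h3
          refine mul_le_of_antitoneOn_div_sqrt hanti ⟨?_, h3.2⟩ hr0 hr1
          rw [ext0_of_pos f h0]
          have := hf.pos ⟨h0, ht.2⟩
          positivity) x
    exact h2.trans (mul_le_mul_of_nonneg_left h1 (div_nonneg hM.le hm.le))

end

end Operators

/-! ### Powers of `G`, the operator `A B^{-s}`, and the transformed iteration step. -/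

section Scale

open ContinuousLinearMap

set_option linter.unusedSectionVars false

variable {𝕜 X Y : Type*} [RCLike 𝕜] [NormedAddCommGroup X] [InnerProductSpace 𝕜 X]
  [CompleteSpace X] [NormedAddCommGroup Y] [InnerProductSpace 𝕜 Y] [CompleteSpace Y]
  {G : X →L[𝕜] X} {a : ℝ}

theorem IsInverse.injective {B : X →ₗ.[𝕜] X} (hGB : IsInverse G B) (x : X) (hx : G x = 0) :
    x = 0 := by
  obtain ⟨h, hB⟩ := hGB x
  have : (⟨G x, h⟩ : B.domain) = 0 := Subtype.ext hx
  rw [← hB, this]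
  exact B.map_zero

/-- Symmetry passes from `B` to its inverse, and `⟨x, G x⟩ = ⟨B (G x), G x⟩ ≥ 0` with the bound
`‖G‖` confines the quadratic form. -/
theorem IsInverse.spectrumIn {B : X →ₗ.[𝕜] X} (hB : IsScaleGenerator B) (hGB : IsInverse G B) :
    SpectrumIn G (Set.Icc 0 ‖G‖) := by
  have hsa : IsSelfAdjoint G := by
    rw [isSelfAdjoint_iff_isSymmetric]
    intro x y
    obtain ⟨hx, hBx⟩ := hGB x
    obtain ⟨hy, hBy⟩ := hGB y
    have h1 := LinearPMap.adjoint_isFormalAdjoint hB.dense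
    rw [LinearPMap.isSelfAdjoint_def.1 hB.selfAdjoint] at h1
    have h2 := h1 ⟨G x, hx⟩ ⟨G y, hy⟩
    rw [hBx, hBy] at h2
    exact h2.symm
  obtain ⟨c, hc, hpos⟩ := hB.pos
  refine spectrumIn_Icc hsa (fun x => ?_) fun x => ?_
  · obtain ⟨hx, hBx⟩ := hGB x
    have h1 := hpos ⟨G x, hx⟩
    rw [hBx] at h1
    have h2 : RCLike.re (inner 𝕜 (G x) x) = RCLike.re (inner 𝕜 x (G x)) := by
      rw [← inner_conj_symm, RCLike.conj_re]
    rw [h2, zero_mul]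
    exact le_trans (by positivity) h1
  · refine (RCLike.re_le_norm _).trans ((norm_inner_le_norm _ _).trans ?_)
    have := G.le_opNorm x
    nlinarith [norm_nonneg x]

theorem continuousOn_rpow {r : ℝ} (hr : 0 ≤ r) (K : Set ℝ) : ContinuousOn (fun t : ℝ => t ^ r) K :=
  (Real.continuous_rpow_const hr).continuousOn

theorem opPow_add (hG : SpectrumIn G (Set.Icc 0 a)) {r s : ℝ} (hr : 0 ≤ r) (hs : 0 ≤ s) (x : X) :
    opPow G (r + s) x = opPow G r (opPow G s x) := by
  rw [opPow, opPow, opPow, ← opFun_mul_apply hG (continuousOn_rpow hr _) (continuousOn_rpow hs _),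
    opFun_congr hG fun t ht => Real.rpow_add_of_nonneg ht.1 hr hs]

theorem opPow_zero (hG : SpectrumIn G (Set.Icc 0 a)) (x : X) : opPow G 0 x = x := by
  rw [opPow, opFun_congr hG fun t _ => Real.rpow_zero t, opFun_const hG]
  simp

theorem opPow_one (hG : SpectrumIn G (Set.Icc 0 a)) (x : X) : opPow G 1 x = G x := by
  rw [opPow, opFun_congr hG fun t _ => Real.rpow_one t, opFun_id hG]

theorem isSelfAdjoint_opPow (G : X →L[𝕜] X) (r : ℝ) : IsSelfAdjoint (opPow G r) :=
  isSelfAdjoint_opFun _ G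

/-- For an integer `n ≥ r` one has `G^n = G^{n-r} G^r`, and integer powers inherit injectivity from
`G`. -/
theorem opPow_injective (hG : SpectrumIn G (Set.Icc 0 a)) (hinj : ∀ x, G x = 0 → x = 0) {r : ℝ}
    (hr : 0 ≤ r) (x : X) (hx : opPow G r x = 0) : x = 0 := by
  have key : ∀ (n : ℕ) (y : X), opPow G n y = 0 → y = 0 := by
    intro n
    induction n with
    | zero => intro y hy; rwa [Nat.cast_zero, opPow_zero hG] at hy
    | succ n ih =>
      intro y hy
      rw [Nat.cast_succ, opPow_add hG n.cast_nonneg zero_le_one, opPow_one hG] at hy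
      exact hinj y (ih _ hy)
  obtain ⟨n, hn⟩ := exists_nat_ge r
  refine key n x ?_
  rw [← sub_add_cancel (n : ℝ) r, opPow_add hG (sub_nonneg.2 hn) hr, hx, map_zero]

theorem denseRange_opPow (hG : SpectrumIn G (Set.Icc 0 a)) (hinj : ∀ x, G x = 0 → x = 0) {r : ℝ}
    (hr : 0 ≤ r) : DenseRange (opPow G r) :=
  denseRange_of_isSelfAdjoint (isSelfAdjoint_opPow G r) (opPow_injective hG hinj hr)

theorem indexOp_psi_opPow (hG : SpectrumIn G (Set.Icc 0 a)) {ϱ : ℝ → ℝ} {r s : ℝ}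
    (hψ : IsIndexFunction (psi ϱ s) a) (hr : 0 ≤ r) (x : X) :
    indexOp (psi ϱ s) G (opPow G r x) = indexOp (psi ϱ (r + s)) G x := by
  rw [indexOp, indexOp, opPow, ← opFun_mul_apply hG hψ.continuousOn_ext0 (continuousOn_rpow hr _),
    opFun_congr hG fun t ht => ?_]
  rcases ht.1.eq_or_lt with rfl | h0
  · simp only [ext0_zero, zero_mul]
  · simp only [ext0_of_pos _ h0, psi, Real.rpow_add h0]
    ring

theorem psi_zero (ϱ : ℝ → ℝ) : psi ϱ 0 = ϱ := by
  funext t; simp [psi]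

theorem PowRel.sub {s : ℝ} {d d' z z' : X} (h : PowRel G s d z) (h' : PowRel G s d' z') :
    PowRel G s (d - d') (z - z') :=
  ⟨fun hs => by rw [map_sub, h.1 hs, h'.1 hs], fun hs => by rw [map_sub, h.2 hs, h'.2 hs]⟩

theorem PowRel.add {s : ℝ} {d d' z z' : X} (h : PowRel G s d z) (h' : PowRel G s d' z') :
    PowRel G s (d + d') (z + z') :=
  ⟨fun hs => by rw [map_add, h.1 hs, h'.1 hs], fun hs => by rw [map_add, h.2 hs, h'.2 hs]⟩

theorem PowRel.zero (G : X →L[𝕜] X) (s : ℝ) : PowRel G s 0 0 :=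
  ⟨fun _ => map_zero _, fun _ => map_zero _⟩

theorem PowRel.left_unique (hG : SpectrumIn G (Set.Icc 0 a)) (hinj : ∀ x, G x = 0 → x = 0)
    {s : ℝ} {d d' z : X} (h : PowRel G s d z) (h' : PowRel G s d' z) : d = d' := by
  have h1 := h.sub h'
  rw [sub_self] at h1
  rcases le_or_gt 0 s with hs | hs
  · have := h1.1 hs
    rw [map_zero] at this
    exact (sub_eq_zero.1 this.symm)
  · exact sub_eq_zero.1 (opPow_injective hG hinj (by linarith) _ (h1.2 hs))

theorem powRel_opPow {s : ℝ} (hs : 0 ≤ s) (z : X) : PowRel G s (opPow G s z) z :=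
  ⟨fun _ => rfl, fun h => absurd h (not_lt.2 hs)⟩

theorem powRel_of_neg {s : ℝ} (hs : s < 0) (d : X) : PowRel G s d (opPow G (-s) d) :=
  ⟨fun h => absurd hs (not_lt.2 h), fun _ => rfl⟩

/-- `T` is the bounded operator `A B^{-s}`. -/
def IsScaled (G : X →L[𝕜] X) (s : ℝ) (A T : X →L[𝕜] Y) : Prop :=
  ∀ d z, PowRel G s d z → A d = T z

/-- For `s ≥ 0`, `T` is `A G^s`. For `s < 0` the rule `G^{-s} x ↦ A x` is bounded on a dense set,
because `‖A x‖ ≤ M ‖ψ_s(G) G^{-s} x‖`, and `T` is its continuous extension. -/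
theorem exists_scaled (hG : SpectrumIn G (Set.Icc 0 a)) (hinj : ∀ x, G x = 0 → x = 0)
    {ϱ : ℝ → ℝ} {s m M : ℝ} (hϱ : IsIndexFunction ϱ a)
    (hψ : IsIndexFunction (psi ϱ s) a) (hM : 0 < M) {A : X →L[𝕜] Y}
    (h₁ : ∀ x, m * ‖indexOp ϱ G x‖ ≤ ‖A x‖) (h₂ : ∀ x, ‖A x‖ ≤ M * ‖indexOp ϱ G x‖) :
    ∃ T : X →L[𝕜] Y, IsScaled G s A T ∧ (∀ x, m * ‖indexOp (psi ϱ s) G x‖ ≤ ‖T x‖) ∧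
      ∀ x, ‖T x‖ ≤ M * ‖indexOp (psi ϱ s) G x‖ := by
  rcases le_or_gt 0 s with hs | hs
  · have h0 : ∀ x, indexOp ϱ G (opPow G s x) = indexOp (psi ϱ s) G x := by
      intro x
      have := indexOp_psi_opPow (ϱ := ϱ) (s := 0) hG (by rwa [psi_zero]) hs x
      rwa [psi_zero, add_zero] at this
    refine ⟨A ∘L opPow G s, fun d z h => ?_, fun x => ?_, fun x => ?_⟩
    · rw [comp_apply, h.1 hs]
    · rw [← h0]; exact h₁ _
    · rw [← h0]; exact h₂ _
  · have hs' : 0 ≤ -s := by linarith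
    have h0 : ∀ x, indexOp (psi ϱ s) G (opPow G (-s) x) = indexOp ϱ G x := by
      intro x
      have := indexOp_psi_opPow hG hψ hs' x
      rwa [neg_add_cancel, psi_zero] at this
    have hd := denseRange_opPow hG hinj hs'
    obtain ⟨T, hT, -⟩ := exists_factor hd A (C := M * ‖indexOp (psi ϱ s) G‖) fun x => by
      refine (h₂ x).trans ?_
      rw [← h0, mul_assoc]
      exact mul_le_mul_of_nonneg_left (le_opNorm _ _) hM.le
    refine ⟨T, fun d z h => ?_, fun x => ?_, fun x => ?_⟩
    · rw [← h.2 hs, hT]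
    · refine hd.induction_on (p := fun x => m * ‖indexOp (psi ϱ s) G x‖ ≤ ‖T x‖) x
        (isClosed_le (by fun_prop) (by fun_prop)) fun x => ?_
      rw [h0, hT]; exact h₁ x
    · refine hd.induction_on (p := fun x => ‖T x‖ ≤ M * ‖indexOp (psi ϱ s) G x‖) x
        (isClosed_le (by fun_prop) (by fun_prop)) fun x => ?_
      rw [h0, hT]; exact h₂ x

/-- In the low order case the range of `T*` is contained in the domain of `B^{-s}`. -/
theorem exists_powRel_adjoint (hG : SpectrumIn G (Set.Icc 0 a)) (hinj : ∀ x, G x = 0 → x = 0)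
    (ha : 0 < a) {ϱ : ℝ → ℝ} {s p M : ℝ} (hp : 0 < p) (hψ : IsIndexFunction (psi ϱ s) a)
    (hM : 0 < M) {T : X →L[𝕜] Y} (hT : ∀ x, ‖T x‖ ≤ M * ‖indexOp (psi ϱ s) G x‖)
    (hanti : s < 0 →
      AntitoneOn (fun t => invPow (psi ϱ s) a (p - s) t / √t) (Set.Ioc 0 (psi ϱ s a ^ 2)))
    (y : Y) : ∃ d, PowRel G s d (adjoint T y) := by
  rcases le_or_gt 0 s with hs | hs
  · exact ⟨_, powRel_opPow hs _⟩
  · have hs' : 0 ≤ -s := by linarith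
    have hψa := hψ.pos ⟨ha, le_rfl⟩
    -- Comparing `k/√t` at `ψ_s(t)²` and at the right endpoint gives `a^{p-s} ψ_s(t) ≤ t^{p-s}
    -- ψ_s(a)`; with `t^p ≤ a^p` this is `ψ_s(t) ≤ C t^{-s}`. Hence `T` factors as `K G^{-s}`, and
    -- `T* = G^{-s} K*`.
    set C := psi ϱ s a / a ^ (p - s) * a ^ p with hC
    have hapos := Real.rpow_pos_of_pos ha (p - s)
    have hC0 : 0 ≤ C := by positivity
    have hbound : ∀ t ∈ Set.Icc 0 a, |ext0 (psi ϱ s) t| ≤ C * |t ^ (-s)| := by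
      intro t ht
      rw [abs_of_nonneg (hψ.ext0_nonneg ht), abs_of_nonneg (Real.rpow_nonneg ht.1 _)]
      rcases ht.1.eq_or_lt with rfl | h0
      · rw [ext0_zero]; exact mul_nonneg hC0 (Real.rpow_nonneg le_rfl _)
      · have ht' : t ∈ Set.Ioc 0 a := ⟨h0, ht.2⟩
        have hψt := hψ.pos ht'
        have hle := hψ.strictMonoOn.monotoneOn ht' ⟨ha, le_rfl⟩ ht.2
        have h1 := hanti hs ⟨by positivity, pow_le_pow_left₀ hψt.le hle 2⟩
          ⟨by positivity, le_rfl⟩ (pow_le_pow_left₀ hψt.le hle 2)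
        simp only [hψ.invPow_apply_of_pos _ ht', hψ.invPow_apply_of_pos _ (⟨ha, le_rfl⟩ : a ∈ Set.Ioc 0 a),
          Real.sqrt_sq hψt.le, Real.sqrt_sq hψa.le] at h1
        rw [div_le_div_iff₀ hψa hψt, sub_eq_add_neg p s, Real.rpow_add h0] at h1
        rw [ext0_of_pos _ h0, hC, div_mul_eq_mul_div, div_mul_eq_mul_div, le_div_iff₀ hapos]
        have h2 : t ^ p ≤ a ^ p := Real.rpow_le_rpow h0.le ht.2 hp.le
        have h3 := Real.rpow_pos_of_pos h0 (-s)
        calc psi ϱ s t * a ^ (p - s) = a ^ (p + -s) * psi ϱ s t := by rw [sub_eq_add_neg, mul_comm]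
          _ ≤ t ^ p * t ^ (-s) * psi ϱ s a := h1
          _ ≤ a ^ p * t ^ (-s) * psi ϱ s a := by gcongr
          _ = _ := by ring
    obtain ⟨K, hK, -⟩ := exists_factor (denseRange_opPow hG hinj hs') T (C := M * C) fun x => by
      refine (hT x).trans ?_
      rw [mul_assoc]
      exact mul_le_mul_of_nonneg_left (norm_opFun_apply_le_mul hG hψ.continuousOn_ext0
        (continuousOn_rpow hs' _) hC0 hbound x) hM.le
    have hTK : T = K ∘L opPow G (-s) := by ext x; exact (hK x).symm
    refine ⟨adjoint K y, fun h => absurd hs (not_lt.2 h), fun _ => ?_⟩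
    rw [hTK, adjoint_comp, (isSelfAdjoint_opPow G (-s)).adjoint_eq, comp_apply]

/-- With `ζ = B^s (x' - x)` the step is a Tikhonov step for `T`. For `s ≥ 0` one applies `G^s` and
uses `T* = G^s A*`; for `s < 0` the given equation is `G^{-s}` applied to the new one, and `G^{-s}`
is injective. -/
theorem isIterationStep_iff (hG : SpectrumIn G (Set.Icc 0 a)) (hinj : ∀ x, G x = 0 → x = 0)
    {s α : ℝ} (hα : 0 < α) {A T : X →L[𝕜] Y} (hAT : IsScaled G s A T) (y : Y) (x x' : X) :
    IsIterationStep A G s α y x x' ↔ ∃ ζ, PowRel G s (x' - x) ζ ∧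
      adjoint T (T ζ) + (α : 𝕜) • ζ = - adjoint T (A x - y) := by
  have hα' : (α : 𝕜) ≠ 0 := RCLike.ofReal_ne_zero.2 hα.ne'
  rcases le_or_gt 0 s with hs | hs
  · have h2s : (0 : ℝ) ≤ 2 * s := by linarith
    have hTA : T = A ∘L opPow G s := by ext z; exact (hAT _ z (powRel_opPow hs z)).symm
    have hT' : ∀ y, adjoint T y = opPow G s (adjoint A y) := by
      intro y
      rw [hTA, adjoint_comp, (isSelfAdjoint_opPow G s).adjoint_eq, comp_apply]
    have hpow : ∀ z, opPow G (2 * s) z = opPow G s (opPow G s z) := fun z => by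
      rw [two_mul, opPow_add hG hs hs]
    constructor
    · rintro ⟨z, hz, heq⟩
      have h1 := hz.1 h2s
      rw [hpow] at h1
      have h2 : PowRel G s (x' - x) (opPow G s z) := h1 ▸ powRel_opPow hs _
      refine ⟨_, h2, ?_⟩
      rw [← hAT _ _ h2, hT', hT', ← map_smul, ← map_add, heq, map_neg]
    · rintro ⟨ζ, hζ, heq⟩
      -- The candidate for `B^{2s}(x' - x)` is obtained by solving the step equation for it.
      have hz : opPow G s ((α : 𝕜)⁻¹ • (- adjoint A (A x - y) - adjoint A (A (x' - x)))) = ζ := by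
        rw [map_smul, map_sub, map_neg, ← hT', ← hT', ← heq, hAT _ _ hζ, add_sub_cancel_left,
          smul_smul, inv_mul_cancel₀ hα', one_smul]
      refine ⟨(α : 𝕜)⁻¹ • (- adjoint A (A x - y) - adjoint A (A (x' - x))),
        ⟨fun _ => ?_, fun h => absurd h (not_lt.2 h2s)⟩, ?_⟩
      · rw [hpow, hz, hζ.1 hs]
      · rw [smul_smul, mul_inv_cancel₀ hα', one_smul, add_sub_cancel]
  · have hs' : 0 ≤ -s := by linarith
    have h2s : 2 * s < 0 := by linarith
    have hAT' : A = T ∘L opPow G (-s) := by ext d; exact hAT d _ (powRel_of_neg hs d)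
    have hA' : ∀ y, adjoint A y = opPow G (-s) (adjoint T y) := by
      intro y
      rw [hAT', adjoint_comp, (isSelfAdjoint_opPow G (-s)).adjoint_eq, comp_apply]
    have hpow : ∀ z, opPow G (-(2 * s)) z = opPow G (-s) (opPow G (-s) z) := fun z => by
      rw [two_mul, neg_add, opPow_add hG hs' hs']
    constructor
    · rintro ⟨z, hz, heq⟩
      refine ⟨_, powRel_of_neg hs _, ?_⟩
      have h1 := hz.2 h2s
      rw [hpow] at h1
      rw [← h1, hA', hA', ← map_smul, ← map_add, ← map_neg,
        hAT _ _ (powRel_of_neg hs (x' - x))] at heq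
      have h2 := opPow_injective hG hinj hs' _ (by rw [map_sub]; exact sub_eq_zero.2 heq)
      exact sub_eq_zero.1 h2
    · rintro ⟨ζ, hζ, heq⟩
      refine ⟨opPow G (-s) ζ, ⟨fun h => absurd h2s (not_lt.2 h), fun _ => ?_⟩, ?_⟩
      · rw [hpow, hζ.2 hs]
      · rw [hA', hA', ← map_smul, ← map_add, ← map_neg, hAT _ _ hζ, heq]

end Scale

/-! ### Closed form, existence and uniqueness of the iterates. -/

section Iteration

open ContinuousLinearMap

set_option linter.unusedSectionVars false

variable {𝕜 X Y : Type*} [RCLike 𝕜] [NormedAddCommGroup X] [InnerProductSpace 𝕜 X]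
  [CompleteSpace X] [NormedAddCommGroup Y] [InnerProductSpace 𝕜 Y] [CompleteSpace Y]
  {G : X →L[𝕜] X} {a b M s : ℝ} {A T : X →L[𝕜] Y} {α : ℕ → ℝ} {n : ℕ}

theorem continuousOn_iterFilter_mul (M : ℝ) (hα : ∀ k ∈ Finset.Icc 1 n, 0 < α k) (b : ℝ) :
    ContinuousOn (fun t => iterFilter α n (M ^ 2 * t)) (Set.Icc 0 b) :=
  (iterFilter_continuousOn hα).comp (by fun_prop) fun _ ht => mul_nonneg (sq_nonneg M) ht.1

noncomputable section

/-- `g_k(T*T) w`. -/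
def iterVec (M : ℝ) (T : X →L[𝕜] Y) (α : ℕ → ℝ) (k : ℕ) (w : X) : X :=
  opFun (fun t => iterFilter α k (M ^ 2 * t)) (gramOp M T) w

/-- `(g_{k+1} - g_k)(T*T) w`. -/
def iterIncr (M : ℝ) (T : X →L[𝕜] Y) (α : ℕ → ℝ) (k : ℕ) (w : X) : X :=
  opFun (fun t => (1 - M ^ 2 * t * iterFilter α k (M ^ 2 * t)) / (M ^ 2 * t + α (k + 1)))
    (gramOp M T) w

theorem continuousOn_residual (M : ℝ) (hα : ∀ k ∈ Finset.Icc 1 n, 0 < α k) (b : ℝ) :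
    ContinuousOn (fun t => 1 - M ^ 2 * t * iterFilter α n (M ^ 2 * t)) (Set.Icc 0 b) :=
  continuousOn_const.sub (ContinuousOn.mul (by fun_prop) (continuousOn_iterFilter_mul M hα b))

theorem continuousOn_incr (M : ℝ) (hα : ∀ k ∈ Finset.Icc 1 (n + 1), 0 < α k) (b : ℝ) :
    ContinuousOn
      (fun t => (1 - M ^ 2 * t * iterFilter α n (M ^ 2 * t)) / (M ^ 2 * t + α (n + 1)))
      (Set.Icc 0 b) := by
  refine (continuousOn_residual M (fun k hk => hα k ?_) b).div (by fun_prop) fun t ht => ?_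
  · exact Finset.Icc_subset_Icc_right n.le_succ hk
  · have := hα (n + 1) (by simp)
    have := ht.1
    positivity

theorem iterVec_succ (hS : SpectrumIn (gramOp M T) (Set.Icc 0 b))
    (hα : ∀ k ∈ Finset.Icc 1 (n + 1), 0 < α k) (w : X) :
    iterVec M T α (n + 1) w = iterVec M T α n w + iterIncr M T α n w := by
  have h1 := opFun_add hS (continuousOn_iterFilter_mul M
    (fun k hk => hα k (Finset.Icc_subset_Icc_right n.le_succ hk)) b) (continuousOn_incr M hα b)
  exact congrArg (fun F : X →L[𝕜] X => F w) h1

theorem iterVec_zero (hS : SpectrumIn (gramOp M T) (Set.Icc 0 b)) (w : X) :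
    iterVec M T α 0 w = 0 := by
  have h := opFun_const hS 0
  rw [RCLike.ofReal_zero, zero_smul] at h
  exact congrArg (fun F : X →L[𝕜] X => F w) h

theorem residual_apply (hM : 0 < M) (hS : SpectrumIn (gramOp M T) (Set.Icc 0 b))
    (hα : ∀ k ∈ Finset.Icc 1 n, 0 < α k) (w : X) :
    opFun (fun t => 1 - M ^ 2 * t * iterFilter α n (M ^ 2 * t)) (gramOp M T) w
      = w - adjoint T (T (iterVec M T α n w)) := by
  have hg := continuousOn_iterFilter_mul M hα b
  rw [iterVec, adjoint_comp_self_opFun hM hS hg,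
    opFun_sub (g := fun t => M ^ 2 * t * iterFilter α n (M ^ 2 * t)) hS continuousOn_const
      (ContinuousOn.mul (by fun_prop) hg), opFun_const hS,
    sub_apply, RCLike.ofReal_one, one_smul, one_apply_eq_self]

/-- On the spectrum this is the scalar identity `(M² t + α) · (1 - M² t g) / (M² t + α) = 1 - M² t
g`; it identifies the increment of the filters with the solution of one Tikhonov step. -/
theorem iterIncr_eq (hM : 0 < M) (hS : SpectrumIn (gramOp M T) (Set.Icc 0 b))
    (hα : ∀ k ∈ Finset.Icc 1 (n + 1), 0 < α k) (w : X) :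
    adjoint T (T (iterIncr M T α n w)) + (α (n + 1) : 𝕜) • iterIncr M T α n w
      = w - adjoint T (T (iterVec M T α n w)) := by
  have hα' : ∀ k ∈ Finset.Icc 1 n, 0 < α k := fun k hk =>
    hα k (Finset.Icc_subset_Icc_right n.le_succ hk)
  have hc := continuousOn_incr M hα b
  rw [← residual_apply hM hS hα', iterIncr, adjoint_comp_self_opFun hM hS hc, ← smul_apply,
    ← opFun_const_mul hS _ hc, ← add_apply,
    ← opFun_add (f := fun t => M ^ 2 * t * _) (g := fun t => α (n + 1) * _) hS
      (ContinuousOn.mul (by fun_prop) hc) (continuousOn_const.mul hc),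
    opFun_congr hS fun t ht => ?_]
  have := hα (n + 1) (by simp)
  have := ht.1
  have : M ^ 2 * t + α (n + 1) ≠ 0 := by positivity
  field_simp

theorem eq_of_regularized_eq {c : ℝ} (hc : 0 < c) {ζ ζ' : X}
    (h : adjoint T (T ζ) + (c : 𝕜) • ζ = adjoint T (T ζ') + (c : 𝕜) • ζ') : ζ = ζ' := by
  have h1 : adjoint T (T (ζ - ζ')) + (c : 𝕜) • (ζ - ζ') = 0 := by
    rw [map_sub, map_sub, smul_sub, sub_add_sub_comm, h, sub_self]
  have h2 : RCLike.re (inner 𝕜 (adjoint T (T (ζ - ζ')) + (c : 𝕜) • (ζ - ζ')) (ζ - ζ')) = 0 := by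
    rw [h1, inner_zero_left, map_zero]
  rw [inner_add_left, map_add, adjoint_inner_left, inner_smul_left, RCLike.conj_ofReal,
    RCLike.re_ofReal_mul, inner_self_eq_norm_sq, inner_self_eq_norm_sq] at h2
  have h3 : ‖ζ - ζ'‖ ^ 2 = 0 := by nlinarith [sq_nonneg ‖T (ζ - ζ')‖, sq_nonneg ‖ζ - ζ'‖]
  exact sub_eq_zero.1 (norm_eq_zero.1 (pow_eq_zero_iff two_ne_zero |>.1 h3))

/-- The iterates satisfy `B^s (x_n - x₀) = g_n(T*T) T* (y - A x₀)`. -/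
theorem IsIterate.powRel (hG : SpectrumIn G (Set.Icc 0 a)) (hinj : ∀ x, G x = 0 → x = 0)
    (hM : 0 < M) (hS : SpectrumIn (gramOp M T) (Set.Icc 0 b)) (hAT : IsScaled G s A T)
    (hα : ∀ k ∈ Finset.Icc 1 n, 0 < α k) {x₀ x : X} {y : Y}
    (hx : IsIterate A G s x₀ α n y x) :
    PowRel G s (x - x₀) (iterVec M T α n (adjoint T (y - A x₀))) := by
  obtain ⟨u, hu0, hstep, rfl⟩ := hx
  induction n with
  | zero => rw [hu0, sub_self, iterVec_zero hS]; exact PowRel.zero G s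
  | succ n ih =>
    have hsub := Finset.Icc_subset_Icc_right (a := 1) n.le_succ
    have h1 := ih (fun k hk => hα k (hsub hk)) fun k hk => hstep k (hsub hk)
    have h2 := hstep (n + 1) (by simp)
    have hα1 := hα (n + 1) (by simp)
    rw [add_tsub_cancel_right, isIterationStep_iff hG hinj hα1 hAT] at h2
    obtain ⟨ζ, hζ, heq⟩ := h2
    -- Both solve the same equation with `T*T + α`: since `A (x_n - x₀) = T g_n(T*T) w`, the
    -- right-hand side of the step is the residual `w - T*T g_n(T*T) w`.
    have h3 : ζ = iterIncr M T α n (adjoint T (y - A x₀)) := by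
      refine eq_of_regularized_eq (T := T) hα1 ?_
      rw [heq, iterIncr_eq hM hS hα, ← hAT _ _ h1, ← map_sub, ← map_neg, map_sub A]
      congr 1
      abel
    rw [iterVec_succ hS hα, ← h3]
    have := h1.add hζ
    rwa [sub_add_sub_cancel'] at this

/-- For `s < 0` an increment `ζ` is admissible only if it is in the range of `G^{-s}`. The Tikhonov
equation puts `ζ` in the range of `T*`, and `hran` says that such vectors are admissible. -/
theorem exists_isIterate (hG : SpectrumIn G (Set.Icc 0 a)) (hinj : ∀ x, G x = 0 → x = 0)
    (hM : 0 < M) (hS : SpectrumIn (gramOp M T) (Set.Icc 0 b)) (hAT : IsScaled G s A T)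
    (hran : ∀ y, ∃ d, PowRel G s d (adjoint T y))
    (hα : ∀ k ∈ Finset.Icc 1 n, 0 < α k) (x₀ : X) (y : Y) :
    ∃ x, IsIterate A G s x₀ α n y x := by
  induction n with
  | zero => exact ⟨x₀, fun _ => x₀, rfl, by simp, rfl⟩
  | succ n ih =>
    have hsub := Finset.Icc_subset_Icc_right (a := 1) n.le_succ
    obtain ⟨x, hx⟩ := ih fun k hk => hα k (hsub hk)
    have h1 := hx.powRel hG hinj hM hS hAT fun k hk => hα k (hsub hk)
    obtain ⟨u, hu0, hstep, rfl⟩ := hx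
    have hα1 := hα (n + 1) (by simp)
    have hα' : (α (n + 1) : 𝕜) ≠ 0 := RCLike.ofReal_ne_zero.2 hα1.ne'
    set w := adjoint T (y - A x₀) with hw
    set ζ := iterIncr M T α n w with hζ
    have heq := iterIncr_eq hM hS hα w
    rw [← hζ] at heq
    have heq' : ζ = adjoint T ((α (n + 1) : 𝕜)⁻¹ • (y - A x₀ - T (iterVec M T α n w) - T ζ)) := by
      rw [map_smul, map_sub, map_sub, ← hw, ← heq, add_sub_cancel_left, smul_smul,
        inv_mul_cancel₀ hα', one_smul]
    obtain ⟨d, hd⟩ := hran ((α (n + 1) : 𝕜)⁻¹ • (y - A x₀ - T (iterVec M T α n w) - T ζ))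
    rw [← heq'] at hd
    refine ⟨u n + d, fun k => if k ≤ n then u k else u n + d, by simpa using hu0, ?_, by simp⟩
    intro k hk
    rw [Finset.mem_Icc] at hk
    rcases hk.2.eq_or_lt with rfl | hlt
    · simp only [add_tsub_cancel_right, le_refl, if_true, add_le_iff_nonpos_right,
        nonpos_iff_eq_zero, one_ne_zero, if_false]
      rw [isIterationStep_iff hG hinj hα1 hAT]
      refine ⟨ζ, by rwa [add_sub_cancel_left], ?_⟩
      rw [heq, hw, ← hAT _ _ h1, ← map_sub, ← map_neg, map_sub A]
      congr 1
      abel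
    · have hkn : k ≤ n := Nat.lt_succ_iff.1 hlt
      simp only [hkn, if_true, (Nat.sub_le k 1).trans hkn]
      exact hstep k (Finset.mem_Icc.2 ⟨hk.1, hkn⟩)

theorem existsUnique_isIterate (hG : SpectrumIn G (Set.Icc 0 a)) (hinj : ∀ x, G x = 0 → x = 0)
    (hM : 0 < M) (hS : SpectrumIn (gramOp M T) (Set.Icc 0 b)) (hAT : IsScaled G s A T)
    (hran : ∀ y, ∃ d, PowRel G s d (adjoint T y))
    (hα : ∀ k ∈ Finset.Icc 1 n, 0 < α k) (x₀ : X) (y : Y) :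
    ∃! x, IsIterate A G s x₀ α n y x := by
  obtain ⟨x, hx⟩ := exists_isIterate hG hinj hM hS hAT hran hα x₀ y
  refine ⟨x, hx, fun x' hx' => ?_⟩
  exact sub_left_injective ((hx'.powRel hG hinj hM hS hAT hα).left_unique hG hinj
    (hx.powRel hG hinj hM hS hAT hα))

end

end Iteration

/-! ### Error estimates under the abstract equivalence `k(T*T/M²) ∼ Q`. -/

section ErrorEstimates

open ContinuousLinearMap

set_option linter.unusedSectionVars false

variable {𝕜 X Y : Type*} [RCLike 𝕜] [NormedAddCommGroup X] [InnerProductSpace 𝕜 X]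
  [CompleteSpace X] [NormedAddCommGroup Y] [InnerProductSpace 𝕜 Y] [CompleteSpace Y]
  {b M c τ : ℝ} {T : X →L[𝕜] Y} {α : ℕ → ℝ} {n : ℕ} {k : ℝ → ℝ} {Q : X →L[𝕜] X}

/-- The data of the abstract error estimate: a function `k` with `k(T*T/M²) ∼ Q`, where `τ`
corresponds to the parameter `1 / σ_n`. -/
structure ErrorSetup (M b c τ : ℝ) (T : X →L[𝕜] Y) (α : ℕ → ℝ) (n : ℕ) (k : ℝ → ℝ)
    (Q : X →L[𝕜] X) : Prop where
  M_pos : 0 < M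
  spec : SpectrumIn (gramOp M T) (Set.Icc 0 b)
  k_cont : ContinuousOn k (Set.Icc 0 b)
  k_mono : MonotoneOn k (Set.Icc 0 b)
  k_anti : AntitoneOn (fun t => k t / √t) (Set.Ioc 0 b)
  k_nonneg : ∀ t ∈ Set.Icc 0 b, 0 ≤ k t
  Q_sa : IsSelfAdjoint Q
  Q_inj : ∀ x, Q x = 0 → x = 0
  c_nonneg : 0 ≤ c
  le_Q : ∀ x, ‖opFun k (gramOp M T) x‖ ≤ ‖Q x‖
  Q_le : ∀ x, ‖Q x‖ ≤ c * ‖opFun k (gramOp M T) x‖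
  α_pos : ∀ j ∈ Finset.Icc 1 n, 0 < α j
  σ_pos : 0 < sigma α n
  τ_mem : τ ∈ Set.Ioc 0 b
  τ_eq : sigma α n * (M ^ 2 * τ) = 1
  kτ_pos : 0 < k τ

namespace ErrorSetup

variable (h : ErrorSetup M b c τ T α n k Q)

include h

theorem filter_cont : ContinuousOn (fun t => iterFilter α n (M ^ 2 * t)) (Set.Icc 0 b) :=
  continuousOn_iterFilter_mul M h.α_pos b

theorem bounds {t : ℝ} (ht : t ∈ Set.Icc 0 b) :
    0 ≤ iterFilter α n (M ^ 2 * t) ∧ iterFilter α n (M ^ 2 * t) ≤ sigma α n ∧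
      0 ≤ 1 - M ^ 2 * t * iterFilter α n (M ^ 2 * t) ∧
      (1 - M ^ 2 * t * iterFilter α n (M ^ 2 * t)) * (1 + sigma α n * (M ^ 2 * t)) ≤ 1 :=
  iterFilter_bounds h.α_pos (mul_nonneg (sq_nonneg M) ht.1)

theorem estimates {t : ℝ} (ht : t ∈ Set.Icc 0 b) :
    M * √t * iterFilter α n (M ^ 2 * t) ≤ √(sigma α n) / k τ * k t ∧
      M * √t * (1 - M ^ 2 * t * iterFilter α n (M ^ 2 * t)) * k t ≤ k τ / √(sigma α n) ∧
      M * √t * iterFilter α n (M ^ 2 * t) * k t ≤ √(sigma α n) * k τ ∧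
      M * √t * (1 - M ^ 2 * t * iterFilter α n (M ^ 2 * t)) ≤ (√(sigma α n) * k τ)⁻¹ * k t :=
  filter_estimates h.M_pos h.σ_pos h.τ_mem h.τ_eq h.k_mono h.k_anti h.k_nonneg h.kτ_pos ht
    (h.bounds ht).1 (h.bounds ht).2.1 (h.bounds ht).2.2.1 (h.bounds ht).2.2.2

theorem norm_T_opFun_le {φ : ℝ → ℝ} (hφ : ContinuousOn φ (Set.Icc 0 b))
    (hφ0 : ∀ t ∈ Set.Icc 0 b, 0 ≤ φ t) {C : ℝ} (hC : 0 ≤ C)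
    (hle : ∀ t ∈ Set.Icc 0 b, M * √t * φ t ≤ C) (x : X) :
    ‖T (opFun φ (gramOp M T) x)‖ ≤ C * ‖x‖ := by
  rw [norm_apply_opFun_eq h.M_pos h.spec hφ]
  refine norm_opFun_apply_le (f := fun t => M * √t * φ t) h.spec
    ((continuousOn_const.mul Real.continuous_sqrt.continuousOn).mul hφ) hC (fun t ht => ?_) x
  have h1 := h.M_pos
  have h2 := hφ0 t ht
  rw [abs_of_nonneg (by positivity)]
  exact hle t ht

theorem norm_T_opFun_le_mul {φ : ℝ → ℝ} (hφ : ContinuousOn φ (Set.Icc 0 b))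
    (hφ0 : ∀ t ∈ Set.Icc 0 b, 0 ≤ φ t) {C : ℝ} (hC : 0 ≤ C)
    (hle : ∀ t ∈ Set.Icc 0 b, M * √t * φ t ≤ C * k t) (x : X) :
    ‖T (opFun φ (gramOp M T) x)‖ ≤ C * ‖opFun k (gramOp M T) x‖ := by
  rw [norm_apply_opFun_eq h.M_pos h.spec hφ]
  refine norm_opFun_apply_le_mul (f := fun t => M * √t * φ t) h.spec
    ((continuousOn_const.mul Real.continuous_sqrt.continuousOn).mul hφ) h.k_cont hC
    (fun t ht => ?_) x
  have h1 := h.M_pos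
  have h2 := hφ0 t ht
  rw [abs_of_nonneg (by positivity), abs_of_nonneg (h.k_nonneg t ht)]
  exact hle t ht

theorem residual_cont :
    ContinuousOn (fun t => 1 - M ^ 2 * t * iterFilter α n (M ^ 2 * t)) (Set.Icc 0 b) :=
  continuousOn_residual M h.α_pos b

theorem norm_residual_le (x : X) :
    ‖opFun (fun t => 1 - M ^ 2 * t * iterFilter α n (M ^ 2 * t)) (gramOp M T) x‖ ≤ ‖x‖ := by
  have h1 := norm_opFun_apply_le h.spec h.residual_cont zero_le_one (fun t ht => by
    obtain ⟨h1, -, h3, -⟩ := h.bounds ht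
    rw [abs_of_nonneg h3]
    have := mul_nonneg (mul_nonneg (sq_nonneg M) ht.1) h1
    linarith) x
  rwa [one_mul] at h1

/-- `T g(T*T) T*` is the product of `T √g(T*T)` and its adjoint, and `‖T √g(T*T)‖² ≤ sup t g(t) ≤
1`. -/
theorem norm_filter_data_le (η : Y) : ‖T (iterVec M T α n (adjoint T η))‖ ≤ ‖η‖ := by
  set g : ℝ → ℝ := fun t => iterFilter α n (M ^ 2 * t) with hg
  have hgc : ContinuousOn (fun t => √(g t)) (Set.Icc 0 b) := h.filter_cont.sqrt
  set R := opFun (fun t => √(g t)) (gramOp M T) with hR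
  have hsq : iterVec M T α n (adjoint T η) = R (adjoint R (adjoint T η)) := by
    have h1 : adjoint R = R := (isSelfAdjoint_opFun _ _).adjoint_eq
    rw [h1, hR, ← opFun_mul_apply h.spec hgc hgc, iterVec,
      opFun_congr h.spec fun t ht => (Real.mul_self_sqrt (h.bounds ht).1).symm]
  have hle : ∀ x, ‖(T ∘L R) x‖ ≤ 1 * ‖x‖ := by
    intro x
    refine h.norm_T_opFun_le hgc (fun t _ => Real.sqrt_nonneg _) zero_le_one (fun t ht => ?_) x
    obtain ⟨h1, -, h3, -⟩ := h.bounds ht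
    have hM := h.M_pos
    refine (pow_le_one_iff_of_nonneg (by positivity) two_ne_zero).1 ?_
    rw [mul_pow, mul_pow, Real.sq_sqrt ht.1, Real.sq_sqrt h1]
    linarith
  rw [hsq, ← comp_apply (adjoint R), ← adjoint_comp, ← comp_apply T R]
  refine (hle _).trans ?_
  rw [one_mul]
  simpa using norm_adjoint_apply_le zero_le_one hle η

theorem iterVec_gram (x : X) :
    iterVec M T α n (adjoint T (T x)) = adjoint T (T (iterVec M T α n x)) := by
  rw [adjoint_comp_self_apply h.M_pos, adjoint_comp_self_apply h.M_pos, iterVec, map_smul, iterVec]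
  congr 1
  have := opFun_comm_apply h.spec h.filter_cont (continuousOn_id' _) x
  rwa [opFun_id h.spec] at this

theorem denseRange_k : DenseRange (opFun k (gramOp M T)) := by
  refine denseRange_of_isSelfAdjoint (isSelfAdjoint_opFun _ _) fun x hx => h.Q_inj x ?_
  have := h.Q_le x
  rw [hx, norm_zero, mul_zero] at this
  exact norm_le_zero_iff.1 this

theorem denseRange_Q : DenseRange Q := denseRange_of_isSelfAdjoint h.Q_sa h.Q_inj

/-- Douglas factorization turns the norm equivalence into bounded operators. Their adjoints give `Q
= k(S) L*` and `k(S) = Q K*`, so elements of one range can be rewritten in the other. -/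
theorem exists_equiv : ∃ K L : X →L[𝕜] X, (∀ x, K (Q x) = opFun k (gramOp M T) x) ∧
    (∀ x, L (opFun k (gramOp M T) x) = Q x) ∧ (∀ x, ‖K x‖ ≤ 1 * ‖x‖) ∧ ∀ x, ‖L x‖ ≤ c * ‖x‖ := by
  obtain ⟨K, hK, hK'⟩ := exists_factor h.denseRange_Q (opFun k (gramOp M T)) (C := 1) fun x => by
    rw [one_mul]; exact h.le_Q x
  obtain ⟨L, hL, hL'⟩ := exists_factor h.denseRange_k Q h.Q_le
  exact ⟨K, L, hK, hL, hK', hL'⟩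

theorem norm_T_filter_le (x : X) :
    ‖T (iterVec M T α n x)‖ ≤ √(sigma α n) / k τ * ‖opFun k (gramOp M T) x‖ :=
  h.norm_T_opFun_le_mul h.filter_cont (fun _ ht => (h.bounds ht).1)
    (div_nonneg (Real.sqrt_nonneg _) h.kτ_pos.le) (fun _ ht => (h.estimates ht).1) x

theorem norm_T_residual_le (x : X) :
    ‖T (opFun (fun t => 1 - M ^ 2 * t * iterFilter α n (M ^ 2 * t)) (gramOp M T) x)‖
      ≤ (√(sigma α n) * k τ)⁻¹ * ‖opFun k (gramOp M T) x‖ :=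
  h.norm_T_opFun_le_mul h.residual_cont (fun _ ht => (h.bounds ht).2.2.1)
    (inv_nonneg.2 (mul_nonneg (Real.sqrt_nonneg _) h.kτ_pos.le))
    (fun _ ht => (h.estimates ht).2.2.2) x

theorem norm_T_residual_k_le (x : X) :
    ‖T (opFun (fun t => 1 - M ^ 2 * t * iterFilter α n (M ^ 2 * t)) (gramOp M T)
      (opFun k (gramOp M T) x))‖ ≤ k τ / √(sigma α n) * ‖x‖ := by
  rw [← opFun_mul_apply h.spec h.residual_cont h.k_cont]
  exact h.norm_T_opFun_le (h.residual_cont.mul h.k_cont)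
    (fun _ ht => mul_nonneg (h.bounds ht).2.2.1 (h.k_nonneg _ ht))
    (div_nonneg h.kτ_pos.le (Real.sqrt_nonneg _))
    (fun _ ht => by have := (h.estimates ht).2.1; rwa [mul_assoc] at this) x

theorem norm_T_filter_k_le (x : X) :
    ‖T (iterVec M T α n (opFun k (gramOp M T) x))‖ ≤ √(sigma α n) * k τ * ‖x‖ := by
  rw [iterVec, ← opFun_mul_apply h.spec h.filter_cont h.k_cont]
  exact h.norm_T_opFun_le (h.filter_cont.mul h.k_cont)
    (fun _ ht => mul_nonneg (h.bounds ht).1 (h.k_nonneg _ ht))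
    (mul_nonneg (Real.sqrt_nonneg _) h.kτ_pos.le)
    (fun _ ht => by have := (h.estimates ht).2.2.1; rwa [mul_assoc] at this) x

/-- The error estimate in the low order case. -/
theorem error_low (v : X) (η : Y) :
    ∃ q, iterVec M T α n (adjoint T (η + T (Q v))) - Q v = Q q ∧
      ‖q‖ ≤ √(sigma α n) / k τ * ‖η‖ + c * ‖v‖ ∧
      ‖T (Q q)‖ ≤ ‖η‖ + k τ / √(sigma α n) * (c * ‖v‖) := by
  obtain ⟨K, L, hK, hL, hK', hL'⟩ := h.exists_equiv
  have hkτ := h.kτ_pos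
  set S := gramOp M T with hS
  set N := opFun k S with hN
  set R := opFun (fun t => 1 - M ^ 2 * t * iterFilter α n (M ^ 2 * t)) S with hR
  set g := opFun (fun t => iterFilter α n (M ^ 2 * t)) S with hg
  have hNa : adjoint N = N := (isSelfAdjoint_opFun _ _).adjoint_eq
  have hga : adjoint g = g := (isSelfAdjoint_opFun _ _).adjoint_eq
  have hQL : ∀ x, Q x = N (adjoint L x) := by
    have : Q = L ∘L N := by ext x; exact (hL x).symm
    intro x
    rw [← h.Q_sa.adjoint_eq, this, adjoint_comp, hNa, comp_apply]
  have hNK : ∀ x, N x = Q (adjoint K x) := by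
    have : N = K ∘L Q := by ext x; exact (hK x).symm
    intro x
    rw [← hNa, this, adjoint_comp, h.Q_sa.adjoint_eq, comp_apply]
  -- From `T g = F N` follows `g T* = N F*`: the propagated noise lies in the range of `N`, with a
  -- preimage of norm at most `√σ / k(τ)` times the noise.
  obtain ⟨F, hF, hF'⟩ := exists_factor h.denseRange_k (T ∘L g) h.norm_T_filter_le
  have hgF : ∀ y, g (adjoint T y) = N (adjoint F y) := by
    have : T ∘L g = F ∘L N := by ext x; exact (hF x).symm
    intro y
    rw [← comp_apply, ← comp_apply, ← hNa, ← adjoint_comp, ← this, adjoint_comp, hga]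
  set u := adjoint L v with hu
  have hun : ‖u‖ ≤ c * ‖v‖ := norm_adjoint_apply_le h.c_nonneg hL' v
  have hRN : R (N u) = N (R u) := opFun_comm_apply h.spec h.residual_cont h.k_cont u
  -- The error splits into propagated noise and residual. Both are then written as `N` of something,
  -- and `N = Q K*` produces `q`.
  have hz : iterVec M T α n (adjoint T (η + T (Q v))) - Q v = g (adjoint T η) - R (Q v) := by
    have h1 : iterVec M T α n (adjoint T (η + T (Q v)))
        = g (adjoint T η) + iterVec M T α n (adjoint T (T (Q v))) := by
      simp only [iterVec, map_add]; rfl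
    rw [h1, h.iterVec_gram, hR, residual_apply h.M_pos h.spec h.α_pos]
    abel
  have hzN : g (adjoint T η) - R (Q v) = N (adjoint F η - R u) := by
    rw [hgF, hQL v, hRN, map_sub]
  refine ⟨adjoint K (adjoint F η - R u), by rw [hz, hzN, hNK], ?_, ?_⟩
  · refine (norm_adjoint_apply_le zero_le_one hK' _).trans ?_
    rw [one_mul]
    refine (norm_sub_le _ _).trans (add_le_add ?_ ((h.norm_residual_le u).trans hun))
    exact norm_adjoint_apply_le (by positivity) hF' η
  · rw [← hNK, ← hzN, map_sub, hQL v]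
    refine (norm_sub_le _ _).trans (add_le_add (h.norm_filter_data_le η) ?_)
    exact (h.norm_T_residual_k_le u).trans (mul_le_mul_of_nonneg_left hun (by positivity))

/-- The error estimate in the high order case. -/
theorem error_high {D : X →L[𝕜] Y} (hD : ∀ x, D (Q x) = T x) (v : X) (η : Y) :
    ‖Q (iterVec M T α n (adjoint T (η + D v))) - v‖
        ≤ c * (√(sigma α n) * k τ * ‖η‖ + ‖v‖) ∧
      ‖D (Q (iterVec M T α n (adjoint T (η + D v))) - v)‖
        ≤ ‖η‖ + (√(sigma α n) * k τ)⁻¹ * ‖v‖ := by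
  obtain ⟨K, L, hK, hL, hK', hL'⟩ := h.exists_equiv
  have hkτ := h.kτ_pos
  have hc := h.c_nonneg
  set S := gramOp M T with hS
  set N := opFun k S with hN
  set R := opFun (fun t => 1 - M ^ 2 * t * iterFilter α n (M ^ 2 * t)) S with hR
  set g := opFun (fun t => iterFilter α n (M ^ 2 * t)) S with hg
  have hNa : adjoint N = N := (isSelfAdjoint_opFun _ _).adjoint_eq
  have hga : adjoint g = g := (isSelfAdjoint_opFun _ _).adjoint_eq
  have hKv : ‖K v‖ ≤ ‖v‖ := by simpa using hK' v
  have hRN : ∀ x, R (N x) = N (R x) := opFun_comm_apply h.spec h.residual_cont h.k_cont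
  -- Formally `D = T Q⁻¹`, with `Q⁻¹` unbounded. On the dense range of `Q` both sides are computed
  -- through `D Q = T`, and continuity extends the identity.
  have hident : Q (g (adjoint T (D v))) - v = - L (R (K v)) := by
    have h1 : ∀ w, (Q ∘L g ∘L adjoint T ∘L D - 1) w = (- (L ∘L R ∘L K)) w := by
      refine eq_of_denseRange h.denseRange_Q fun x => ?_
      simp only [sub_apply, comp_apply, neg_apply, one_apply_eq_self, hD, hK, hRN, hL]
      have h2 : g (adjoint T (T x)) = adjoint T (T (iterVec M T α n x)) := h.iterVec_gram x
      rw [h2, ← map_sub, hR, residual_apply h.M_pos h.spec h.α_pos, ← map_neg, neg_sub]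
    exact h1 v
  have hsplit : Q (iterVec M T α n (adjoint T (η + D v))) - v
      = Q (g (adjoint T η)) + - L (R (K v)) := by
    rw [← hident]
    have : iterVec M T α n (adjoint T (η + D v)) = g (adjoint T η) + g (adjoint T (D v)) := by
      simp only [iterVec, map_add]; rfl
    rw [this, map_add]
    abel
  -- `N g T*` is the adjoint of `T g N`, whose norm is controlled by the filter bounds.
  have hNg : ‖N (g (adjoint T η))‖ ≤ √(sigma α n) * k τ * ‖η‖ := by
    have h1 := norm_adjoint_apply_le (F := T ∘L g ∘L N) (by positivity) h.norm_T_filter_k_le η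
    rwa [adjoint_comp, adjoint_comp, hNa, hga, comp_apply, comp_apply] at h1
  -- On the range of `N`, `D L R N = D L N R = D Q R = T R`, and `T R` is bounded by `N`.
  have hDLR : ∀ w, ‖(D ∘L L ∘L R) w‖ ≤ (√(sigma α n) * k τ)⁻¹ * ‖w‖ := by
    refine norm_apply_le_of_denseRange h.denseRange_k fun x => ?_
    rw [comp_apply, comp_apply, hRN, hL, hD]
    exact h.norm_T_residual_le x
  rw [hsplit]
  constructor
  · refine (norm_add_le _ _).trans ?_
    rw [norm_neg, mul_add, ← hL]
    refine add_le_add ((hL' _).trans (mul_le_mul_of_nonneg_left hNg hc)) ((hL' _).trans ?_)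
    exact mul_le_mul_of_nonneg_left ((h.norm_residual_le _).trans hKv) hc
  · rw [map_add, map_neg, hD]
    refine (norm_add_le _ _).trans (add_le_add (h.norm_filter_data_le η) ?_)
    rw [norm_neg]
    exact (hDLR (K v)).trans (mul_le_mul_of_nonneg_left hKv (by positivity))

end ErrorSetup

end ErrorEstimates

/-! ### The interpolation inequality and the lower bound for arbitrary methods. -/

section Interpolation

open ContinuousLinearMap

set_option linter.unusedSectionVars false

variable {𝕜 X Y : Type*} [RCLike 𝕜] [NormedAddCommGroup X] [InnerProductSpace 𝕜 X]
  [CompleteSpace X] [NormedAddCommGroup Y] [InnerProductSpace 𝕜 Y] [CompleteSpace Y]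
  {G : X →L[𝕜] X} {a : ℝ} {ϱ : ℝ → ℝ} {p : ℝ}

theorem re_inner_opFun_affine {S : X →L[𝕜] X} {K : Set ℝ} (hS : SpectrumIn S K) {f : ℝ → ℝ}
    (hf : ContinuousOn f K) (d c : ℝ) (x : X) :
    RCLike.re (inner 𝕜 (opFun (fun t => d + c * f t ^ 2) S x) x)
      = d * ‖x‖ ^ 2 + c * ‖opFun f S x‖ ^ 2 := by
  have hf2 : ContinuousOn (fun t => f t ^ 2) K := hf.pow 2
  rw [opFun_add (g := fun t => c * f t ^ 2) hS continuousOn_const (continuousOn_const.mul hf2), opFun_const hS, opFun_const_mul hS c hf2, add_apply,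
    smul_apply, smul_apply, inner_add_left, inner_smul_left, inner_smul_left, RCLike.conj_ofReal,
    RCLike.conj_ofReal, map_add, RCLike.re_ofReal_mul, RCLike.re_ofReal_mul,
    re_inner_opFun_sq hS hf, one_apply_eq_self, inner_self_eq_norm_sq]

/-- A convex function has a supporting line at interior points. -/
theorem exists_supporting_line {f : ℝ → ℝ} {s : Set ℝ} (hf : ConvexOn ℝ s f) {x : ℝ}
    (hx : x ∈ interior s) : ∃ c, ∀ y ∈ s, f x + c * (y - x) ≤ f y := by
  refine ⟨derivWithin f (Set.Ioi x) x, fun y hy => ?_⟩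
  rcases lt_trichotomy x y with h | rfl | h
  · have h1 := hf.rightDeriv_le_slope_of_mem_interior hx hy h
    rw [slope_def_field, le_div_iff₀ (sub_pos.2 h)] at h1
    linarith
  · simp
  · have h1 := (hf.slope_le_leftDeriv_of_mem_interior hy hx h).trans
      (hf.leftDeriv_le_rightDeriv_of_mem_interior hx)
    rw [slope_def_field, div_le_iff₀ (sub_pos.2 h)] at h1
    linarith

/-- The line supports `ξ_p` at `t₀^{2p}` and is rewritten in the variable `t`. Letting `t → 0` shows
that its intercept is nonpositive, because `ψ_p(0+) = 0`; this in turn forces a positive slope. -/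
theorem exists_supporting_psi (ha : 0 < a) (hϱ : IsIndexFunction ϱ a) (hp : 0 < p)
    (hconv : ConvexOn ℝ (Set.Ioc 0 (a ^ (2 * p))) (fun t => psi ϱ p (t ^ (1 / (2 * p))) ^ 2))
    {t₀ : ℝ} (ht₀ : t₀ ∈ Set.Ioo 0 a) :
    ∃ c, 0 < c ∧ psi ϱ p t₀ ^ 2 ≤ c * (t₀ ^ p) ^ 2 ∧
      ∀ t ∈ Set.Icc 0 a, (psi ϱ p t₀ ^ 2 - c * (t₀ ^ p) ^ 2) + c * (t ^ p) ^ 2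
        ≤ ext0 (psi ϱ p) t ^ 2 := by
  have hψ := hϱ.psi hp
  have h2p : (0 : ℝ) < 2 * p := by linarith
  have hroot : ∀ t : ℝ, 0 ≤ t → (t ^ (2 * p)) ^ (1 / (2 * p)) = t := fun t ht => by
    rw [← Real.rpow_mul ht, mul_one_div_cancel h2p.ne', Real.rpow_one]
  have hsq : ∀ t : ℝ, 0 ≤ t → t ^ (2 * p) = (t ^ p) ^ 2 := fun t ht => by
    rw [two_mul, Real.rpow_add_of_nonneg ht hp.le hp.le, pow_two]
  obtain ⟨c, hc⟩ := exists_supporting_line hconv (x := t₀ ^ (2 * p)) (by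
    rw [interior_Ioc]
    exact ⟨Real.rpow_pos_of_pos ht₀.1 _, Real.rpow_lt_rpow ht₀.1.le ht₀.2 h2p⟩)
  simp only [hroot t₀ ht₀.1.le] at hc
  have h1 : ∀ t ∈ Set.Ioc 0 a, (psi ϱ p t₀ ^ 2 - c * (t₀ ^ p) ^ 2) + c * (t ^ p) ^ 2
      ≤ ext0 (psi ϱ p) t ^ 2 := by
    intro t ht
    have := hc (t ^ (2 * p)) ⟨Real.rpow_pos_of_pos ht.1 _, Real.rpow_le_rpow ht.1.le ht.2 h2p.le⟩
    rw [hroot t ht.1.le, hsq t ht.1.le, hsq t₀ ht₀.1.le] at this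
    rw [ext0_of_pos _ ht.1]
    linarith
  have h2 : ∀ t ∈ Set.Icc 0 a, (psi ϱ p t₀ ^ 2 - c * (t₀ ^ p) ^ 2) + c * (t ^ p) ^ 2
      ≤ ext0 (psi ϱ p) t ^ 2 := by
    have hcl : closure (Set.Ioc 0 a) = Set.Icc 0 a := closure_Ioc ha.ne
    intro t ht
    refine le_on_closure (f := fun t => (psi ϱ p t₀ ^ 2 - c * (t₀ ^ p) ^ 2) + c * (t ^ p) ^ 2)
      (g := fun t => ext0 (psi ϱ p) t ^ 2) h1 ?_ ?_ (by rwa [hcl])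
    · exact continuousOn_const.add (continuousOn_const.mul ((continuousOn_rpow hp.le _).pow 2))
    · rw [hcl]; exact hψ.continuousOn_ext0.pow 2
  have h3 := h2 0 ⟨le_rfl, ha.le⟩
  rw [Real.zero_rpow hp.ne', ext0_zero] at h3
  have h4 := hψ.pos ⟨ht₀.1, ht₀.2.le⟩
  have h5 := Real.rpow_pos_of_pos ht₀.1 p
  refine ⟨c, ?_, by linarith, h2⟩
  by_contra! hc0
  have : c * (t₀ ^ p) ^ 2 ≤ 0 := mul_nonpos_of_nonpos_of_nonneg hc0 (sq_nonneg _)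
  have : 0 < psi ϱ p t₀ ^ 2 := by positivity
  linarith

/-- The interpolation inequality in variable Hilbert scales. -/
theorem norm_opPow_le_of_interpolation (hG : SpectrumIn G (Set.Icc 0 a)) (ha : 0 < a)
    (hϱ : IsIndexFunction ϱ a) (hp : 0 < p)
    (hconv : ConvexOn ℝ (Set.Ioc 0 (a ^ (2 * p))) (fun t => psi ϱ p (t ^ (1 / (2 * p))) ^ 2))
    {t₀ : ℝ} (ht₀ : t₀ ∈ Set.Ioc 0 a) {q : X} {E : ℝ} (hq : ‖q‖ ≤ E)
    (hle : ‖indexOp ϱ G (opPow G p q)‖ ≤ E * psi ϱ p t₀) : ‖opPow G p q‖ ≤ E * t₀ ^ p := by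
  have hE : 0 ≤ E := (norm_nonneg q).trans hq
  -- At `t₀ = a` a supporting line need not exist, but there `‖G^p q‖ ≤ a^p ‖q‖` already suffices.
  rcases ht₀.2.eq_or_lt with rfl | hlt
  · have h1 := norm_opFun_apply_le hG (continuousOn_rpow hp.le _) (Real.rpow_nonneg ha.le p)
      (fun t ht => by
        rw [abs_of_nonneg (Real.rpow_nonneg ht.1 p)]
        exact Real.rpow_le_rpow ht.1 ht.2 hp.le) q
    rw [mul_comm]
    exact h1.trans (mul_le_mul_of_nonneg_left hq (Real.rpow_nonneg ha.le p))
  · obtain ⟨c, hc, h0, hsup⟩ := exists_supporting_psi ha hϱ hp hconv ⟨ht₀.1, hlt⟩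
    have hψ := hϱ.psi hp
    have h1 := re_inner_opFun_mono hG
      (f := fun t => (psi ϱ p t₀ ^ 2 - c * (t₀ ^ p) ^ 2) + c * (t ^ p) ^ 2)
      (g := fun t => ext0 (psi ϱ p) t ^ 2)
      (continuousOn_const.add (continuousOn_const.mul ((continuousOn_rpow hp.le _).pow 2)))
      (hψ.continuousOn_ext0.pow 2) hsup q
    rw [re_inner_opFun_affine hG (continuousOn_rpow hp.le _),
      re_inner_opFun_sq hG hψ.continuousOn_ext0] at h1
    have h2 : indexOp ϱ G (opPow G p q) = opFun (ext0 (psi ϱ p)) G q := by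
      have := indexOp_psi_opPow (ϱ := ϱ) (s := 0) hG (by rwa [psi_zero]) hp.le q
      rwa [psi_zero, add_zero] at this
    rw [h2] at hle
    have h3 : ‖opFun (ext0 (psi ϱ p)) G q‖ ^ 2 ≤ (E * psi ϱ p t₀) ^ 2 :=
      pow_le_pow_left₀ (norm_nonneg _) hle 2
    have h4 : ‖q‖ ^ 2 ≤ E ^ 2 := pow_le_pow_left₀ (norm_nonneg _) hq 2
    have h5 := mul_le_mul_of_nonneg_left h4 (sub_nonneg.2 h0)
    -- The intercept is nonpositive, so `‖q‖²` may be replaced by `E²` in the right direction, and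
    -- the terms with `ψ_p(t₀)²` cancel.
    have h6 : c * ‖opPow G p q‖ ^ 2 ≤ c * (E * t₀ ^ p) ^ 2 := by
      have : opPow G p q = opFun (fun t => t ^ p) G q := rfl
      rw [this]
      nlinarith
    have h7 := le_of_mul_le_mul_left h6 hc
    exact (sq_le_sq₀ (norm_nonneg _)
      (mul_nonneg hE (Real.rpow_nonneg ht₀.1.le p))).1 h7

/-- A continuous bump `f` with `f(t₁) > 0` lives where `ψ_p ≤ 2 ψ_p(t₁)` and `t^p ≥ t₁^p / 2`. Since
`f(t₁)` is a nonzero spectral value of `f(G)`, this operator is not zero, and every vector in its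
range satisfies both inequalities. -/
theorem exists_approx_eigenvector (hG : SpectrumIn G (Set.Icc 0 a))
    (hϱ : IsIndexFunction ϱ a) (hp : 0 < p) {t₁ : ℝ} (ht₁ : t₁ ∈ Set.Ioc 0 a)
    (hmem : (t₁ : 𝕜) ∈ spectrum 𝕜 G) :
    ∃ w : X, w ≠ 0 ∧ ‖indexOp (psi ϱ p) G w‖ ≤ 2 * psi ϱ p t₁ * ‖w‖ ∧
      t₁ ^ p / 2 * ‖w‖ ≤ ‖opPow G p w‖ := by
  have hψ := hϱ.psi hp
  have hψ₁ := hψ.pos ht₁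
  have hp₁ := Real.rpow_pos_of_pos ht₁.1 p
  set f : ℝ → ℝ := fun t => max 0 (min (2 * psi ϱ p t₁ - ext0 (psi ϱ p) t) (t ^ p - t₁ ^ p / 2))
    with hf
  have hfc : ContinuousOn f (Set.Icc 0 a) := ContinuousOn.sup continuousOn_const
    (ContinuousOn.inf (continuousOn_const.sub hψ.continuousOn_ext0)
      ((continuousOn_rpow hp.le _).sub continuousOn_const))
  have hf0 : ∀ t, 0 ≤ f t := fun t => le_max_left _ _
  have hf1 : 0 < f t₁ := by
    refine lt_max_of_lt_right (lt_min ?_ ?_)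
    · rw [ext0_of_pos _ ht₁.1]; linarith
    · linarith
  have hsupp : ∀ t, f t ≠ 0 → ext0 (psi ϱ p) t ≤ 2 * psi ϱ p t₁ ∧ t₁ ^ p / 2 ≤ t ^ p := by
    intro t ht
    have h1 : 0 < f t := lt_of_le_of_ne (hf0 t) (Ne.symm ht)
    rcases lt_max_iff.1 h1 with h | h
    · exact absurd h (lt_irrefl _)
    · obtain ⟨h2, h3⟩ := lt_min_iff.1 h
      exact ⟨by linarith, by linarith⟩
  have hne : opFun f G ≠ 0 := by
    intro h0
    have h1 := (spectrum_opFun hG hfc (f t₁)).2 ⟨t₁, hmem, rfl⟩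
    rw [h0] at h1
    refine h1 ?_
    rw [spectrum.mem_resolventSet_iff, sub_zero]
    exact (IsUnit.mk0 ((f t₁ : ℝ) : 𝕜) (RCLike.ofReal_ne_zero.2 hf1.ne')).map _
  obtain ⟨z, hz⟩ : ∃ z, opFun f G z ≠ 0 := by
    by_contra! h
    exact hne (ContinuousLinearMap.ext h)
  refine ⟨opFun f G z, hz, ?_, ?_⟩
  · rw [indexOp, ← opFun_mul_apply hG hψ.continuousOn_ext0 hfc]
    refine norm_opFun_apply_le_mul (f := fun t => ext0 (psi ϱ p) t * f t) hG
      (hψ.continuousOn_ext0.mul hfc) hfc (by positivity)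
      (fun t ht => ?_) z
    rw [abs_mul, abs_of_nonneg (hψ.ext0_nonneg ht)]
    by_cases h : f t = 0
    · rw [h]; simp
    · exact mul_le_mul_of_nonneg_right (hsupp t h).1 (abs_nonneg _)
  · rw [opPow, ← opFun_mul_apply hG (continuousOn_rpow hp.le _) hfc]
    have h1 := norm_opFun_apply_le_mul (g := fun t => t ^ p * f t) hG hfc
      ((continuousOn_rpow hp.le _).mul hfc)
      (c := (t₁ ^ p / 2)⁻¹) (by positivity) (fun t ht => by
        rw [← div_eq_inv_mul, le_div_iff₀ (by positivity), abs_mul, mul_comm,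
          abs_of_nonneg (Real.rpow_nonneg ht.1 p)]
        by_cases h : f t = 0
        · rw [h]; simp
        · exact mul_le_mul_of_nonneg_right (hsupp t h).2 (abs_nonneg _)) z
    rwa [← div_eq_inv_mul, le_div_iff₀ (by positivity), mul_comm] at h1

theorem mem_smoothSet (hp : 0 < p) {x₀ x v : X} {E : ℝ} (h : x - x₀ = opPow G p v)
    (hv : ‖v‖ ≤ E) : x ∈ smoothSet G x₀ p E :=
  ⟨v, by rw [h]; exact powRel_opPow hp.le v, hv⟩

/-- A lower bound for the worst case error of an arbitrary method. -/
theorem le_worstCaseError (hG : SpectrumIn G (Set.Icc 0 a))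
    (hϱ : IsIndexFunction ϱ a) (hp : 0 < p) {t₁ : ℝ} (ht₁ : t₁ ∈ Set.Ioc 0 a)
    (hmem : (t₁ : 𝕜) ∈ spectrum 𝕜 G) {M E δ : ℝ} (hM : 0 < M) (hE : 0 < E)
    (hδ : δ = M * E * psi ϱ p t₁) {A : X →L[𝕜] Y}
    (hA : ∀ x, ‖A x‖ ≤ M * ‖indexOp ϱ G x‖) (x₀ : X) (R : Y → X) :
    ENNReal.ofReal (E * t₁ ^ p / 4) ≤ worstCaseError A (smoothSet G x₀ p E) δ R := by
  obtain ⟨w, hw, h1, h2⟩ := exists_approx_eigenvector hG hϱ hp ht₁ hmem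
  have hw0 : 0 < ‖w‖ := norm_pos_iff.2 hw
  -- The scaling to norm `E/2` cancels the factor `2` in the bound for `ψ_p(G) w`, so that `‖A u‖ ≤
  -- M E ψ_p(t₁) = δ`.
  set r : ℝ := E / (2 * ‖w‖) with hr
  have hr0 : 0 < r := by positivity
  have hrw : r * ‖w‖ = E / 2 := by rw [hr]; field_simp
  set v : X := (r : 𝕜) • w with hv
  have hnv : ‖v‖ = E / 2 := by
    rw [hv, norm_smul, RCLike.norm_ofReal, abs_of_pos hr0, hrw]
  set u := opPow G p v with hu
  have hnu : E * t₁ ^ p / 4 ≤ ‖u‖ := by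
    rw [hu, hv, map_smul, norm_smul, RCLike.norm_ofReal, abs_of_pos hr0]
    calc E * t₁ ^ p / 4 = r * (t₁ ^ p / 2 * ‖w‖) := by linear_combination (-(t₁ ^ p) / 2) * hrw
      _ ≤ _ := mul_le_mul_of_nonneg_left h2 hr0.le
  have hAu : ‖A u‖ ≤ δ := by
    refine (hA u).trans ?_
    have h3 : indexOp ϱ G u = indexOp (psi ϱ p) G v := by
      have := indexOp_psi_opPow (ϱ := ϱ) (s := 0) hG (by rwa [psi_zero]) hp.le v
      rwa [psi_zero, add_zero] at this
    rw [h3, hv, map_smul, norm_smul, RCLike.norm_ofReal, abs_of_pos hr0, hδ, mul_assoc]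
    refine mul_le_mul_of_nonneg_left ?_ hM.le
    calc r * ‖indexOp (psi ϱ p) G w‖ ≤ r * (2 * psi ϱ p t₁ * ‖w‖) :=
          mul_le_mul_of_nonneg_left h1 hr0.le
      _ = E * psi ϱ p t₁ := by linear_combination (2 * psi ϱ p t₁) * hrw
  -- The data `A x₀` are admissible for both `x₀ + u` and `x₀ - u`, which are `2 ‖u‖` apart, so one
  -- of the two errors is at least `‖u‖`.
  have key : ∀ x ∈ smoothSet G x₀ p E, ‖A x - A x₀‖ ≤ δ →
      ENNReal.ofReal ‖R (A x₀) - x‖ ≤ worstCaseError A (smoothSet G x₀ p E) δ R := by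
    intro x hx hy
    rw [worstCaseError]
    exact le_iSup_of_le x (le_iSup_of_le hx (le_iSup_of_le (A x₀) (le_iSup_of_le hy le_rfl)))
  have hp1 := key (x₀ + u) (mem_smoothSet hp (v := v) (by rw [add_sub_cancel_left])
    (by rw [hnv]; linarith)) (by rwa [← map_sub, add_sub_cancel_left])
  have hp2 := key (x₀ - u) (mem_smoothSet hp (v := -v) (by rw [map_neg, sub_sub_cancel_left])
    (by rw [norm_neg, hnv]; linarith)) (by rwa [← map_sub, sub_sub_cancel_left, map_neg, norm_neg])
  have htri : 2 * ‖u‖ ≤ ‖R (A x₀) - (x₀ + u)‖ + ‖R (A x₀) - (x₀ - u)‖ := by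
    have h4 := norm_sub_le (R (A x₀) - (x₀ - u)) (R (A x₀) - (x₀ + u))
    have h5 : R (A x₀) - (x₀ - u) - (R (A x₀) - (x₀ + u)) = (2 : 𝕜) • u := by
      rw [two_smul]; abel
    rw [h5, norm_smul, RCLike.norm_ofNat] at h4
    linarith
  rcases le_total ‖u‖ ‖R (A x₀) - (x₀ + u)‖ with h | h
  · exact (ENNReal.ofReal_le_ofReal (hnu.trans h)).trans hp1
  · exact (ENNReal.ofReal_le_ofReal (hnu.trans (by linarith))).trans hp2

end Interpolation

/-! ### Inserting the parameter choice and matching the bounds. -/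

section Optimality

open ContinuousLinearMap

set_option linter.unusedSectionVars false

variable {𝕜 X Y : Type*} [RCLike 𝕜] [NormedAddCommGroup X] [InnerProductSpace 𝕜 X]
  [CompleteSpace X] [NormedAddCommGroup Y] [InnerProductSpace 𝕜 Y] [CompleteSpace Y]
  {G : X →L[𝕜] X} {a : ℝ} {ϱ : ℝ → ℝ} {p s m M E δ t₀ : ℝ} {A T : X →L[𝕜] Y} {α : ℕ → ℝ} {n : ℕ}

/-- The order conditions of the low or high order case with exponent `q = |p - s|`. -/
structure OrderCondition (𝕜 X : Type*) [RCLike 𝕜] [NormedAddCommGroup X] [InnerProductSpace 𝕜 X]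
    [CompleteSpace X] (ϱ : ℝ → ℝ) (a s q : ℝ) : Prop where
  nonneg : 0 ≤ q
  monotone : ∃ φ, IsOperatorMonotone 𝕜 X φ (psi ϱ s a ^ 2) ∧
    ∀ t ∈ Set.Ioc 0 (psi ϱ s a ^ 2), φ t = invPow (psi ϱ s) a q t ^ 2
  anti : AntitoneOn (fun t => invPow (psi ϱ s) a q t / √t) (Set.Ioc 0 (psi ϱ s a ^ 2))

theorem orderCondition_high (hϱ : IsIndexFunction ϱ a) (hψ : IsIndexFunction (psi ϱ s) a)
    (ha : 0 < a) (hp : 0 < p) (hps : p ≤ s)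
    (hw : IsOperatorMonotone 𝕜 X (fun t => wFun ϱ a s p t ^ 2) (psi ϱ s a ^ 2)) :
    OrderCondition 𝕜 X ϱ a s (s - p) where
  nonneg := sub_nonneg.2 hps
  monotone := ⟨_, hw, fun t ht => by rw [wFun_eq_invPow hψ ha p ht]⟩
  anti := antitoneOn_invPow_div_sqrt hϱ hψ ha hp

theorem orderCondition_low (hsp : s ≤ p)
    (hh : IsOperatorMonotone 𝕜 X (fun t => hFun ϱ a s p t ^ 2) (psi ϱ s a ^ 2))
    (hanti : AntitoneOn (fun t => hFun ϱ a s p t / √t) (Set.Ioc 0 (psi ϱ s a ^ 2))) :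
    OrderCondition 𝕜 X ϱ a s (p - s) where
  nonneg := sub_nonneg.2 hsp
  monotone := ⟨_, hh, fun t ht => by rw [hFun_eq_invPow ϱ a s p ht.1]⟩
  anti := hanti.congr fun t ht => by simp only [hFun_eq_invPow ϱ a s p ht.1]

/-- The choice `τ = (m/M)² ψ_s(t₀)²` makes `M² τ = 1/σ_n`. As `k(ψ_s(t₀)²) = t₀^q`, the two growth
properties of `k` locate `k(τ)` between `(m/M) t₀^q` and `t₀^q`. -/
theorem errorSetup (hG : SpectrumIn G (Set.Icc 0 a)) (hinj : ∀ x, G x = 0 → x = 0) (ha : 0 < a)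
    (hψ : IsIndexFunction (psi ϱ s) a) (hm : 0 < m) (hmM : m ≤ M)
    (hT₁ : ∀ x, m * ‖indexOp (psi ϱ s) G x‖ ≤ ‖T x‖)
    (hT₂ : ∀ x, ‖T x‖ ≤ M * ‖indexOp (psi ϱ s) G x‖)
    {q : ℝ} (hq : OrderCondition 𝕜 X ϱ a s q) (hα : ∀ k ∈ Finset.Icc 1 n, 0 < α k)
    (ht₀ : t₀ ∈ Set.Ioc 0 a) (hσ : (sigma α n)⁻¹ = m ^ 2 * psi ϱ s t₀ ^ 2) :
    ErrorSetup M (psi ϱ s a ^ 2) (M / m) ((m / M) ^ 2 * psi ϱ s t₀ ^ 2) T α n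
      (invPow (psi ϱ s) a q) (opPow G q) ∧
    m / M * t₀ ^ q ≤ invPow (psi ϱ s) a q ((m / M) ^ 2 * psi ϱ s t₀ ^ 2) ∧
    invPow (psi ϱ s) a q ((m / M) ^ 2 * psi ϱ s t₀ ^ 2) ≤ t₀ ^ q := by
  have hM := hm.trans_le hmM
  have hr0 : 0 < m / M := div_pos hm hM
  have hr1 : m / M ≤ 1 := div_le_one_of_le₀ hmM hM.le
  have hψ₀ := hψ.pos ht₀
  obtain ⟨φ, hφ, hφk⟩ := hq.monotone
  have hmem : psi ϱ s t₀ ^ 2 ∈ Set.Ioc 0 (psi ϱ s a ^ 2) :=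
    ⟨by positivity, pow_le_pow_left₀ hψ₀.le
      (hψ.strictMonoOn.monotoneOn ht₀ ⟨ha, le_rfl⟩ ht₀.2) 2⟩
  have hle : (m / M) ^ 2 * psi ϱ s t₀ ^ 2 ≤ psi ϱ s t₀ ^ 2 :=
    mul_le_of_le_one_left (sq_nonneg _) (pow_le_one₀ hr0.le hr1)
  have hτ : (m / M) ^ 2 * psi ϱ s t₀ ^ 2 ∈ Set.Ioc 0 (psi ϱ s a ^ 2) :=
    ⟨by positivity, hle.trans hmem.2⟩
  have heq := norm_equivalence hG ha hψ hm hmM hT₁ hT₂ hq.nonneg hφ hφk hq.anti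
  have hmono := hψ.invPow_monotoneOn ha hq.nonneg
  have hk := hψ.invPow_apply_of_pos q ht₀
  refine ⟨?_, ?_, ?_⟩
  · exact
    { M_pos := hM
      spec := spectrumIn_gramOp hG ha hψ hM hT₂
      k_cont := hψ.invPow_continuousOn ha hq.nonneg
      k_mono := hmono
      k_anti := hq.anti
      k_nonneg := fun t ht => invPow_nonneg hψ ha q ht
      Q_sa := isSelfAdjoint_opPow G q
      Q_inj := opPow_injective hG hinj hq.nonneg
      c_nonneg := div_nonneg hM.le hm.le
      le_Q := fun x => (heq x).1
      Q_le := fun x => (heq x).2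
      α_pos := hα
      σ_pos := by
        rw [← inv_pos, hσ]; positivity
      τ_mem := hτ
      τ_eq := by
        have h1 : M ^ 2 * ((m / M) ^ 2 * psi ϱ s t₀ ^ 2) = (sigma α n)⁻¹ := by
          rw [hσ]; field_simp
        rw [h1]
        -- `σ_n = 0` is excluded: its inverse would be `0` by convention, against the positive value
        -- in `hσ`.
        refine mul_inv_cancel₀ fun h0 => ?_
        rw [h0, inv_zero] at hσ
        have : 0 < m ^ 2 * psi ϱ s t₀ ^ 2 := by positivity
        linarith
      kτ_pos := hψ.invPow_pos ha q hτ }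
  · rw [← hk]
    exact mul_le_of_antitoneOn_div_sqrt hq.anti hmem hr0 hr1
  · rw [← hk]
    exact hmono ⟨hτ.1.le, hτ.2⟩ ⟨hmem.1.le, hmem.2⟩ hle

theorem psi_eq_rpow_mul (ϱ : ℝ → ℝ) (p s : ℝ) {t : ℝ} (ht : 0 < t) :
    psi ϱ p t = t ^ (p - s) * psi ϱ s t := by
  rw [psi, psi, ← mul_assoc, ← Real.rpow_add ht, sub_add_cancel]

theorem sqrt_sigma_eq (hψ₀ : 0 < psi ϱ s t₀) (hm : 0 < m)
    (hσ : (sigma α n)⁻¹ = m ^ 2 * psi ϱ s t₀ ^ 2) : √(sigma α n) = (m * psi ϱ s t₀)⁻¹ := by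
  rw [← inv_inv (sigma α n), hσ, ← mul_pow, Real.sqrt_inv, Real.sqrt_sq (by positivity)]

/-- In the low order case `B^s G^p v = G^{p-s} v`, so the error is analysed in `ζ` with `Q =
G^{p-s}`. In the high order case `G^s = G^p G^{s-p}`, so a factor `G^p` is split off and `Q =
G^{s-p}` acts on `ζ`. -/
theorem exists_error_repr (hG : SpectrumIn G (Set.Icc 0 a)) (hinj : ∀ x, G x = 0 → x = 0)
    (ha : 0 < a) (hψ : IsIndexFunction (psi ϱ s) a) (hm : 0 < m) (hmM : m ≤ M) (hE : 0 < E)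
    (hp : 0 < p) (hAT : IsScaled G s A T)
    (hT₁ : ∀ x, m * ‖indexOp (psi ϱ s) G x‖ ≤ ‖T x‖)
    (hT₂ : ∀ x, ‖T x‖ ≤ M * ‖indexOp (psi ϱ s) G x‖)
    (hcase : (p ≤ s ∧ OrderCondition 𝕜 X ϱ a s (s - p)) ∨
      (s ≤ p ∧ OrderCondition 𝕜 X ϱ a s (p - s)))
    (hα : ∀ k ∈ Finset.Icc 1 n, 0 < α k)
    (ht₀ : t₀ ∈ Set.Ioc 0 a) (hδ : δ = m * E * psi ϱ p t₀)
    (hσ : (sigma α n)⁻¹ = m ^ 2 * psi ϱ s t₀ ^ 2) {x₀ x xd : X} {y : Y}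
    (hx : IsIterate A G s x₀ α n y x) (hxd : xd ∈ smoothSet G x₀ p E) (hy : ‖A xd - y‖ ≤ δ) :
    ∃ q : X, x - xd = opPow G p q ∧ ‖q‖ ≤ 2 * (M / m) * E ∧
      ‖A (x - xd)‖ ≤ (1 + M / m) * δ := by
  have hM := hm.trans_le hmM
  have hψ₀ := hψ.pos ht₀
  have hS := spectrumIn_gramOp hG ha hψ hM hT₂
  have hz := hx.powRel hG hinj hM hS hAT hα
  obtain ⟨v, hv, hvE⟩ := hxd
  have hxv := hv.1 hp.le
  set η := y - A xd with hη
  have hηδ : ‖η‖ ≤ δ := by rwa [hη, norm_sub_rev]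
  have hη0 := norm_nonneg η
  have hyη : y - A x₀ = η + A (opPow G p v) := by
    rw [hxv, hη, map_sub]; abel
  rw [hyη] at hz
  -- From here `√σ_n = 1/(m ψ)`, `δ = m E P ψ`, and `k(τ)` is comparable to `P` (low order) or `1/P`
  -- (high order); all powers of `t₀` cancel in the bounds.
  have hsq := sqrt_sigma_eq hψ₀ hm hσ
  have hP := Real.rpow_pos_of_pos ht₀.1 (p - s)
  rw [psi_eq_rpow_mul ϱ p s ht₀.1] at hδ
  set P := t₀ ^ (p - s) with hPdef
  set ψ := psi ϱ s t₀ with hψdef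
  have hc : 0 < M / m := div_pos hM hm
  rcases hcase with ⟨hps, hq⟩ | ⟨hsp, hq⟩
  · obtain ⟨hset, hk₁, hk₂⟩ := errorSetup hG hinj ha hψ hm hmM hT₁ hT₂ hq hα ht₀ hσ
    have hkpos := hset.kτ_pos
    have hPinv : t₀ ^ (s - p) = P⁻¹ := by rw [hPdef, ← Real.rpow_neg ht₀.1.le, neg_sub]
    rw [hPinv] at hk₁ hk₂
    have hs : 0 ≤ s := hp.le.trans hps
    have hpow : ∀ z, opPow G s z = opPow G p (opPow G (s - p) z) := fun z => by
      rw [← opPow_add hG hp.le hq.nonneg, add_sub_cancel]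
    obtain ⟨h1, h2⟩ := hset.error_high (D := A ∘L opPow G p) (fun z => by
      rw [comp_apply, ← hpow]; exact hAT _ _ (powRel_opPow hs z)) v η
    rw [comp_apply] at h1 h2
    have hrepr : x - xd = opPow G p (opPow G (s - p)
        (iterVec M T α n (adjoint T (η + A (opPow G p v)))) - v) := by
      rw [map_sub, ← hpow, hz.1 hs, hxv]; abel
    refine ⟨_, hrepr, h1.trans ?_, ?_⟩
    · rw [hsq]
      have h3 : (m * ψ)⁻¹ * invPow (psi ϱ s) a (s - p) ((m / M) ^ 2 * ψ ^ 2) * ‖η‖ ≤ E := by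
        calc _ ≤ (m * ψ)⁻¹ * P⁻¹ * δ := by gcongr
          _ = E := by rw [hδ]; field_simp
      calc M / m * (_ + ‖v‖) ≤ M / m * (E + E) := by gcongr
        _ = _ := by ring
    · rw [hrepr]
      refine h2.trans ?_
      rw [hsq]
      have h3 : ((m * ψ)⁻¹ * invPow (psi ϱ s) a (s - p) ((m / M) ^ 2 * ψ ^ 2))⁻¹ * ‖v‖
          ≤ M / m * δ := by
        calc _ ≤ ((m * ψ)⁻¹ * (m / M * P⁻¹))⁻¹ * E := by gcongr
          _ = M / m * δ := by rw [hδ]; field_simp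
      linarith
  · obtain ⟨hset, hk₁, hk₂⟩ := errorSetup hG hinj ha hψ hm hmM hT₁ hT₂ hq hα ht₀ hσ
    have hkpos := hset.kτ_pos
    have hrel : ∀ w, PowRel G s (opPow G p w) (opPow G (p - s) w) := fun w => by
      refine ⟨fun hs => ?_, fun hs => ?_⟩
      · rw [← opPow_add hG hs hq.nonneg, add_sub_cancel]
      · rw [← opPow_add hG (by linarith) hp.le, neg_add_eq_sub]
    rw [hAT _ _ (hrel v)] at hz
    obtain ⟨q, hq1, hq2, hq3⟩ := hset.error_low v η
    have h1 := hz.sub (hxv ▸ hrel v)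
    rw [hq1, sub_sub_sub_cancel_right] at h1
    refine ⟨q, h1.left_unique hG hinj (hrel q), hq2.trans ?_, ?_⟩
    · rw [hsq]
      have h3 : (m * ψ)⁻¹ / invPow (psi ϱ s) a (p - s) ((m / M) ^ 2 * ψ ^ 2) * ‖η‖
          ≤ M / m * E := by
        calc _ ≤ (m * ψ)⁻¹ / (m / M * P) * δ := by gcongr
          _ = M / m * E := by rw [hδ]; field_simp
      have h4 : M / m * ‖v‖ ≤ M / m * E := by gcongr
      linarith
    · rw [hAT _ _ h1]
      refine hq3.trans ?_
      rw [hsq]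
      have h3 : invPow (psi ϱ s) a (p - s) ((m / M) ^ 2 * ψ ^ 2) / (m * ψ)⁻¹ * (M / m * ‖v‖)
          ≤ M / m * δ := by
        calc _ ≤ P / (m * ψ)⁻¹ * (M / m * E) := by gcongr
          _ = M / m * δ := by rw [hδ]; field_simp
      linarith

/-- The error bound `‖x_n - x†‖ ≤ 2 (M/m) E [ψ_p⁻¹(δ/(mE))]^p`. -/
theorem norm_error_le (hG : SpectrumIn G (Set.Icc 0 a)) (ha : 0 < a)
    (hϱ : IsIndexFunction ϱ a) (hp : 0 < p) (hm : 0 < m) (hmM : m ≤ M)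
    (hconv : ConvexOn ℝ (Set.Ioc 0 (a ^ (2 * p))) (fun t => psi ϱ p (t ^ (1 / (2 * p))) ^ 2))
    (hA : ∀ x, m * ‖indexOp ϱ G x‖ ≤ ‖A x‖) (hE : 0 < E)
    (ht₀ : t₀ ∈ Set.Ioc 0 a) (hδ : δ = m * E * psi ϱ p t₀) {e q : X} (he : e = opPow G p q)
    (hq : ‖q‖ ≤ 2 * (M / m) * E) (hAe : ‖A e‖ ≤ (1 + M / m) * δ) :
    ‖e‖ ≤ 2 * (M / m) * E * t₀ ^ p := by
  rw [he]
  refine norm_opPow_le_of_interpolation hG ha hϱ hp hconv ht₀ hq ?_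
  rw [← he]
  have h1 := (hA e).trans hAe
  -- Since `1 + M/m ≤ 2 M/m`, both error bounds fit the interpolation inequality with the common
  -- radius `2 (M/m) E`.
  have h2 : 1 ≤ M / m := (one_le_div₀ hm).2 hmM
  have h3 := (hϱ.psi hp).pos ht₀
  refine le_of_mul_le_mul_left (h1.trans ?_) hm
  rw [hδ]
  have h4 : 0 < m * E * psi ϱ p t₀ := by positivity
  nlinarith

theorem worstCaseError_le {S : Set X} {R : Y → X} {c : ℝ}
    (h : ∀ x ∈ S, ∀ y, ‖A x - y‖ ≤ δ → ‖R y - x‖ ≤ c) :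
    worstCaseError A S δ R ≤ ENNReal.ofReal c :=
  iSup₂_le fun x hx => iSup₂_le fun y hy => ENNReal.ofReal_le_ofReal (h x hx y hy)

/-- `t₁ ≤ t₀` because `m ≤ M`, so replacing `ϱ(t₁)` by the larger `ϱ(t₀)` lets the factor `ϱ`
cancel. -/
theorem rpow_le_of_psi (hϱ : IsIndexFunction ϱ a) (hp : 0 < p) (hm : 0 < m) (hmM : m ≤ M)
    {t₁ : ℝ} (ht₀ : t₀ ∈ Set.Ioc 0 a) (ht₁ : t₁ ∈ Set.Ioc 0 a)
    (h : m * psi ϱ p t₀ = M * psi ϱ p t₁) : t₀ ^ p ≤ M / m * t₁ ^ p := by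
  have hψ := hϱ.psi hp
  have h0 := hψ.pos ht₀
  have h1 := hψ.pos ht₁
  have hle : t₁ ≤ t₀ := by
    rw [← hψ.strictMonoOn.le_iff_le ht₁ ht₀]
    nlinarith
  have hϱle := hϱ.strictMonoOn.monotoneOn ht₁ ht₀ hle
  have hϱ0 := hϱ.pos ht₀
  rw [psi, psi] at h
  rw [div_mul_eq_mul_div, le_div_iff₀ hm]
  refine le_of_mul_le_mul_right ?_ hϱ0
  have hp1 := Real.rpow_pos_of_pos ht₁.1 p
  calc t₀ ^ p * m * ϱ t₀ = M * (t₁ ^ p * ϱ t₁) := by rw [← h]; ring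
    _ ≤ M * (t₁ ^ p * ϱ t₀) := by have := hm.trans_le hmM; gcongr
    _ = _ := by ring

theorem exists_spectrum_of_indexOp (hG : SpectrumIn G (Set.Icc 0 a)) (hϱ : IsIndexFunction ϱ a)
    (hp : 0 < p) {c : ℝ} (hc : 0 < c) (h : (c : 𝕜) ∈ spectrum 𝕜 (indexOp (psi ϱ p) G)) :
    ∃ t ∈ Set.Ioc 0 a, (t : 𝕜) ∈ spectrum 𝕜 G ∧ psi ϱ p t = c := by
  obtain ⟨t, ht, htc⟩ := (spectrum_opFun hG (hϱ.psi hp).continuousOn_ext0 c).1 h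
  have hta := hG.mem t ht
  rcases hta.1.eq_or_lt with rfl | h0
  · rw [ext0_zero] at htc; exact absurd htc hc.ne
  · exact ⟨t, ⟨h0, hta.2⟩, ht, by rw [← htc, ext0_of_pos _ h0]⟩

end Optimality

end HilbertScale

/-! ### The main theorem. -/

open HilbertScale
theorem theorem3p6 (m M E : ℝ) (hm : 0 < m) (hmM : m ≤ M) (hE : 0 < E) :
    ∃ c₁ c₂ C : ℝ, 0 < c₁ ∧ 0 < c₂ ∧ 0 < C ∧
      ∀ (𝕜 X Y : Type*) [RCLike 𝕜]
        [NormedAddCommGroup X] [InnerProductSpace 𝕜 X] [CompleteSpace X]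
        [NormedAddCommGroup Y] [InnerProductSpace 𝕜 Y] [CompleteSpace Y]
        (A : X →L[𝕜] Y) (_ : Function.Injective A) (_ : ¬ IsClosed (Set.range A))
        (B : X →ₗ.[𝕜] X) (_ : IsScaleGenerator B)
        (G : X →L[𝕜] X) (_ : IsInverse G B)
        (ϱ : ℝ → ℝ) (_ : IsIndexFunction ϱ ‖G‖)
        -- link conditions
        (_ : ∀ x : X, m * ‖indexOp ϱ G x‖ ≤ ‖A x‖)
        (_ : ∀ x : X, ‖A x‖ ≤ M * ‖indexOp ϱ G x‖)
        (p s : ℝ) (_ : 0 < p) (_ : IsIndexFunction (psi ϱ s) ‖G‖)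
        -- high order or low order case, with the monotonicity conditions of that case
        (_ : (p ≤ s ∧
              IsOperatorMonotone 𝕜 X (fun t => wFun ϱ ‖G‖ s p t ^ 2) (psi ϱ s ‖G‖ ^ 2)) ∨
            (s ≤ p ∧
              IsOperatorMonotone 𝕜 X (fun t => hFun ϱ ‖G‖ s p t ^ 2) (psi ϱ s ‖G‖ ^ 2) ∧
              AntitoneOn (fun t => hFun ϱ ‖G‖ s p t / Real.sqrt t)
                (Set.Ioc 0 (psi ϱ s ‖G‖ ^ 2))))
        (_ : ConvexOn ℝ (Set.Ioc 0 (‖G‖ ^ (2 * p))) (fun t => psi ϱ p (t ^ (1 / (2 * p))) ^ 2))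
        (x₀ : X) (n : ℕ) (α : ℕ → ℝ) (_ : ∀ k ∈ Finset.Icc 1 n, 0 < α k)
        -- a priori choice of `σ_n`; the first condition says that its right-hand side is defined
        (δ : ℝ) (_ : 0 < δ) (_ : δ / (m * E) ∈ psi ϱ p '' Set.Ioc 0 ‖G‖)
        (_ : (sigma α n)⁻¹ =
          δ ^ 2 / E ^ 2 * (psiInv ϱ ‖G‖ p (δ / (m * E))) ^ (2 * (s - p))),
        -- the iterate is well defined
        (∀ yδ : Y, ∃! x : X, IsIterate A G s x₀ α n yδ x) ∧
        -- error bound on `M_{p,E}`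
        (c₂ * δ ∈ psi ϱ p '' Set.Ioc 0 ‖G‖ ∧
          ∀ xd ∈ smoothSet G x₀ p E, ∀ yδ : Y, ‖A xd - yδ‖ ≤ δ →
            ∀ x : X, IsIterate A G s x₀ α n yδ x →
              ‖x - xd‖ ≤ c₁ * (psiInv ϱ ‖G‖ p (c₂ * δ)) ^ p) ∧
        -- order optimality on `M_{p,E}`
        (((δ / (M * E) : ℝ) : 𝕜) ∈ spectrum 𝕜 (indexOp (psi ϱ p) G) →
          ∀ R : Y → X, (∀ yδ : Y, IsIterate A G s x₀ α n yδ (R yδ)) →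
            worstCaseError A (smoothSet G x₀ p E) δ R ≤
              ENNReal.ofReal C *
                ⨅ R' : Y → X, worstCaseError A (smoothSet G x₀ p E) δ R') := by
  have hM : 0 < M := hm.trans_le hmM
  -- The value of `C` comes from `2 (M/m) E t₀^p ≤ 2 (M/m)² E t₁^p = 8 (M/m)² · E t₁^p / 4`, the
  -- last factor being the lower bound for every method.
  refine ⟨2 * (M / m) * E, 1 / (m * E), 8 * (M / m) ^ 2, by positivity, by positivity,
    by positivity, ?_⟩
  intro 𝕜 X Y _ _ _ _ _ _ _ A _ _ B hB G hGB ϱ hϱ hA₁ hA₂ p s hp hψ hcase hconv x₀ n α hα δ hδ hδmem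
    hσ
  have hG := hGB.spectrumIn hB
  have hinj := hGB.injective
  obtain ⟨t₀, ht₀, ht₀δ⟩ := hδmem
  have ha : 0 < ‖G‖ := ht₀.1.trans_le ht₀.2
  have hψp := hϱ.psi hp
  have hinv : psiInv ϱ ‖G‖ p (δ / (m * E)) = t₀ := by
    rw [← ht₀δ]; exact hψp.invFunOn_apply ht₀
  have hδ₀ : δ = m * E * psi ϱ p t₀ := by rw [ht₀δ]; field_simp
  -- `δ/E = m ψ_p(t₀)` and `t₀^{s-p} ψ_p(t₀) = ψ_s(t₀)`, so the rule depends only on `ψ_s`.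
  have hσ' : (sigma α n)⁻¹ = m ^ 2 * psi ϱ s t₀ ^ 2 := by
    rw [hσ, hinv, hδ₀, psi_eq_rpow_mul ϱ s p ht₀.1, mul_comm 2 (s - p), Real.rpow_mul ht₀.1.le,
      Real.rpow_two]
    field_simp
  have hc₂ : 1 / (m * E) * δ = δ / (m * E) := by ring
  have hcase' : (p ≤ s ∧ OrderCondition 𝕜 X ϱ ‖G‖ s (s - p)) ∨
      (s ≤ p ∧ OrderCondition 𝕜 X ϱ ‖G‖ s (p - s)) := by
    rcases hcase with ⟨h, hw⟩ | ⟨h, hh, hanti⟩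
    · exact Or.inl ⟨h, orderCondition_high hϱ hψ ha hp h hw⟩
    · exact Or.inr ⟨h, orderCondition_low h hh hanti⟩
  obtain ⟨T, hAT, hT₁, hT₂⟩ := exists_scaled hG hinj hϱ hψ hM hA₁ hA₂
  have hS := spectrumIn_gramOp hG ha hψ hM hT₂
  -- Negative `s` occurs only in the low order case, since `p > 0`.
  have hran := exists_powRel_adjoint hG hinj ha hp hψ hM hT₂ fun hs => by
    rcases hcase' with ⟨h, -⟩ | ⟨-, h⟩
    · linarith
    · exact h.anti
  have herr : ∀ xd ∈ smoothSet G x₀ p E, ∀ yδ : Y, ‖A xd - yδ‖ ≤ δ →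
      ∀ x : X, IsIterate A G s x₀ α n yδ x → ‖x - xd‖ ≤ 2 * (M / m) * E * t₀ ^ p := by
    intro xd hxd yδ hy x hx
    obtain ⟨q, hq, hqn, hAq⟩ := exists_error_repr hG hinj ha hψ hm hmM hE hp hAT hT₁ hT₂ hcase' hα
      ht₀ hδ₀ hσ' hx hxd hy
    exact norm_error_le hG ha hϱ hp hm hmM hconv hA₁ hE ht₀ hδ₀ hq hqn hAq
  refine ⟨fun yδ => existsUnique_isIterate hG hinj hM hS hAT hran hα x₀ yδ,
    ⟨hc₂ ▸ ⟨t₀, ht₀, ht₀δ⟩, ?_⟩, ?_⟩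
  · rw [hc₂, hinv]
    exact herr
  · intro hspec R hR
    obtain ⟨t₁, ht₁, hmem, hψ₁⟩ := exists_spectrum_of_indexOp hG hϱ hp (by positivity) hspec
    have hδ₁ : δ = M * E * psi ϱ p t₁ := by rw [hψ₁]; field_simp
    have hratio := rpow_le_of_psi hϱ hp hm hmM ht₀ ht₁
      (mul_right_cancel₀ hE.ne' (by linarith))
    refine (worstCaseError_le fun x hx y hy => herr x hx y hy (R y) (hR y)).trans ?_
    calc ENNReal.ofReal (2 * (M / m) * E * t₀ ^ p)
        ≤ ENNReal.ofReal (8 * (M / m) ^ 2 * (E * t₁ ^ p / 4)) := by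
          refine ENNReal.ofReal_le_ofReal ?_
          calc 2 * (M / m) * E * t₀ ^ p ≤ 2 * (M / m) * E * (M / m * t₁ ^ p) := by gcongr
            _ = _ := by ring
      _ = ENNReal.ofReal (8 * (M / m) ^ 2) * ENNReal.ofReal (E * t₁ ^ p / 4) :=
          ENNReal.ofReal_mul (by positivity)
      _ ≤ _ := by
          gcongr
          exact le_iInf fun R' => le_worstCaseError hG hϱ hp ht₁ hmem hM hE hδ₁ hA₂ x₀ R'
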